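/- Consider the simply typed $\lambda$-calculus over a signature in which every constant is either free (no axioms) or associative, an associative constant $f$ having a type $\delta\to\delta\to\delta$ with $\delta$ a base type and satisfying $f(a,f(b,c))\equiv f(f(a,b),c)$. There are infinitely many free variables (capital letters) of each type. Terms are taken up to $\alpha$-equivalence; $=_{\mathsf A}$ is equality modulo $\beta$, $\eta$ and associativity. The flattened form $f(t_1,\dots,t_n)$ of a term with an associative head $f$ lists all its maximal arguments $t_i$ whose head is not $f$; $f(t)$ stands for $t$. Write $u\preceq_{\mathsf A}v$ if $u\vartheta=_{\mathsf A}v$ for some (finite, type-preserving) substitution $\vartheta$ of free variables. A term is a higher-order pattern if in its $\eta$-long $\beta$-normal form every free variable is applied to pairwise distinct ($\eta$-long forms of) bound variables. A pattern generalization of $u,v$ modulo associativity is a pattern $r$ with $r\preceq_{\mathsf A}u$ and $r\preceq_{\mathsf A}v$. The rules of $\mathcal G_{\mathsf A}$ act on states $A;S;\sigma$, where $A$ and $S$ are sets of anti-unification problems $X(\bar x):t\triangleq s$ ($\bar x$ distinct bound variables, local to the problem) and $\sigma$ is a substitution. The variables $Y,Y_i,X'$ introduced by Dec, Abs, Sol,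 Dec-A-L and Dec-A-R below are distinct and fresh for the state, and $\uplus$ is disjoint union. * Dec: $\{X(\bar x):h(t_1,\dots,t_m)\triangleq h(s_1,\dots,s_m)\}\uplus A;S;\sigma\Rightarrow\{Y_i(\bar x):t_i\triangleq s_i\mid 1\le i\le m\}\cup A;S;\sigma\{X\mapsto\lambda\bar x.h(Y_1(\bar x),\dots,Y_m(\bar x))\}$, where both sides have basic type and $h$ is a free constant or $h\in\bar x$. * Abs: $\{X(\bar x):\lambda y.t\triangleq\lambda z.s\}\uplus A;S;\sigma\Rightarrow\{X'(\bar x,y):t\triangleq s\{z\mapsto y\}\}\cup A;S;\sigma\{X\mapsto\lambda\bar x,y.X'(\bar x,y)\}$. * Sol: $\{X(\bar x):t\triangleq s\}\uplus A;S;\sigma\Rightarrow A;\{Y(\bar y):t\triangleq s\}\cup S;\sigma\{X\mapsto\lambda\bar x.Y(\bar y)\}$, where $t,s$ have basic type, their heads differ or are the same free variable, and $\bar y$ is the subsequence of $\bar x$ of the variables occurring free in $t$ or $s$. * Mer: $A;\{X(\bar x):t_1\triangleq t_2,\ Y(\bar y):s_1\triangleq s_2\}\uplus S;\sigma\Rightarrow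 A;\{X(\bar x):t_1\triangleq t_2\}\cup S;\sigma\{Y\mapsto\lambda\bar y.X(\bar x\pi)\}$, where $\pi:\{\bar x\}\to\{\bar y\}$ is a type-preserving bijection with $t_1\pi=_{\mathsf A}s_1$ and $t_2\pi=_{\mathsf A}s_2$. * Dec-A-L: for $f$ associative, $n,m\ge2$, $1\le k\le n-1$ and flattened sides, $\{X(\bar x):f(t_1,\dots,t_n)\triangleq f(s_1,\dots,s_m)\}\uplus A;S;\sigma\Rightarrow\{Y_1(\bar x):f(t_1,\dots,t_k)\triangleq s_1,\ Y_2(\bar x):f(t_{k+1},\dots,t_n)\triangleq f(s_2,\dots,s_m)\}\cup A;S;\sigma\{X\mapsto\lambda\bar x.f(Y_1(\bar x),Y_2(\bar x))\}$. * Dec-A-R: for $f$ associative, $n,m\ge2$, $1\le k\le m-1$ and flattened sides, $\{X(\bar x):f(t_1,\dots,t_n)\triangleq f(s_1,\dots,s_m)\}\uplus A;S;\sigma\Rightarrow\{Y_1(\bar x):t_1\triangleq f(s_1,\dots,s_k),\ Y_2(\bar x):f(t_2,\dots,t_n)\triangleq f(s_{k+1},\dots,s_m)\}\cup A;S;\sigma\{X\mapsto\lambda\bar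 x.f(Y_1(\bar x),Y_2(\bar x))\}$. **Theorem (completeness of $\mathcal G_{\mathsf A}$).** Let $\lambda\bar x.t_1$ and $\lambda\bar x.t_2$ be terms of the same type, with $t_1,t_2$ in $\eta$-long $\beta$-normal form, and let $X$ be a free variable of that type that does not occur in $t_1,t_2$. 1. If $\lambda\bar x.s$ is a higher-order pattern that generalizes $\lambda\bar x.t_1$ and $\lambda\bar x.t_2$ modulo associativity, then there is a transformation sequence $\{X(\bar x):t_1\triangleq t_2\};\emptyset;\emptyset\Rightarrow^*\emptyset;S;\sigma$ in $\mathcal G_{\mathsf A}$ with $\lambda\bar x.s\preceq_{\mathsf A}X\sigma$. 2. The terms $X\sigma$ so computed form a complete set of pattern generalizations modulo associativity: in addition to 1, for every transformation sequence $\{X(\bar x):t_1\triangleq t_2\};\emptyset;\emptyset\Rightarrow^*\emptyset;S;\sigma$ in $\mathcal G_{\mathsf A}$, the term $X\sigma$ is a higher-order pattern generalization of $\lambda\bar x.t_1$ and $\lambda\bar x.t_2$ modulo associativity. -/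

import Mathlib

/-!
Higher-order pattern generalization modulo associativity for simply typed lambda terms.

Lower-case (bound) variables are de Bruijn indices, so terms are identified up to renaming of bound
variables.  Capital (free) variables are pairs of a type and a natural number.  Terms are
intrinsically typed.
-/

universe u

namespace AntiUnif

/-- Simple types over a type `B` of base types. -/
inductive Ty (B : Type u) : Type u
  | base : B → Ty B
  | arr : Ty B → Ty B → Ty B

/-- The type of functions that take arguments of the types listed in `Γ` (innermost, i.e. last,
argument first in the list) and return a value of type `τ`. -/
def arrows {B : Type u} : List (Ty B) → Ty B → Ty B
  | [], τ => τ
  | σ :: Γ, τ => arrows Γ (.arr σ τ)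

/-- A signature in which every constant is either free (`Ax(c) = ∅`) or associative
(`Ax(f) = {A}`).  An associative constant has a type `b → b → b` with `b` basic. -/
structure Sig where
  Base : Type u
  free : Ty Base → Type u
  assoc : Base → Type u

/-- Bound variables of type `τ` in the context `Γ` (de Bruijn indices). -/
inductive Var {B : Type u} : List (Ty B) → Ty B → Type u
  | zero {Γ : List (Ty B)} {τ : Ty B} : Var (τ :: Γ) τ
  | succ {Γ : List (Ty B)} {σ τ : Ty B} : Var Γ τ → Var (σ :: Γ) τ

/-- Type-preserving renamings of bound variables. -/
abbrev Ren {B : Type u} (Γ Δ : List (Ty B)) : Type u := ∀ τ, Var Γ τ → Var Δ τ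

/-- A renaming extended to one more bound variable. -/
def Ren.lift {B : Type u} {Γ Δ : List (Ty B)} (ρ : Ren Γ Δ) (σ : Ty B) :
    Ren (σ :: Γ) (σ :: Δ)
  | _, .zero => .zero
  | _, .succ x => .succ (ρ _ x)

/-- The only renaming of the empty context. -/
def Ren.empty {B : Type u} (Γ : List (Ty B)) : Ren [] Γ := fun _ x => nomatch x

/-- `Thin Δ Γ`: a way to see the sequence of bound variables `Δ` as a subsequence of `Γ`. -/
inductive Thin {B : Type u} : List (Ty B) → List (Ty B) → Type u
  | nil : Thin [] []
  | keep {Δ Γ : List (Ty B)} {σ : Ty B} : Thin Δ Γ → Thin (σ :: Δ) (σ :: Γ)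
  | drop {Δ Γ : List (Ty B)} {σ : Ty B} : Thin Δ Γ → Thin Δ (σ :: Γ)

/-- The inclusion of a subsequence of bound variables. -/
def Thin.ren {B : Type u} : {Δ Γ : List (Ty B)} → Thin Δ Γ → Ren Δ Γ
  | _, _, .nil => Ren.empty []
  | _, _, .keep (σ := σ) ι => (Thin.ren ι).lift σ
  | _, _, .drop ι => fun _ x => .succ (Thin.ren ι _ x)

/-- A free variable: a type together with a name; there are infinitely many of each type. -/
abbrev FVar (𝒮 : Sig.{u}) : Type u := (_ : Ty 𝒮.Base) × ℕ

/-- Simply typed lambda terms of type `τ` whose dangling bound variables are those of `Γ`. -/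
inductive Tm (𝒮 : Sig.{u}) : List (Ty 𝒮.Base) → Ty 𝒮.Base → Type u
  | bvar {Γ : List (Ty 𝒮.Base)} {τ : Ty 𝒮.Base} : Var Γ τ → Tm 𝒮 Γ τ
  | fvar {Γ : List (Ty 𝒮.Base)} {τ : Ty 𝒮.Base} : ℕ → Tm 𝒮 Γ τ
  | con {Γ : List (Ty 𝒮.Base)} {τ : Ty 𝒮.Base} : 𝒮.free τ → Tm 𝒮 Γ τ
  | acon {Γ : List (Ty 𝒮.Base)} {b : 𝒮.Base} :
      𝒮.assoc b → Tm 𝒮 Γ (.arr (.base b) (.arr (.base b) (.base b)))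
  | lam {Γ : List (Ty 𝒮.Base)} {σ τ : Ty 𝒮.Base} : Tm 𝒮 (σ :: Γ) τ → Tm 𝒮 Γ (.arr σ τ)
  | app {Γ : List (Ty 𝒮.Base)} {σ τ : Ty 𝒮.Base} :
      Tm 𝒮 Γ (.arr σ τ) → Tm 𝒮 Γ σ → Tm 𝒮 Γ τ

namespace Tm

variable {𝒮 : Sig.{u}}

/-- Renaming of bound variables. -/
def rename : {Γ Δ : List (Ty 𝒮.Base)} → {τ : Ty 𝒮.Base} → Ren Γ Δ → Tm 𝒮 Γ τ → Tm 𝒮 Δ τ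
  | _, _, _, ρ, .bvar x => .bvar (ρ _ x)
  | _, _, _, _, .fvar n => .fvar n
  | _, _, _, _, .con c => .con c
  | _, _, _, _, .acon f => .acon f
  | _, _, _, ρ, .lam t => .lam (rename (ρ.lift _) t)
  | _, _, _, ρ, .app t v => .app (rename ρ t) (rename ρ v)

/-- Weakening by one bound variable. -/
def wk {Γ : List (Ty 𝒮.Base)} {σ τ : Ty 𝒮.Base} (t : Tm 𝒮 Γ τ) : Tm 𝒮 (σ :: Γ) τ :=
  t.rename (fun _ x => x.succ)

/-- An assignment of terms to bound variables, extended to one more bound variable. -/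
def liftEnv {Γ Δ : List (Ty 𝒮.Base)} (e : ∀ τ, Var Γ τ → Tm 𝒮 Δ τ) (σ : Ty 𝒮.Base) :
    ∀ τ, Var (σ :: Γ) τ → Tm 𝒮 (σ :: Δ) τ
  | _, .zero => .bvar .zero
  | _, .succ x => (e _ x).wk

/-- Simultaneous capture-avoiding replacement of the dangling bound variables. -/
def bsubst : {Γ Δ : List (Ty 𝒮.Base)} → {τ : Ty 𝒮.Base} →
    (∀ τ, Var Γ τ → Tm 𝒮 Δ τ) → Tm 𝒮 Γ τ → Tm 𝒮 Δ τ
  | _, _, _, e, .bvar x => e _ x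
  | _, _, _, _, .fvar n => .fvar n
  | _, _, _, _, .con c => .con c
  | _, _, _, _, .acon f => .acon f
  | _, _, _, e, .lam t => .lam (bsubst (liftEnv e _) t)
  | _, _, _, e, .app t v => .app (bsubst e t) (bsubst e v)

/-- The assignment that sends the last bound variable to `v` and fixes all others. -/
def instEnv {Γ : List (Ty 𝒮.Base)} {σ : Ty 𝒮.Base} (v : Tm 𝒮 Γ σ) :
    ∀ τ, Var (σ :: Γ) τ → Tm 𝒮 Γ τ
  | _, .zero => v
  | _, .succ x => .bvar x

/-- `t{x ↦ v}` for the last bound variable `x` of `t`. -/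
def inst {Γ : List (Ty 𝒮.Base)} {σ τ : Ty 𝒮.Base} (t : Tm 𝒮 (σ :: Γ) τ) (v : Tm 𝒮 Γ σ) :
    Tm 𝒮 Γ τ :=
  t.bsubst (instEnv v)

/-- The term `f(v, w)` for an associative constant `f`. -/
def bin {Γ : List (Ty 𝒮.Base)} {b : 𝒮.Base} (f : 𝒮.assoc b) (v w : Tm 𝒮 Γ (.base b)) :
    Tm 𝒮 Γ (.base b) :=
  .app (.app (.acon f) v) w

/-- `λx̄. t`, where `x̄` are the bound variables of `Γ`. -/
def lams : (Γ : List (Ty 𝒮.Base)) → {τ : Ty 𝒮.Base} → Tm 𝒮 Γ τ → Tm 𝒮 [] (arrows Γ τ)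
  | [], _, t => t
  | _ :: Γ, _, t => lams Γ (.lam t)

/-- `t(ē)`: the application of `t` to one argument for each element of `Δ`. -/
def apps {Γ : List (Ty 𝒮.Base)} : (Δ : List (Ty 𝒮.Base)) → {τ : Ty 𝒮.Base} →
    Tm 𝒮 Γ (arrows Δ τ) → (∀ σ, Var Δ σ → Tm 𝒮 Γ σ) → Tm 𝒮 Γ τ
  | [], _, t, _ => t
  | _ :: Δ, _, t, e => .app (apps Δ t (fun _ x => e _ x.succ)) (e _ .zero)

/-- `X(x̄π)` for a free variable `X` and a renaming `π` of the bound variables `x̄` of `Γ`. -/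
def fvarApp {Γ Δ : List (Ty 𝒮.Base)} {τ : Ty 𝒮.Base} (X : ℕ) (π : Ren Γ Δ) : Tm 𝒮 Δ τ :=
  apps Γ (.fvar X) (fun _ x => .bvar (π _ x))

/-- The generalization term `X(x̄)`, where `x̄` are all bound variables of `Γ`. -/
def gen {Γ : List (Ty 𝒮.Base)} {τ : Ty 𝒮.Base} (X : ℕ) : Tm 𝒮 Γ τ :=
  fvarApp (Γ := Γ) X (fun _ x => x)

/-- The free variable `X` occurs in the term. -/
def Occurs (X : FVar 𝒮) : {Γ : List (Ty 𝒮.Base)} → {τ : Ty 𝒮.Base} → Tm 𝒮 Γ τ → Prop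
  | _, _, .bvar _ => False
  | _, τ, .fvar n => X = ⟨τ, n⟩
  | _, _, .con _ => False
  | _, _, .acon _ => False
  | _, _, .lam t => Occurs X t
  | _, _, .app t v => Occurs X t ∨ Occurs X v

/-- The dangling bound variable `x` occurs in the term. -/
def HasVar : {Γ : List (Ty 𝒮.Base)} → {σ τ : Ty 𝒮.Base} → Var Γ σ → Tm 𝒮 Γ τ → Prop
  | Γ, σ, τ, x, .bvar y => (⟨σ, x⟩ : (α : Ty 𝒮.Base) × Var Γ α) = ⟨τ, y⟩
  | _, _, _, _, .fvar _ => False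
  | _, _, _, _, .con _ => False
  | _, _, _, _, .acon _ => False
  | _, _, _, x, .lam t => HasVar x.succ t
  | _, _, _, x, .app t v => HasVar x t ∨ HasVar x v

/-- Equational theories: the empty one, and associativity of all constants in `𝒮.assoc`. -/
inductive Theory
  | empty
  | assoc

/-- Equality of terms modulo `β`, `η` and the equational theory `E`. -/
inductive Eqv (E : Theory) : {Γ : List (Ty 𝒮.Base)} → {τ : Ty 𝒮.Base} →
    Tm 𝒮 Γ τ → Tm 𝒮 Γ τ → Prop
  | refl {Γ : List (Ty 𝒮.Base)} {τ : Ty 𝒮.Base} (t : Tm 𝒮 Γ τ) : Eqv E t t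
  | symm {Γ : List (Ty 𝒮.Base)} {τ : Ty 𝒮.Base} {t v : Tm 𝒮 Γ τ} : Eqv E t v → Eqv E v t
  | trans {Γ : List (Ty 𝒮.Base)} {τ : Ty 𝒮.Base} {t v w : Tm 𝒮 Γ τ} :
      Eqv E t v → Eqv E v w → Eqv E t w
  | lam {Γ : List (Ty 𝒮.Base)} {σ τ : Ty 𝒮.Base} {t v : Tm 𝒮 (σ :: Γ) τ} :
      Eqv E t v → Eqv E (.lam t) (.lam v)
  | app {Γ : List (Ty 𝒮.Base)} {σ τ : Ty 𝒮.Base} {t t' : Tm 𝒮 Γ (.arr σ τ)} {v v' : Tm 𝒮 Γ σ} :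
      Eqv E t t' → Eqv E v v' → Eqv E (.app t v) (.app t' v')
  | beta {Γ : List (Ty 𝒮.Base)} {σ τ : Ty 𝒮.Base} (t : Tm 𝒮 (σ :: Γ) τ) (v : Tm 𝒮 Γ σ) :
      Eqv E (.app (.lam t) v) (t.inst v)
  | eta {Γ : List (Ty 𝒮.Base)} {σ τ : Ty 𝒮.Base} (t : Tm 𝒮 Γ (.arr σ τ)) :
      Eqv E (.lam (.app t.wk (.bvar .zero))) t
  | assoc {Γ : List (Ty 𝒮.Base)} {b : 𝒮.Base} (hE : E = .assoc) (f : 𝒮.assoc b)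
      (v₁ v₂ v₃ : Tm 𝒮 Γ (.base b)) :
      Eqv E (bin f v₁ (bin f v₂ v₃)) (bin f (bin f v₁ v₂) v₃)

mutual

/-- `η`-long `β`-normal forms. -/
inductive IsNf : {Γ : List (Ty 𝒮.Base)} → {τ : Ty 𝒮.Base} → Tm 𝒮 Γ τ → Prop
  | lam {Γ : List (Ty 𝒮.Base)} {σ τ : Ty 𝒮.Base} {t : Tm 𝒮 (σ :: Γ) τ} :
      IsNf t → IsNf (.lam t)
  | ne {Γ : List (Ty 𝒮.Base)} {b : 𝒮.Base} {t : Tm 𝒮 Γ (.base b)} : IsNe t → IsNf t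

/-- A constant or variable applied to `η`-long `β`-normal forms. -/
inductive IsNe : {Γ : List (Ty 𝒮.Base)} → {τ : Ty 𝒮.Base} → Tm 𝒮 Γ τ → Prop
  | bvar {Γ : List (Ty 𝒮.Base)} {τ : Ty 𝒮.Base} (x : Var Γ τ) : IsNe (.bvar x)
  | fvar {Γ : List (Ty 𝒮.Base)} {τ : Ty 𝒮.Base} (n : ℕ) :
      IsNe (.fvar n : Tm 𝒮 Γ τ)
  | con {Γ : List (Ty 𝒮.Base)} {τ : Ty 𝒮.Base} (c : 𝒮.free τ) :
      IsNe (.con c : Tm 𝒮 Γ τ)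
  | acon {Γ : List (Ty 𝒮.Base)} {b : 𝒮.Base} (f : 𝒮.assoc b) :
      IsNe (.acon f : Tm 𝒮 Γ (.arr (.base b) (.arr (.base b) (.base b))))
  | app {Γ : List (Ty 𝒮.Base)} {σ τ : Ty 𝒮.Base} {t : Tm 𝒮 Γ (.arr σ τ)} {v : Tm 𝒮 Γ σ} :
      IsNe t → IsNf v → IsNe (.app t v)

end

/-- The `η`-long form of a variable, or of a variable applied to `η`-long terms. -/
def etaLong : (τ : Ty 𝒮.Base) → {Γ : List (Ty 𝒮.Base)} → Tm 𝒮 Γ τ → Tm 𝒮 Γ τ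
  | .base _, _, t => t
  | .arr σ τ, _, t => .lam (etaLong τ (.app t.wk (etaLong σ (.bvar .zero))))

mutual

/-- Higher-order patterns in `η`-long `β`-normal form: every free variable is applied to
pairwise distinct (`η`-long forms of) bound variables. -/
inductive IsNfPattern : {Γ : List (Ty 𝒮.Base)} → {τ : Ty 𝒮.Base} → Tm 𝒮 Γ τ → Prop
  | lam {Γ : List (Ty 𝒮.Base)} {σ τ : Ty 𝒮.Base} {t : Tm 𝒮 (σ :: Γ) τ} :
      IsNfPattern t → IsNfPattern (.lam t)
  | rigid {Γ : List (Ty 𝒮.Base)} {b : 𝒮.Base} {t : Tm 𝒮 Γ (.base b)} :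
      IsRigid t → IsNfPattern t
  | flex {Γ Δ : List (Ty 𝒮.Base)} {b : 𝒮.Base} (n : ℕ) (ρ : Ren Δ Γ)
      (hρ : ∀ σ, Function.Injective (ρ σ)) :
      IsNfPattern (apps Δ (τ := .base b) (.fvar n : Tm 𝒮 Γ (arrows Δ (.base b)))
        (fun σ x => etaLong σ (.bvar (ρ σ x))))

/-- A constant or bound variable applied to patterns. -/
inductive IsRigid : {Γ : List (Ty 𝒮.Base)} → {τ : Ty 𝒮.Base} → Tm 𝒮 Γ τ → Prop
  | bvar {Γ : List (Ty 𝒮.Base)} {τ : Ty 𝒮.Base} (x : Var Γ τ) : IsRigid (.bvar x)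
  | con {Γ : List (Ty 𝒮.Base)} {τ : Ty 𝒮.Base} (c : 𝒮.free τ) :
      IsRigid (.con c : Tm 𝒮 Γ τ)
  | acon {Γ : List (Ty 𝒮.Base)} {b : 𝒮.Base} (f : 𝒮.assoc b) :
      IsRigid (.acon f : Tm 𝒮 Γ (.arr (.base b) (.arr (.base b) (.base b))))
  | app {Γ : List (Ty 𝒮.Base)} {σ τ : Ty 𝒮.Base} {t : Tm 𝒮 Γ (.arr σ τ)} {v : Tm 𝒮 Γ σ} :
      IsRigid t → IsNfPattern v → IsRigid (.app t v)

end

/-- A higher-order pattern: its `η`-long `β`-normal form is a pattern. -/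
def IsPattern {τ : Ty 𝒮.Base} (t : Tm 𝒮 [] τ) : Prop :=
  ∃ p : Tm 𝒮 [] τ, Eqv .empty t p ∧ IsNfPattern p

/-- Head symbols. -/
inductive Head (𝒮 : Sig.{u}) (Γ : List (Ty 𝒮.Base)) : Type u
  | bvar : ((τ : Ty 𝒮.Base) × Var Γ τ) → Head 𝒮 Γ
  | fvar : FVar 𝒮 → Head 𝒮 Γ
  | con : ((τ : Ty 𝒮.Base) × 𝒮.free τ) → Head 𝒮 Γ
  | acon : ((b : 𝒮.Base) × 𝒮.assoc b) → Head 𝒮 Γ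

/-- The head of `h(t₁, …, tₘ)`; only used for normal forms of basic type, which are not
abstractions. -/
def head : {Γ : List (Ty 𝒮.Base)} → {τ : Ty 𝒮.Base} → Tm 𝒮 Γ τ → Option (Head 𝒮 Γ)
  | _, τ, .bvar x => some (.bvar ⟨τ, x⟩)
  | _, τ, .fvar n => some (.fvar ⟨τ, n⟩)
  | _, τ, .con c => some (.con ⟨τ, c⟩)
  | _, _, .acon f => some (.acon ⟨_, f⟩)
  | _, _, .lam _ => none
  | _, _, .app t _ => head t

/-- `f(t₁, …, tₙ)` for an associative constant `f`, `n ≥ 1`; `f(t)` stands for `t`.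
The list `[t₂, …, tₙ]` is the last argument. -/
def acomb {Γ : List (Ty 𝒮.Base)} {b : 𝒮.Base} (f : 𝒮.assoc b) :
    Tm 𝒮 Γ (.base b) → List (Tm 𝒮 Γ (.base b)) → Tm 𝒮 Γ (.base b)
  | t, [] => t
  | t, v :: vs => bin f t (acomb f v vs)

/-- `Flat f t [t₁, …, tₙ]`: the flattened form of `t` is `f(t₁, …, tₙ)`, where no `tᵢ` has the
head `f`. -/
inductive Flat {Γ : List (Ty 𝒮.Base)} {b : 𝒮.Base} (f : 𝒮.assoc b) :
    Tm 𝒮 Γ (.base b) → List (Tm 𝒮 Γ (.base b)) → Prop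
  | leaf {t : Tm 𝒮 Γ (.base b)} (h : ∀ v w, t ≠ bin f v w) : Flat f t [t]
  | node {v w : Tm 𝒮 Γ (.base b)} {vs ws : List (Tm 𝒮 Γ (.base b))} :
      Flat f v vs → Flat f w ws → Flat f (bin f v w) (vs ++ ws)

end Tm

/-- Substitutions: type-preserving maps from free variables to terms without dangling bound
variables that move only finitely many variables. -/
structure Subst (𝒮 : Sig.{u}) where
  map : ∀ τ : Ty 𝒮.Base, ℕ → Tm 𝒮 [] τ
  finite : {Z : FVar 𝒮 | map Z.1 Z.2 ≠ .fvar Z.2}.Finite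

/-- `tθ` for a substitution `θ`. -/
def Tm.subst {𝒮 : Sig.{u}} (θ : Subst 𝒮) :
    {Γ : List (Ty 𝒮.Base)} → {τ : Ty 𝒮.Base} → Tm 𝒮 Γ τ → Tm 𝒮 Γ τ
  | _, _, .bvar x => .bvar x
  | Γ, τ, .fvar n => (θ.map τ n).rename (Ren.empty Γ)
  | _, _, .con c => .con c
  | _, _, .acon f => .acon f
  | _, _, .lam t => .lam (Tm.subst θ t)
  | _, _, .app t v => .app (Tm.subst θ t) (Tm.subst θ v)

namespace Subst

variable {𝒮 : Sig.{u}}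

/-- The empty substitution. -/
def id : Subst 𝒮 where
  map _ n := .fvar n
  finite := by simp

open Classical in
/-- The substitution `{X ↦ r}`. -/
noncomputable def single {τ : Ty 𝒮.Base} (X : ℕ) (r : Tm 𝒮 [] τ) : Subst 𝒮 where
  map α n := if h : τ = α ∧ X = n then h.1 ▸ r else .fvar n
  finite := by
    refine (Set.finite_singleton (⟨τ, X⟩ : FVar 𝒮)).subset ?_
    rintro ⟨α, n⟩ h
    by_cases h' : τ = α ∧ X = n
    · obtain ⟨rfl, rfl⟩ := h'; rfl
    · exact absurd (dif_neg h') h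

/-- Composition: `Z(σθ) = (Zσ)θ`. -/
def comp (σ θ : Subst 𝒮) : Subst 𝒮 where
  map τ n := (σ.map τ n).subst θ
  finite := by
    refine (σ.finite.union θ.finite).subset ?_
    rintro ⟨τ, n⟩ h
    by_contra hn
    simp only [Set.mem_union, Set.mem_ofPred_eq, not_or, not_not] at hn
    apply h
    simp [hn.1, Tm.subst, hn.2, Tm.rename]

/-- The free variable `X` belongs to the domain of `σ` or occurs in its range. -/
def Mentions (σ : Subst 𝒮) (X : FVar 𝒮) : Prop :=
  ∃ Z : FVar 𝒮, σ.map Z.1 Z.2 ≠ .fvar Z.2 ∧ (X = Z ∨ (σ.map Z.1 Z.2).Occurs X)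

end Subst

/-- `t ⪯ v` modulo associativity: some instance of `t` equals `v` modulo `β`, `η` and
associativity. -/
def MoreGeneral {𝒮 : Sig.{u}} {τ : Ty 𝒮.Base} (t v : Tm 𝒮 [] τ) : Prop :=
  ∃ θ : Subst 𝒮, Tm.Eqv .assoc (t.subst θ) v

/-- `r` is a higher-order pattern generalization of `t` and `v` modulo associativity. -/
def IsPatternGeneralization {𝒮 : Sig.{u}} {τ : Ty 𝒮.Base} (r t v : Tm 𝒮 [] τ) : Prop :=
  r.IsPattern ∧ MoreGeneral r t ∧ MoreGeneral r v

/-- The anti-unification problem `X(x̄) : left ≜ right`.  Here `x̄` are the bound variables of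
`ctx`, and `X` is the free variable with name `var` and the type of `λx̄. left`. -/
structure AUP (𝒮 : Sig.{u}) where
  ctx : List (Ty 𝒮.Base)
  ty : Ty 𝒮.Base
  var : ℕ
  left : Tm 𝒮 ctx ty
  right : Tm 𝒮 ctx ty

/-- The free variable `Z` is the generalization variable of `p` or occurs in one of its terms. -/
def AUP.Mentions {𝒮 : Sig.{u}} (p : AUP 𝒮) (Z : FVar 𝒮) : Prop :=
  Z = ⟨arrows p.ctx p.ty, p.var⟩ ∨ p.left.Occurs Z ∨ p.right.Occurs Z

/-- States `A; S; σ`. -/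
structure State (𝒮 : Sig.{u}) where
  problems : Set (AUP 𝒮)
  store : Set (AUP 𝒮)
  sub : Subst 𝒮

/-- The name `Y` is fresh for the state, as a free variable of type `τ`. -/
def State.Fresh {𝒮 : Sig.{u}} (Q : State 𝒮) (τ : Ty 𝒮.Base) (Y : ℕ) : Prop :=
  (∀ p ∈ Q.problems ∪ Q.store, ¬ p.Mentions ⟨τ, Y⟩) ∧ ¬ Q.sub.Mentions ⟨τ, Y⟩

/-- A constant that is free, or one of the bound variables `x̄`: the heads to which the rule `Dec`
applies. -/
inductive IsDecHead {𝒮 : Sig.{u}} {Γ : List (Ty 𝒮.Base)} {τ : Ty 𝒮.Base} : Tm 𝒮 Γ τ → Prop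
  | bvar (x : Var Γ τ) : IsDecHead (.bvar x)
  | con (c : 𝒮.free τ) : IsDecHead (.con c)

open Tm in
/-- The transformation rules of `𝒢_A`. -/
inductive Step {𝒮 : Sig.{u}} : State 𝒮 → State 𝒮 → Prop
  /-- Decomposition; `Δ` lists the argument types of `h`. -/
  | dec {Γ Δ : List (Ty 𝒮.Base)} {b : 𝒮.Base} {A S : Set (AUP 𝒮)} {σ : Subst 𝒮} (X : ℕ)
      (h : Tm 𝒮 Γ (arrows Δ (.base b))) (hh : IsDecHead h)
      (t s : ∀ α, Var Δ α → Tm 𝒮 Γ α) (Y : ∀ α, Var Δ α → ℕ)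
      (hA : (⟨Γ, .base b, X, apps Δ h t, apps Δ h s⟩ : AUP 𝒮) ∉ A)
      (hfresh : ∀ α (x : Var Δ α),
        State.Fresh ⟨insert ⟨Γ, .base b, X, apps Δ h t, apps Δ h s⟩ A, S, σ⟩
          (arrows Γ α) (Y α x))
      (hdistinct : ∀ α, Function.Injective (Y α)) :
      Step ⟨insert ⟨Γ, .base b, X, apps Δ h t, apps Δ h s⟩ A, S, σ⟩
        ⟨{p | ∃ α, ∃ x : Var Δ α, p = ⟨Γ, α, Y α x, t α x, s α x⟩} ∪ A, S,
          σ.comp (.single X (lams Γ (apps Δ h (fun α x => gen (Y α x)))))⟩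
  /-- Abstraction. -/
  | abs {Γ : List (Ty 𝒮.Base)} {α τ : Ty 𝒮.Base} {A S : Set (AUP 𝒮)} {σ : Subst 𝒮} (X : ℕ)
      (t s : Tm 𝒮 (α :: Γ) τ) (X' : ℕ)
      (hA : (⟨Γ, .arr α τ, X, .lam t, .lam s⟩ : AUP 𝒮) ∉ A)
      (hfresh : State.Fresh ⟨insert ⟨Γ, .arr α τ, X, .lam t, .lam s⟩ A, S, σ⟩
        (arrows (α :: Γ) τ) X') :
      Step ⟨insert ⟨Γ, .arr α τ, X, .lam t, .lam s⟩ A, S, σ⟩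
        ⟨insert ⟨α :: Γ, τ, X', t, s⟩ A, S,
          σ.comp (.single X (lams (α :: Γ) (gen (τ := τ) X')))⟩
  /-- Solve; `ι` singles out the subsequence `ȳ` of `x̄` of the variables that occur in one of the
  two terms, and `t`, `s` are the two terms in the context `ȳ`. -/
  | sol {Γ Δ : List (Ty 𝒮.Base)} {b : 𝒮.Base} {A S : Set (AUP 𝒮)} {σ : Subst 𝒮} (X : ℕ)
      (ι : Thin Δ Γ) (t s : Tm 𝒮 Δ (.base b)) (Y : ℕ)
      (hhead : t.head ≠ s.head ∨ ∃ Z : FVar 𝒮, t.head = some (.fvar Z) ∧ s.head = some (.fvar Z))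
      (hvars : ∀ α (y : Var Δ α), t.HasVar y ∨ s.HasVar y)
      (hA : (⟨Γ, .base b, X, t.rename ι.ren, s.rename ι.ren⟩ : AUP 𝒮) ∉ A)
      (hfresh : State.Fresh
        ⟨insert ⟨Γ, .base b, X, t.rename ι.ren, s.rename ι.ren⟩ A, S, σ⟩
        (arrows Δ (.base b)) Y) :
      Step ⟨insert ⟨Γ, .base b, X, t.rename ι.ren, s.rename ι.ren⟩ A, S, σ⟩
        ⟨A, insert ⟨Δ, .base b, Y, t, s⟩ S,
          σ.comp (.single X (lams Γ (fvarApp (τ := .base b) Y ι.ren)))⟩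
  /-- Merge. -/
  | mer {Γ Δ : List (Ty 𝒮.Base)} {τ : Ty 𝒮.Base} {A S : Set (AUP 𝒮)} {σ : Subst 𝒮} (X Y : ℕ)
      (t₁ t₂ : Tm 𝒮 Γ τ) (s₁ s₂ : Tm 𝒮 Δ τ)
      (π : Ren Γ Δ) (hπ : ∀ α, Function.Bijective (π α))
      (h₁ : Eqv .assoc (t₁.rename π) s₁) (h₂ : Eqv .assoc (t₂.rename π) s₂)
      (hne : (⟨Γ, τ, X, t₁, t₂⟩ : AUP 𝒮) ≠ ⟨Δ, τ, Y, s₁, s₂⟩)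
      (hX : (⟨Γ, τ, X, t₁, t₂⟩ : AUP 𝒮) ∉ S) (hY : (⟨Δ, τ, Y, s₁, s₂⟩ : AUP 𝒮) ∉ S) :
      Step ⟨A, {⟨Γ, τ, X, t₁, t₂⟩, ⟨Δ, τ, Y, s₁, s₂⟩} ∪ S, σ⟩
        ⟨A, insert ⟨Γ, τ, X, t₁, t₂⟩ S,
          σ.comp (.single Y (lams Δ (fvarApp (τ := τ) X π)))⟩
  /-- Associative decomposition left: the flattened forms of the two terms are
  `f(t₁, …, tₖ, tₖ₊₁, …, tₙ)` and `f(s₁, s₂, …, sₘ)`, with `t₁, …, tₖ = t :: ts`,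
  `tₖ₊₁, …, tₙ = t' :: ts'` and `s₂, …, sₘ = s' :: ss'`. -/
  | decAL {Γ : List (Ty 𝒮.Base)} {b : 𝒮.Base} {A S : Set (AUP 𝒮)} {σ : Subst 𝒮} (X : ℕ)
      (f : 𝒮.assoc b) (l r : Tm 𝒮 Γ (.base b))
      (t t' s s' : Tm 𝒮 Γ (.base b)) (ts ts' ss' : List (Tm 𝒮 Γ (.base b)))
      (hl : Flat f l ((t :: ts) ++ (t' :: ts'))) (hr : Flat f r (s :: s' :: ss'))
      (Y₁ Y₂ : ℕ)
      (hA : (⟨Γ, .base b, X, l, r⟩ : AUP 𝒮) ∉ A)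
      (hY₁ : State.Fresh ⟨insert ⟨Γ, .base b, X, l, r⟩ A, S, σ⟩ (arrows Γ (.base b)) Y₁)
      (hY₂ : State.Fresh ⟨insert ⟨Γ, .base b, X, l, r⟩ A, S, σ⟩ (arrows Γ (.base b)) Y₂)
      (hY : Y₁ ≠ Y₂) :
      Step ⟨insert ⟨Γ, .base b, X, l, r⟩ A, S, σ⟩
        ⟨{⟨Γ, .base b, Y₁, acomb f t ts, s⟩,
            ⟨Γ, .base b, Y₂, acomb f t' ts', acomb f s' ss'⟩} ∪ A, S,
          σ.comp (.single X (lams Γ (bin f (gen Y₁) (gen Y₂))))⟩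
  /-- Associative decomposition right: the flattened forms of the two terms are
  `f(t₁, t₂, …, tₙ)` and `f(s₁, …, sₖ, sₖ₊₁, …, sₘ)`, with `t₂, …, tₙ = t' :: ts'`,
  `s₁, …, sₖ = s :: ss` and `sₖ₊₁, …, sₘ = s' :: ss'`. -/
  | decAR {Γ : List (Ty 𝒮.Base)} {b : 𝒮.Base} {A S : Set (AUP 𝒮)} {σ : Subst 𝒮} (X : ℕ)
      (f : 𝒮.assoc b) (l r : Tm 𝒮 Γ (.base b))
      (t t' s s' : Tm 𝒮 Γ (.base b)) (ts' ss ss' : List (Tm 𝒮 Γ (.base b)))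
      (hl : Flat f l (t :: t' :: ts')) (hr : Flat f r ((s :: ss) ++ (s' :: ss')))
      (Y₁ Y₂ : ℕ)
      (hA : (⟨Γ, .base b, X, l, r⟩ : AUP 𝒮) ∉ A)
      (hY₁ : State.Fresh ⟨insert ⟨Γ, .base b, X, l, r⟩ A, S, σ⟩ (arrows Γ (.base b)) Y₁)
      (hY₂ : State.Fresh ⟨insert ⟨Γ, .base b, X, l, r⟩ A, S, σ⟩ (arrows Γ (.base b)) Y₂)
      (hY : Y₁ ≠ Y₂) :
      Step ⟨insert ⟨Γ, .base b, X, l, r⟩ A, S, σ⟩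
        ⟨{⟨Γ, .base b, Y₁, t, acomb f s ss⟩,
            ⟨Γ, .base b, Y₂, acomb f t' ts', acomb f s' ss'⟩} ∪ A, S,
          σ.comp (.single X (lams Γ (bin f (gen Y₁) (gen Y₂))))⟩

/-- `Computes X t₁ t₂ σ`: some transformation sequence of `𝒢_A` leads from
`{X(x̄) : t₁ ≜ t₂}; ∅; ∅` to `∅; S; σ` for some store `S`. -/
def Computes {𝒮 : Sig.{u}} {Γ : List (Ty 𝒮.Base)} {τ : Ty 𝒮.Base} (X : ℕ) (t₁ t₂ : Tm 𝒮 Γ τ)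
    (σ : Subst 𝒮) : Prop :=
  ∃ S : Set (AUP 𝒮),
    Relation.ReflTransGen Step ⟨{⟨Γ, τ, X, t₁, t₂⟩}, ∅, Subst.id⟩ ⟨∅, S, σ⟩

end AntiUnif

/-!
The computed terms are generalizations because every rule replaces a problem by finitely many
problems, and any two substitutions that map the variables of the new problems to the left and to
the right sides of these problems also map the term substituted for the old variable to the sides
of the old problem (`IsGen.replace`, `IsGen.step`). Hence the composed substitution stays a pattern
throughout, and instantiates to both given terms.

For completeness, a given pattern generalization `s` is first instantiated as far as possible
without losing either of the two instances (`exists_reduced_of_isPatternGeneralization`). In the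
result `q` the two values of each variable cannot be decomposed any more: they have a basic type,
their heads differ or are the same free variable, and every argument of the variable occurs in one
of them. This pattern guides the rules along its own structure (`Solvable`): an abstraction calls
for an abstraction step, a free constant or a bound variable for a decomposition, and a variable for
a solving step. For an associative constant `f`, written as a right comb `f(v, w)` where `v` does
not have the head `f`, the two instances of `v` cannot both be headed by `f`: if `v` is a variable,
its two values would have the same constant head. So `v` corresponds to a single argument on one
of the two sides, which is the situation of the two associative decomposition rules
(`solvable_bin`).

All along, a substitution `κ` instantiates the term computed so far to `q` (`Invariant`). At the end
each solved problem stems from one variable of `q`, whose arguments it may permute. Two problems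
that stem from the same variable are equal up to a renaming of bound variables and are merged
(`Invariant.merge`). After that different problems stem from different variables, so `κ` is
invertible, and `s` is more general than the computed term (`Invariant.moreGeneral`).

Both parts have to analyse equality modulo `β`, `η` and associativity. It is decided by a canonical
form that is computed by evaluation in a Kripke model, in which the elements at base types are
normal terms and an associative constant is interpreted by the concatenation of right combs
(`canon`, `eqv_iff_canon_eq`). In particular the head and the arguments of a normal term, and the
list of arguments of a flattened term, are invariant under this equality.
-/

/-! ### Renaming and simultaneous substitution -/

namespace AntiUnif

variable {𝒮 : Sig.{u}} {Γ Δ Θ : List (Ty 𝒮.Base)} {σ τ : Ty 𝒮.Base} {E : Tm.Theory}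

/-- A family of terms over `Γ`, one for each bound variable of `Δ`: the argument list of an
application to `Δ`, or a simultaneous replacement of the variables of `Δ`. -/
abbrev Env (𝒮 : Sig.{u}) (Δ Γ : List (Ty 𝒮.Base)) : Type u := ∀ τ, Var Δ τ → Tm 𝒮 Γ τ

theorem Ren.lift_id : Ren.lift (fun _ x => x : Ren Γ Γ) σ = fun _ x => x := by
  funext τ x; cases x <;> rfl

theorem Ren.lift_comp (ρ : Ren Γ Δ) (ρ' : Ren Δ Θ) :
    Ren.lift (fun τ x => ρ' τ (ρ τ x)) σ = fun τ x => ρ'.lift σ τ (ρ.lift σ τ x) := by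
  funext τ x; cases x <;> rfl

theorem Ren.lift_injective {ρ : Ren Γ Δ} (h : ∀ α, Function.Injective (ρ α)) :
    ∀ α, Function.Injective (ρ.lift σ α) := by
  intro α x y hxy
  cases x <;> cases y <;> simp only [Ren.lift, Var.succ.injEq, reduceCtorEq] at hxy
  · rfl
  · rw [h _ hxy]

theorem Ren.empty_unique (ρ : Ren [] Γ) : ρ = Ren.empty Γ := by
  funext τ x; cases x

namespace Tm

theorem rename_id (t : Tm 𝒮 Γ τ) : t.rename (fun _ x => x) = t := by
  induction t <;> simp_all [rename, Ren.lift_id]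

theorem rename_rename (t : Tm 𝒮 Γ τ) (ρ : Ren Γ Δ) (ρ' : Ren Δ Θ) :
    (t.rename ρ).rename ρ' = t.rename (fun τ x => ρ' τ (ρ τ x)) := by
  induction t generalizing Δ Θ <;> simp_all [rename, Ren.lift_comp]

theorem wk_rename_lift (t : Tm 𝒮 Γ τ) (ρ : Ren Γ Δ) :
    (t.wk (σ := σ)).rename (ρ.lift σ) = (t.rename ρ).wk := by
  simp only [wk, rename_rename, Ren.lift]

theorem bsubst_rename (t : Tm 𝒮 Γ τ) (ρ : Ren Γ Δ) (e : Env 𝒮 Δ Θ) :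
    (t.rename ρ).bsubst e = t.bsubst (fun τ x => e τ (ρ τ x)) := by
  induction t generalizing Δ Θ with
  | lam t ih =>
    simp only [rename, bsubst, ih]
    congr 2; funext τ x; cases x <;> rfl
  | _ => simp_all [rename, bsubst]

theorem rename_bsubst (t : Tm 𝒮 Γ τ) (e : Env 𝒮 Γ Δ) (ρ : Ren Δ Θ) :
    (t.bsubst e).rename ρ = t.bsubst (fun τ x => (e τ x).rename ρ) := by
  induction t generalizing Δ Θ with
  | lam t ih =>
    simp only [rename, bsubst, ih]
    congr 2; funext τ x
    cases x
    · rfl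
    · exact wk_rename_lift _ _
  | _ => simp_all [rename, bsubst]

theorem bsubst_bsubst (t : Tm 𝒮 Γ τ) (e : Env 𝒮 Γ Δ) (e' : Env 𝒮 Δ Θ) :
    (t.bsubst e).bsubst e' = t.bsubst (fun τ x => (e τ x).bsubst e') := by
  induction t generalizing Δ Θ with
  | lam t ih =>
    simp only [bsubst, ih]
    congr 2; funext τ x
    cases x
    · rfl
    · simp only [liftEnv, wk, bsubst_rename, rename_bsubst]
  | _ => simp_all [bsubst]

theorem rename_eq_bsubst (t : Tm 𝒮 Γ τ) (ρ : Ren Γ Δ) :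
    t.rename ρ = t.bsubst (fun _ x => .bvar (ρ _ x)) := by
  induction t generalizing Δ with
  | lam t ih =>
    simp only [bsubst, rename, ih]
    congr 2; funext τ x; cases x <;> rfl
  | _ => simp_all [bsubst, rename]

theorem bsubst_bvar (t : Tm 𝒮 Γ τ) : t.bsubst (fun _ x => .bvar x) = t := by
  rw [← rename_eq_bsubst t (fun _ x => x), rename_id]

theorem inst_rename (t : Tm 𝒮 (σ :: Γ) τ) (v : Tm 𝒮 Γ σ) (ρ : Ren Γ Δ) :
    (t.inst v).rename ρ = (t.rename (ρ.lift σ)).inst (v.rename ρ) := by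
  simp only [inst, rename_bsubst, bsubst_rename]
  congr 1; funext τ x; cases x <;> rfl

theorem inst_wk (t : Tm 𝒮 Γ τ) (v : Tm 𝒮 Γ σ) : t.wk.inst v = t := by
  simp only [inst, wk, bsubst_rename, instEnv]; exact bsubst_bvar t

theorem rename_injective {ρ : Ren Γ Δ} (h : ∀ α, Function.Injective (ρ α)) {t v : Tm 𝒮 Γ τ}
    (htv : t.rename ρ = v.rename ρ) : t = v := by
  induction t generalizing Δ with
  | bvar x => cases v <;> simp only [rename, bvar.injEq, reduceCtorEq] at htv; rw [h _ htv]
  | fvar n => cases v <;> simp_all [rename]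
  | con n => cases v <;> simp_all [rename]
  | acon n => cases v <;> simp_all [rename]
  | lam t ih =>
    cases v <;> simp only [rename, lam.injEq, reduceCtorEq] at htv
    rw [ih (Ren.lift_injective h) htv]
  | app t w ih₁ ih₂ =>
    cases v <;> simp only [rename, app.injEq, reduceCtorEq] at htv
    obtain ⟨rfl, h1, h2⟩ := htv
    rw [ih₁ h (eq_of_heq h1), ih₂ h (eq_of_heq h2)]

/-! ### Substitution of free variables -/

theorem subst_rename (θ : Subst 𝒮) (t : Tm 𝒮 Γ τ) (ρ : Ren Γ Δ) :
    (t.rename ρ).subst θ = (t.subst θ).rename ρ := by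
  induction t generalizing Δ with
  | fvar n => simp only [rename, Tm.subst, rename_rename]; congr 1; exact (Ren.empty_unique _).symm
  | _ => simp_all [rename, Tm.subst]

theorem subst_bsubst (θ : Subst 𝒮) (t : Tm 𝒮 Γ τ) (e : Env 𝒮 Γ Δ) :
    (t.bsubst e).subst θ = (t.subst θ).bsubst (fun τ x => (e τ x).subst θ) := by
  induction t generalizing Δ with
  | fvar n =>
    simp only [bsubst, Tm.subst, bsubst_rename]
    rw [rename_eq_bsubst]; congr 1; funext τ x; cases x
  | lam t ih =>
    simp only [bsubst, Tm.subst, ih]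
    congr 2; funext τ x
    cases x
    · rfl
    · exact subst_rename _ _ _
  | _ => simp_all [bsubst, Tm.subst]

theorem subst_comp (θ θ' : Subst 𝒮) (t : Tm 𝒮 Γ τ) :
    t.subst (θ.comp θ') = (t.subst θ).subst θ' := by
  induction t with
  | fvar n => simp only [Tm.subst, Subst.comp, subst_rename]
  | _ => simp_all [Tm.subst]

theorem subst_id (t : Tm 𝒮 Γ τ) : t.subst Subst.id = t := by
  induction t with
  | fvar n => simp only [Tm.subst, Subst.id, rename]
  | _ => simp_all [Tm.subst]

theorem subst_fvar (θ : Subst 𝒮) (n : ℕ) :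
    (fvar n : Tm 𝒮 [] τ).subst θ = θ.map τ n := by
  simp only [Tm.subst, ← Ren.empty_unique (fun _ x => x), rename_id]

theorem occurs_rename (X : FVar 𝒮) (t : Tm 𝒮 Γ τ) (ρ : Ren Γ Δ) :
    (t.rename ρ).Occurs X ↔ t.Occurs X := by
  induction t generalizing Δ <;> simp_all [rename, Occurs]

theorem occurs_subst (θ : Subst 𝒮) (X : FVar 𝒮) (t : Tm 𝒮 Γ τ) :
    (t.subst θ).Occurs X ↔ ∃ Z : FVar 𝒮, t.Occurs Z ∧ (θ.map Z.1 Z.2).Occurs X := by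
  induction t with
  | fvar n => simp [Tm.subst, Occurs, occurs_rename]
  | lam t ih => simpa [Tm.subst, Occurs] using ih
  | app t v ih₁ ih₂ => simp only [Tm.subst, Occurs, ih₁, ih₂, or_and_right, exists_or]
  | _ => simp [Tm.subst, Occurs]

theorem finite_occurs (t : Tm 𝒮 Γ τ) : {X : FVar 𝒮 | t.Occurs X}.Finite := by
  induction t with
  | fvar n => simp [Occurs]
  | lam t ih => simpa [Occurs] using ih
  | app t v ih₁ ih₂ => exact ih₁.union ih₂
  | _ => simp [Occurs]

/-! ### Equality modulo the theory -/

namespace Eqv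

theorem of_eq {t v : Tm 𝒮 Γ τ} (h : t = v) : Eqv E t v := h ▸ .refl t

theorem of_empty {t v : Tm 𝒮 Γ τ} (h : Eqv .empty t v) : Eqv E t v := by
  induction h with
  | refl => exact .refl _
  | symm _ ih => exact ih.symm
  | trans _ _ ih₁ ih₂ => exact ih₁.trans ih₂
  | lam _ ih => exact ih.lam
  | app _ _ ih₁ ih₂ => exact ih₁.app ih₂
  | beta => exact .beta _ _
  | eta => exact .eta _
  | assoc h => cases h

theorem rename {t v : Tm 𝒮 Γ τ} (h : Eqv E t v) (ρ : Ren Γ Δ) :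
    Eqv E (t.rename ρ) (v.rename ρ) := by
  induction h generalizing Δ with
  | refl => exact .refl _
  | symm _ ih => exact (ih ρ).symm
  | trans _ _ ih₁ ih₂ => exact (ih₁ ρ).trans (ih₂ ρ)
  | lam _ ih => exact (ih _).lam
  | app _ _ ih₁ ih₂ => exact (ih₁ ρ).app (ih₂ ρ)
  | beta t v => rw [inst_rename]; exact .beta _ _
  | eta t => simp only [Tm.rename, wk_rename_lift]; exact .eta _
  | assoc h f => exact .assoc h f _ _ _

theorem subst {t v : Tm 𝒮 Γ τ} (h : Eqv E t v) (θ : Subst 𝒮) :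
    Eqv E (t.subst θ) (v.subst θ) := by
  induction h with
  | refl => exact .refl _
  | symm _ ih => exact ih.symm
  | trans _ _ ih₁ ih₂ => exact ih₁.trans ih₂
  | lam _ ih => exact ih.lam
  | app _ _ ih₁ ih₂ => exact ih₁.app ih₂
  | beta t v =>
    refine (Eqv.beta _ _).trans (.of_eq ?_)
    simp only [inst, subst_bsubst]
    congr 1; funext τ x; cases x <;> rfl
  | eta t => simp only [Tm.subst, wk, subst_rename]; exact .eta _
  | assoc h f => exact .assoc h f _ _ _

/-- Substitutions that agree on the free variables of `t` up to `E` give equal instances of `t`. -/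
theorem subst_congr {θ θ' : Subst 𝒮} (t : Tm 𝒮 Γ τ)
    (h : ∀ Z : FVar 𝒮, t.Occurs Z → Eqv E (θ.map Z.1 Z.2) (θ'.map Z.1 Z.2)) :
    Eqv E (t.subst θ) (t.subst θ') := by
  induction t with
  | fvar n => exact (h ⟨_, n⟩ rfl).rename _
  | lam t ih => exact (ih h).lam
  | app t v ih₁ ih₂ =>
    exact (ih₁ fun Z hZ => h Z (.inl hZ)).app (ih₂ fun Z hZ => h Z (.inr hZ))
  | _ => exact .refl _

end Eqv

/-! ### Iterated abstraction and application -/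

theorem apps_congr {t t' : Tm 𝒮 Γ (arrows Δ τ)} {e e' : Env 𝒮 Δ Γ} (ht : Eqv E t t')
    (he : ∀ σ x, Eqv E (e σ x) (e' σ x)) : Eqv E (apps Δ t e) (apps Δ t' e') := by
  induction Δ generalizing τ with
  | nil => exact ht
  | cons σ Δ ih => exact (ih ht fun _ x => he _ x.succ).app (he _ .zero)

theorem apps_rename (t : Tm 𝒮 Γ (arrows Δ τ)) (e : Env 𝒮 Δ Γ) (ρ : Ren Γ Θ) :
    (apps Δ t e).rename ρ = apps Δ (t.rename ρ) (fun σ x => (e σ x).rename ρ) := by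
  induction Δ generalizing τ with
  | nil => rfl
  | cons σ Δ ih => exact congrArg (Tm.app · _) (ih (τ := .arr σ τ) t _)

theorem apps_subst (t : Tm 𝒮 Γ (arrows Δ τ)) (e : Env 𝒮 Δ Γ) (θ : Subst 𝒮) :
    (apps Δ t e).subst θ = apps Δ (t.subst θ) (fun σ x => (e σ x).subst θ) := by
  induction Δ generalizing τ with
  | nil => rfl
  | cons σ Δ ih => exact congrArg (Tm.app · _) (ih (τ := .arr σ τ) t _)

theorem occurs_apps (X : FVar 𝒮) (t : Tm 𝒮 Γ (arrows Δ τ)) (e : Env 𝒮 Δ Γ) :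
    (apps Δ t e).Occurs X ↔ t.Occurs X ∨ ∃ σ x, (e σ x).Occurs X := by
  induction Δ generalizing τ with
  | nil =>
    refine ⟨.inl, ?_⟩
    rintro (h | ⟨σ, x, -⟩)
    · exact h
    · cases x
  | cons α Δ ih =>
    refine (or_congr_left (ih (τ := .arr α τ) t _)).trans (or_assoc.trans (or_congr_right ⟨?_, ?_⟩))
    · rintro (⟨σ, x, h⟩ | h)
      · exact ⟨σ, _, h⟩
      · exact ⟨_, _, h⟩
    · rintro ⟨σ, x, h⟩
      cases x
      · exact .inr h
      · exact .inl ⟨_, _, h⟩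

theorem lams_congr {t v : Tm 𝒮 Γ τ} (h : Eqv E t v) : Eqv E (lams Γ t) (lams Γ v) := by
  induction Γ generalizing τ with
  | nil => exact h
  | cons σ Γ ih => exact ih h.lam

theorem lams_subst (t : Tm 𝒮 Γ τ) (θ : Subst 𝒮) : (lams Γ t).subst θ = lams Γ (t.subst θ) := by
  induction Γ generalizing τ with
  | nil => rfl
  | cons σ Γ ih => exact ih _

theorem occurs_lams (X : FVar 𝒮) (t : Tm 𝒮 Γ τ) : (lams Γ t).Occurs X ↔ t.Occurs X := by
  induction Γ generalizing τ with
  | nil => rfl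
  | cons σ Γ ih => exact ih _

/-- Iterated `β`-reduction. -/
theorem apps_lams (t : Tm 𝒮 Γ τ) (e : Env 𝒮 Γ Δ) :
    Eqv E (apps Γ ((lams Γ t).rename (Ren.empty Δ)) e) (t.bsubst e) := by
  induction Γ generalizing τ with
  | nil =>
    refine .of_eq ?_
    refine (rename_eq_bsubst t _).trans ?_
    congr 1; funext τ x; cases x
  | cons σ Γ ih =>
    refine ((ih t.lam fun _ x => e _ x.succ).app (.refl _)).trans ((Eqv.beta _ _).trans (.of_eq ?_))
    simp only [inst, bsubst_bsubst]
    congr 1; funext τ x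
    cases x
    · rfl
    · exact inst_wk _ _

theorem apps_lams_ren (t : Tm 𝒮 Γ τ) (ρ : Ren Γ Δ) :
    Eqv E (apps Γ ((lams Γ t).rename (Ren.empty Δ)) (fun _ x => .bvar (ρ _ x))) (t.rename ρ) := by
  rw [rename_eq_bsubst t]; exact apps_lams t _

/-- Iterated `η`-conversion. -/
theorem lams_apps (t : Tm 𝒮 [] (arrows Γ τ)) :
    Eqv E (lams Γ (apps Γ (t.rename (Ren.empty Γ)) (fun _ x => .bvar x))) t := by
  induction Γ generalizing τ with
  | nil =>
    refine .of_eq ?_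
    rw [lams, apps, ← Ren.empty_unique (fun _ x => x), rename_id]
  | cons σ Γ ih =>
    refine Eqv.trans (lams_congr (Γ := Γ) ?_) (ih (τ := .arr σ τ) t)
    refine Eqv.trans (.of_eq ?_) (.eta _)
    have h : (t.rename (Ren.empty Γ)).rename (fun _ x => Var.succ (σ := σ) x) =
        t.rename (Ren.empty (σ :: Γ)) :=
      (rename_rename t _ _).trans (congrArg (Tm.rename · t) (Ren.empty_unique _))
    rw [wk, apps_rename]
    exact congrArg (fun z => Tm.lam (Tm.app (apps Γ (τ := .arr σ τ) z fun _ x => .bvar x.succ)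
      (.bvar .zero))) h.symm

theorem eqv_of_lams {t v : Tm 𝒮 Γ τ} (h : Eqv E (lams Γ t) (lams Γ v)) : Eqv E t v := by
  have := (apps_lams_ren (E := E) t fun _ x => x).symm.trans
    ((apps_congr (h.rename (Ren.empty Γ)) fun _ _ => .refl _).trans (apps_lams_ren v fun _ x => x))
  simpa only [rename_id] using this

/-- The instance of `X(x̄π)` under a substitution that maps `X` to `λx̄. t` is `tπ`. -/
theorem fvarApp_subst {θ : Subst 𝒮} {X : ℕ} {t : Tm 𝒮 Γ τ}
    (h : Eqv E (θ.map (arrows Γ τ) X) (lams Γ t)) (π : Ren Γ Δ) :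
    Eqv E ((fvarApp X π : Tm 𝒮 Δ τ).subst θ) (t.rename π) := by
  rw [fvarApp, apps_subst]
  exact (apps_congr (h.rename _) fun _ _ => .refl _).trans (apps_lams_ren t π)

theorem gen_subst {θ : Subst 𝒮} {X : ℕ} {t : Tm 𝒮 Γ τ}
    (h : Eqv E (θ.map (arrows Γ τ) X) (lams Γ t)) :
    Eqv E ((gen X : Tm 𝒮 Γ τ).subst θ) t := by
  have := fvarApp_subst h (fun _ x => x)
  rwa [rename_id] at this

theorem fvarApp_rename (X : ℕ) (π : Ren Γ Δ) (ρ : Ren Δ Θ) :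
    (fvarApp X π : Tm 𝒮 Δ τ).rename ρ = fvarApp X (fun _ x => ρ _ (π _ x)) := by
  rw [fvarApp, apps_rename]; rfl

theorem occurs_fvarApp (Z : FVar 𝒮) (X : ℕ) (π : Ren Γ Δ) :
    (fvarApp X π : Tm 𝒮 Δ τ).Occurs Z ↔ Z = ⟨arrows Γ τ, X⟩ := by
  simp [fvarApp, occurs_apps, Occurs]

theorem lams_gen (X : ℕ) : Eqv E (lams Γ (gen X : Tm 𝒮 Γ τ)) (.fvar X) :=
  lams_apps (.fvar X)

theorem etaLong_eqv (t : Tm 𝒮 Γ τ) : Eqv E (etaLong τ t) t := by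
  induction τ generalizing Γ with
  | base b => exact .refl _
  | arr σ τ ih₁ ih₂ =>
    exact ((ih₂ _).trans ((Eqv.refl _).app (ih₁ _))).lam.trans (.eta t)

theorem apps_injective {t : Tm 𝒮 Γ (arrows Δ τ)} {e e' : Env 𝒮 Δ Γ}
    (h : apps Δ t e = apps Δ t e') : e = e' := by
  induction Δ generalizing τ with
  | nil => funext τ x; cases x
  | cons σ Δ ih =>
    simp only [apps, app.injEq, heq_eq_eq, true_and] at h
    have := ih h.1
    funext τ x
    cases x
    · exact h.2
    · exact congrFun (congrFun this _) _

theorem head_apps (t : Tm 𝒮 Γ (arrows Δ τ)) (e : Env 𝒮 Δ Γ) : (apps Δ t e).head = t.head := by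
  induction Δ generalizing τ with
  | nil => rfl
  | cons σ Δ ih => exact ih _ _

end Tm

theorem arrows_injective_right {α β : Ty 𝒮.Base} (h : arrows Γ α = arrows Γ β) : α = β := by
  induction Γ generalizing α β with
  | nil => exact h
  | cons σ Γ ih => exact (Ty.arr.inj (ih h)).2

/-- The number of arguments of a function of the given type. -/
def Ty.arity {B : Type u} : Ty B → ℕ
  | .base _ => 0
  | .arr _ τ => τ.arity + 1

theorem arity_arrows (Γ : List (Ty 𝒮.Base)) (τ : Ty 𝒮.Base) :
    (arrows Γ τ).arity = Γ.length + τ.arity := by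
  induction Γ generalizing τ with
  | nil => simp [arrows]
  | cons σ Γ ih => simp [arrows, ih, Ty.arity]; omega

theorem arrows_injective {α β : Ty 𝒮.Base} (hα : α.arity = β.arity)
    (h : arrows Γ α = arrows Δ β) : Γ = Δ ∧ α = β := by
  induction Γ generalizing α β Δ with
  | nil =>
    cases Δ with
    | nil => exact ⟨rfl, h⟩
    | cons σ Δ =>
      have := congrArg Ty.arity h
      rw [arity_arrows, arity_arrows, hα] at this
      simp at this
  | cons σ Γ ih =>
    cases Δ with
    | nil =>
      have := congrArg Ty.arity h
      rw [arity_arrows, arity_arrows, hα] at this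
      simp at this
    | cons σ' Δ =>
      obtain ⟨h1, h2⟩ := ih (Δ := Δ) (α := .arr σ α) (β := .arr σ' β) (by simp [Ty.arity, hα]) h
      injection h2 with h3 h4
      exact ⟨by rw [h1, h3], h4⟩

theorem arrows_base_injective {b c : 𝒮.Base} (h : arrows Γ (.base b) = arrows Δ (.base c)) :
    Γ = Δ ∧ b = c := by
  obtain ⟨h1, h2⟩ := arrows_injective (α := .base b) (β := .base c) rfl h
  exact ⟨h1, Ty.base.inj h2⟩

end AntiUnif

/-! ### Canonical forms: normalization by evaluation -/

namespace AntiUnif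

variable {𝒮 : Sig.{u}} {Γ Δ Θ : List (Ty 𝒮.Base)} {σ τ : Ty 𝒮.Base} {E : Tm.Theory}

namespace Tm

theorem bin_inj {b : 𝒮.Base} {f g : 𝒮.assoc b} {v w v' w' : Tm 𝒮 Γ (.base b)}
    (h : bin f v w = bin g v' w') : f = g ∧ v = v' ∧ w = w' := by
  simpa [bin, and_assoc] using h

/-- The number of nodes of a term. -/
def size : {Γ : List (Ty 𝒮.Base)} → {τ : Ty 𝒮.Base} → Tm 𝒮 Γ τ → ℕ
  | _, _, .bvar _ => 1
  | _, _, .fvar _ => 1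
  | _, _, .con _ => 1
  | _, _, .acon _ => 1
  | _, _, .lam t => size t + 1
  | _, _, .app t v => size t + size v + 1

theorem size_bin {b : 𝒮.Base} (f : 𝒮.assoc b) (v w : Tm 𝒮 Γ (.base b)) :
    (bin f v w).size = v.size + w.size + 3 := by
  simp only [bin, size]; omega

theorem rename_eq_bin {b : 𝒮.Base} {f : 𝒮.assoc b} {t : Tm 𝒮 Γ (.base b)} {ρ : Ren Γ Δ}
    {v w : Tm 𝒮 Δ (.base b)} (h : t.rename ρ = bin f v w) : ∃ v' w', t = bin f v' w' := by
  cases t with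
  | app t w' =>
    simp only [bin, rename, app.injEq] at h
    obtain ⟨rfl, h, -⟩ := h
    replace h := eq_of_heq h
    cases t with
    | app t v' =>
      simp only [rename, app.injEq] at h
      obtain ⟨rfl, h, -⟩ := h
      replace h := eq_of_heq h
      cases t with
      | acon g =>
        simp only [rename, acon.injEq] at h
        subst h
        exact ⟨_, _, rfl⟩
      | _ => simp [rename] at h
    | _ => simp [rename] at h
  | _ => simp [bin, rename] at h

open Classical in
/-- `f(v, w)` with the `f`-tree `v` reassociated to the right. -/
noncomputable def append {b : 𝒮.Base} (f : 𝒮.assoc b) (v w : Tm 𝒮 Γ (.base b)) :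
    Tm 𝒮 Γ (.base b) :=
  if h : ∃ p : Tm 𝒮 Γ (.base b) × Tm 𝒮 Γ (.base b), v = bin f p.1 p.2 then
    bin f h.choose.1 (append f h.choose.2 w)
  else bin f v w
termination_by v.size
decreasing_by
  conv_rhs => rw [h.choose_spec]
  rw [size_bin]; omega

theorem append_bin {b : 𝒮.Base} (f : 𝒮.assoc b) (v v' w : Tm 𝒮 Γ (.base b)) :
    append f (bin f v v') w = bin f v (append f v' w) := by
  have h : ∃ p : Tm 𝒮 Γ (.base b) × Tm 𝒮 Γ (.base b), bin f v v' = bin f p.1 p.2 :=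
    ⟨(v, v'), rfl⟩
  rw [append, dif_pos h]
  obtain ⟨-, h1, h2⟩ := bin_inj h.choose_spec
  rw [← h1, ← h2]

theorem append_of_ne {b : 𝒮.Base} (f : 𝒮.assoc b) {v : Tm 𝒮 Γ (.base b)}
    (h : ∀ v₁ v₂, v ≠ bin f v₁ v₂) (w : Tm 𝒮 Γ (.base b)) : append f v w = bin f v w := by
  rw [append, dif_neg]
  rintro ⟨p, hp⟩
  exact h _ _ hp

/-- Induction over the right spine of an `f`-tree. -/
theorem spine_induction {b : 𝒮.Base} (f : 𝒮.assoc b) {P : Tm 𝒮 Γ (.base b) → Prop}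
    (leaf : ∀ t, (∀ v w, t ≠ bin f v w) → P t) (node : ∀ v w, P w → P (bin f v w))
    (t : Tm 𝒮 Γ (.base b)) : P t := by
  by_cases h : ∃ v w, t = bin f v w
  · obtain ⟨v, w, ht⟩ := h
    rw [ht]
    exact node v w (spine_induction f leaf node w)
  · push Not at h
    exact leaf t h
termination_by t.size
decreasing_by rw [ht, size_bin]; omega

theorem append_assoc {b : 𝒮.Base} (f : 𝒮.assoc b) (u v w : Tm 𝒮 Γ (.base b)) :
    append f u (append f v w) = append f (append f u v) w := by
  induction u using spine_induction f with
  | leaf t h => rw [append_of_ne f h, append_of_ne f h, append_bin]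
  | node u₁ u₂ ih => simp only [append_bin, ih]

theorem append_rename {b : 𝒮.Base} (f : 𝒮.assoc b) (v w : Tm 𝒮 Γ (.base b)) (ρ : Ren Γ Δ) :
    (append f v w).rename ρ = append f (v.rename ρ) (w.rename ρ) := by
  induction v using spine_induction f with
  | leaf t h =>
    rw [append_of_ne f h, append_of_ne f]
    · rfl
    · intro v₁ v₂ h'
      obtain ⟨_, _, h''⟩ := rename_eq_bin h'
      exact h _ _ h''
  | node u₁ u₂ ih =>
    rw [append_bin]
    exact (congrArg (bin f _) ih).trans (append_bin f _ _ _).symm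

theorem append_eqv {b : 𝒮.Base} (f : 𝒮.assoc b) (v w : Tm 𝒮 Γ (.base b)) :
    Eqv .assoc (bin f v w) (append f v w) := by
  induction v using spine_induction f with
  | leaf t h => rw [append_of_ne f h]; exact .refl _
  | node u₁ u₂ ih =>
    rw [append_bin]
    exact (Eqv.assoc rfl f _ _ _).symm.trans ((Eqv.refl _).app ih)

theorem IsNf.isNe {b : 𝒮.Base} {t : Tm 𝒮 Γ (.base b)} (h : IsNf t) : IsNe t := by
  cases h; assumption

theorem IsNe.bin {b : 𝒮.Base} {f : 𝒮.assoc b} {v w : Tm 𝒮 Γ (.base b)} (hv : IsNe v)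
    (hw : IsNe w) : IsNe (bin f v w) :=
  .app (.app (.acon f) (.ne hv)) (.ne hw)

theorem isNe_bin {b : 𝒮.Base} {f : 𝒮.assoc b} {v w : Tm 𝒮 Γ (.base b)} (h : IsNe (Tm.bin f v w)) :
    IsNe v ∧ IsNe w := by
  cases h with
  | app h hw => cases h with | app h hv => exact ⟨hv.isNe, hw.isNe⟩

theorem isNe_append {b : 𝒮.Base} {f : 𝒮.assoc b} {v w : Tm 𝒮 Γ (.base b)} (hv : IsNe v)
    (hw : IsNe w) : IsNe (append f v w) := by
  induction v using spine_induction f with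
  | leaf t h => rw [append_of_ne f h]; exact hv.bin hw
  | node u₁ u₂ ih =>
    rw [append_bin]
    exact (isNe_bin hv).1.bin (ih (isNe_bin hv).2)

theorem isNf_isNe_rename (t : Tm 𝒮 Γ τ) (ρ : Ren Γ Δ) :
    (IsNf (t.rename ρ) ↔ IsNf t) ∧ (IsNe (t.rename ρ) ↔ IsNe t) := by
  induction t generalizing Δ with
  | bvar x =>
    have h : IsNe (.bvar (ρ _ x)) ↔ IsNe (.bvar x : Tm 𝒮 _ _) := ⟨fun _ => .bvar _, fun _ => .bvar _⟩
    refine ⟨⟨?_, ?_⟩, h⟩ <;> (intro h'; cases h'; exact .ne (.bvar _))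
  | fvar n =>
    refine ⟨⟨?_, ?_⟩, ⟨fun _ => .fvar _, fun _ => .fvar _⟩⟩ <;>
      (intro h'; cases h'; exact .ne (.fvar _))
  | con n =>
    refine ⟨⟨?_, ?_⟩, ⟨fun _ => .con _, fun _ => .con _⟩⟩ <;>
      (intro h'; cases h'; exact .ne (.con _))
  | acon n =>
    refine ⟨⟨?_, ?_⟩, ⟨fun _ => .acon _, fun _ => .acon _⟩⟩ <;> (intro h'; cases h')
  | lam t ih =>
    refine ⟨⟨?_, ?_⟩, ⟨?_, ?_⟩⟩ <;> intro h'
    · cases h' with | lam h' => exact .lam ((ih _).1.1 h')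
    · cases h' with | lam h' => exact .lam ((ih _).1.2 h')
    · cases h'
    · cases h'
  | app t v ih₁ ih₂ =>
    have h : IsNe ((app t v).rename ρ) ↔ IsNe (app t v) := by
      constructor
      · intro h; cases h with | app h1 h2 => exact .app ((ih₁ _).2.1 h1) ((ih₂ _).1.1 h2)
      · intro h; cases h with | app h1 h2 => exact .app ((ih₁ _).2.2 h1) ((ih₂ _).1.2 h2)
    refine ⟨⟨?_, ?_⟩, h⟩
    · intro h'; cases h' with | ne h' => exact .ne (h.1 h')
    · intro h'; cases h' with | ne h' => exact .ne (h.2 h')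

theorem isNf_rename {t : Tm 𝒮 Γ τ} {ρ : Ren Γ Δ} : IsNf (t.rename ρ) ↔ IsNf t :=
  (isNf_isNe_rename t ρ).1

theorem isNe_rename {t : Tm 𝒮 Γ τ} {ρ : Ren Γ Δ} : IsNe (t.rename ρ) ↔ IsNe t :=
  (isNf_isNe_rename t ρ).2

end Tm

open Tm

/-- Families of types indexed by contexts, on which renamings act functorially. -/
structure Psh (B : Type u) where
  obj : List (Ty B) → Type u
  map : {Γ Δ : List (Ty B)} → Ren Γ Δ → obj Γ → obj Δ
  map_id : ∀ {Γ : List (Ty B)} (a : obj Γ), map (fun _ x => x) a = a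
  map_map : ∀ {Γ Δ Θ : List (Ty B)} (ρ : Ren Γ Δ) (ρ' : Ren Δ Θ) (a : obj Γ),
    map ρ' (map ρ a) = map (fun τ x => ρ' τ (ρ τ x)) a

/-- The exponential: functions that are defined in all extensions of the context, naturally. -/
def Psh.exp {B : Type u} (P Q : Psh B) : Psh B where
  obj Γ := {F : ∀ Δ, Ren Γ Δ → P.obj Δ → Q.obj Δ //
    ∀ (Δ Θ : List (Ty B)) (ρ : Ren Γ Δ) (ρ' : Ren Δ Θ) (a : P.obj Δ),
      Q.map ρ' (F Δ ρ a) = F Θ (fun τ x => ρ' τ (ρ τ x)) (P.map ρ' a)}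
  map ρ F := ⟨fun Δ ρ' a => F.1 Δ (fun τ x => ρ' τ (ρ τ x)) a, fun _ _ _ _ _ => F.2 _ _ _ _ _⟩
  map_id _ := rfl
  map_map _ _ _ := rfl

/-- The meaning of a type: at base types, terms; at function types, the exponential. -/
def Sem (𝒮 : Sig.{u}) : Ty 𝒮.Base → Psh 𝒮.Base
  | .base b => ⟨fun Γ => Tm 𝒮 Γ (.base b), fun ρ t => t.rename ρ, rename_id,
      fun ρ ρ' t => rename_rename t ρ ρ'⟩
  | .arr σ τ => (Sem 𝒮 σ).exp (Sem 𝒮 τ)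

/-- Natural maps from terms to meanings and back. -/
structure Quote (𝒮 : Sig.{u}) (τ : Ty 𝒮.Base) where
  reflect : {Γ : List (Ty 𝒮.Base)} → Tm 𝒮 Γ τ → (Sem 𝒮 τ).obj Γ
  reify : {Γ : List (Ty 𝒮.Base)} → (Sem 𝒮 τ).obj Γ → Tm 𝒮 Γ τ
  map_reflect : ∀ {Γ Δ : List (Ty 𝒮.Base)} (ρ : Ren Γ Δ) (t : Tm 𝒮 Γ τ),
    (Sem 𝒮 τ).map ρ (reflect t) = reflect (t.rename ρ)
  rename_reify : ∀ {Γ Δ : List (Ty 𝒮.Base)} (ρ : Ren Γ Δ) (a : (Sem 𝒮 τ).obj Γ),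
    (reify a).rename ρ = reify ((Sem 𝒮 τ).map ρ a)

/-- `η`-expanding reflection of terms and reification of meanings. -/
def quote : (τ : Ty 𝒮.Base) → Quote 𝒮 τ
  | .base _ => ⟨fun t => t, fun t => t, fun _ _ => rfl, fun _ _ => rfl⟩
  | .arr σ τ =>
    { reflect := fun t => ⟨fun _ ρ a => (quote τ).reflect (.app (t.rename ρ) ((quote σ).reify a)),
        fun _ _ ρ ρ' a => by
          rw [(quote τ).map_reflect, rename, rename_rename, (quote σ).rename_reify]⟩
      reify := fun F => .lam ((quote τ).reify
        (F.1 _ (fun _ x => x.succ) ((quote σ).reflect (.bvar .zero))))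
      map_reflect := fun ρ t => by
        refine Subtype.ext ?_
        funext Δ ρ' a
        exact congrArg (fun z => (quote τ).reflect (.app z ((quote σ).reify a)))
          (rename_rename t ρ ρ').symm
      rename_reify := fun ρ F => by
        rw [rename, (quote τ).rename_reify, F.2, (quote σ).map_reflect]
        rfl }

/-- Meanings for the bound variables of `Γ`. -/
abbrev SemEnv (𝒮 : Sig.{u}) (Γ Δ : List (Ty 𝒮.Base)) : Type u := ∀ τ, Var Γ τ → (Sem 𝒮 τ).obj Δ

/-- An environment extended by a meaning for one more bound variable. -/
def SemEnv.cons (e : SemEnv 𝒮 Γ Δ) (a : (Sem 𝒮 σ).obj Δ) : SemEnv 𝒮 (σ :: Γ) Δ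
  | _, .zero => a
  | _, .succ x => e _ x

/-- Renaming of an environment. -/
def SemEnv.map (e : SemEnv 𝒮 Γ Δ) (ρ : Ren Δ Θ) : SemEnv 𝒮 Γ Θ := fun τ x => (Sem 𝒮 τ).map ρ (e τ x)

theorem SemEnv.map_cons (e : SemEnv 𝒮 Γ Δ) (a : (Sem 𝒮 σ).obj Δ) (ρ : Ren Δ Θ) :
    (e.cons a).map ρ = (e.map ρ).cons ((Sem 𝒮 σ).map ρ a) := by
  funext τ x; cases x <;> rfl

theorem SemEnv.map_map {Ξ : List (Ty 𝒮.Base)} (e : SemEnv 𝒮 Γ Δ) (ρ : Ren Δ Θ) (ρ' : Ren Θ Ξ) :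
    (e.map ρ).map ρ' = e.map (fun τ x => ρ' τ (ρ τ x)) := by
  funext τ x; exact (Sem 𝒮 τ).map_map _ _ _

/-- The meaning of a term, as a natural function of the environment.  An associative constant
means reassociation to the right, which is associative on the nose. -/
noncomputable def evalNatural : {Γ : List (Ty 𝒮.Base)} → {τ : Ty 𝒮.Base} → Tm 𝒮 Γ τ →
    {F : ∀ Δ, SemEnv 𝒮 Γ Δ → (Sem 𝒮 τ).obj Δ //
      ∀ (Δ Θ : List (Ty 𝒮.Base)) (e : SemEnv 𝒮 Γ Δ) (ρ : Ren Δ Θ),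
        (Sem 𝒮 τ).map ρ (F Δ e) = F Θ (e.map ρ)}
  | _, τ, .bvar x => ⟨fun _ e => e τ x, fun _ _ _ _ => rfl⟩
  | _, τ, .fvar n => ⟨fun _ _ => (quote τ).reflect (.fvar n), fun _ _ _ _ => (quote τ).map_reflect _ _⟩
  | _, τ, .con c => ⟨fun _ _ => (quote τ).reflect (.con c), fun _ _ _ _ => (quote τ).map_reflect _ _⟩
  | _, _, .acon f => ⟨fun _ _ => ⟨fun _ _ v => ⟨fun _ ρ w => append f (v.rename ρ) w,
      fun _ _ ρ ρ' w => (append_rename f _ w ρ').trans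
        (congrArg (append f · _) (rename_rename v ρ ρ'))⟩,
      fun _ _ _ ρ' v => Subtype.ext (by
        funext Θ ρ w
        exact congrArg (append f · _) (rename_rename v ρ' ρ).symm)⟩, fun _ _ _ _ => rfl⟩
  | _, _, .lam t => ⟨fun _ e => ⟨fun Θ ρ a => (evalNatural t).1 Θ ((e.map ρ).cons a),
      fun _ _ ρ ρ' a => by rw [(evalNatural t).2, SemEnv.map_cons, SemEnv.map_map]⟩,
      fun _ _ e ρ => Subtype.ext (by
        funext Θ ρ' a
        exact congrArg (fun e' : SemEnv 𝒮 _ Θ => (evalNatural t).1 Θ (e'.cons a))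
          (SemEnv.map_map e ρ ρ').symm)⟩
  | _, _, .app t v => ⟨fun Δ e => ((evalNatural t).1 Δ e).1 Δ (fun _ x => x) ((evalNatural v).1 Δ e),
      fun Δ Θ e ρ => (((evalNatural t).1 Δ e).2 _ _ _ _ _).trans
        ((congrArg (((evalNatural t).1 Δ e).1 Θ ρ) ((evalNatural v).2 Δ Θ e ρ)).trans
          (congrArg (fun F : (Sem 𝒮 (.arr _ _)).obj Θ => F.1 Θ (fun _ x => x) _)
            ((evalNatural t).2 Δ Θ e ρ)))⟩

/-- The meaning of a term in an environment. -/
noncomputable def eval (t : Tm 𝒮 Γ τ) (e : SemEnv 𝒮 Γ Δ) : (Sem 𝒮 τ).obj Δ := (evalNatural t).1 Δ e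

theorem map_eval (t : Tm 𝒮 Γ τ) (e : SemEnv 𝒮 Γ Δ) (ρ : Ren Δ Θ) :
    (Sem 𝒮 τ).map ρ (eval t e) = eval t (e.map ρ) :=
  (evalNatural t).2 _ _ _ _

theorem eval_app (t : Tm 𝒮 Γ (.arr σ τ)) (v : Tm 𝒮 Γ σ) (e : SemEnv 𝒮 Γ Δ) :
    eval (.app t v) e = (eval t e).1 Δ (fun _ x => x) (eval v e) := rfl

theorem eval_lam (t : Tm 𝒮 (σ :: Γ) τ) (e : SemEnv 𝒮 Γ Δ) (ρ : Ren Δ Θ) (a : (Sem 𝒮 σ).obj Θ) :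
    (eval (.lam t) e).1 Θ ρ a = eval t ((e.map ρ).cons a) := rfl

theorem eval_bin {b : 𝒮.Base} (f : 𝒮.assoc b) (v w : Tm 𝒮 Γ (.base b)) (e : SemEnv 𝒮 Γ Δ) :
    eval (bin f v w) e = append f (eval v e) (eval w e) :=
  congrArg (append f · _) (rename_id _)

theorem eval_rename (t : Tm 𝒮 Γ τ) (ρ : Ren Γ Δ) (e : SemEnv 𝒮 Δ Θ) :
    eval (t.rename ρ) e = eval t (fun τ x => e τ (ρ τ x)) := by
  induction t generalizing Δ Θ with
  | lam t ih =>
    refine Subtype.ext ?_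
    funext Ξ ρ' a
    simp only [rename, eval_lam, ih]
    congr 1; funext τ x; cases x <;> rfl
  | app t v ih₁ ih₂ => simp only [rename, eval_app, ih₁, ih₂]
  | _ => rfl

theorem eval_bsubst (t : Tm 𝒮 Γ τ) (s : Env 𝒮 Γ Δ) (e : SemEnv 𝒮 Δ Θ) :
    eval (t.bsubst s) e = eval t (fun τ x => eval (s τ x) e) := by
  induction t generalizing Δ Θ with
  | lam t ih =>
    refine Subtype.ext ?_
    funext Ξ ρ' a
    simp only [bsubst, eval_lam, ih]
    congr 1; funext τ x
    cases x
    · rfl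
    · simp only [liftEnv, wk, eval_rename, SemEnv.cons, SemEnv.map, map_eval]
      rfl
  | app t v ih₁ ih₂ => simp only [bsubst, eval_app, ih₁, ih₂]
  | _ => rfl

/-- Terms that are equal modulo `β`, `η` and associativity have the same meaning. -/
theorem eval_eq_of_eqv {t v : Tm 𝒮 Γ τ} (h : Eqv E t v) (e : SemEnv 𝒮 Γ Δ) :
    eval t e = eval v e := by
  induction h generalizing Δ with
  | refl => rfl
  | symm _ ih => exact (ih e).symm
  | trans _ _ ih₁ ih₂ => exact (ih₁ e).trans (ih₂ e)
  | lam _ ih =>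
    refine Subtype.ext ?_
    funext Ξ ρ a
    exact ih _
  | app _ _ ih₁ ih₂ => rw [eval_app, eval_app, ih₁, ih₂]
  | beta t v =>
    rw [eval_app, eval_lam, inst, eval_bsubst]
    congr 1; funext τ x
    cases x
    · rfl
    · exact (Sem 𝒮 _).map_id _
  | eta t =>
    refine Subtype.ext ?_
    funext Ξ ρ a
    rw [eval_lam, eval_app, wk, eval_rename]
    have : (fun τ x => (e.map ρ).cons a τ (Var.succ x)) = e.map ρ := rfl
    rw [this, ← map_eval]
    rfl
  | assoc h f => simp only [eval_bin]; exact append_assoc f _ _ _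

/-- The logical relation between terms and their meanings. -/
def Realizes : (τ : Ty 𝒮.Base) → {Γ : List (Ty 𝒮.Base)} → Tm 𝒮 Γ τ → (Sem 𝒮 τ).obj Γ → Prop
  | .base _, _, t, a => Eqv .assoc t a ∧ IsNe a
  | .arr σ τ, Γ, t, F => ∀ (Δ : List (Ty 𝒮.Base)) (ρ : Ren Γ Δ) (v : Tm 𝒮 Δ σ) (a : (Sem 𝒮 σ).obj Δ),
      Realizes σ v a → Realizes τ (.app (t.rename ρ) v) (F.1 Δ ρ a)

namespace Realizes

theorem of_eqv {t t' : Tm 𝒮 Γ τ} {a : (Sem 𝒮 τ).obj Γ} (h : Realizes τ t a) (ht : Eqv .assoc t' t) :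
    Realizes τ t' a := by
  induction τ generalizing Γ with
  | base b => exact ⟨ht.trans h.1, h.2⟩
  | arr σ τ _ ih => exact fun Δ ρ v a hv => ih (h Δ ρ v a hv) ((ht.rename ρ).app (.refl _))

theorem rename {t : Tm 𝒮 Γ τ} {a : (Sem 𝒮 τ).obj Γ} (h : Realizes τ t a) (ρ : Ren Γ Δ) :
    Realizes τ (t.rename ρ) ((Sem 𝒮 τ).map ρ a) := by
  cases τ with
  | base b => exact ⟨h.1.rename ρ, isNe_rename.2 h.2⟩
  | arr σ τ =>
    intro Θ ρ' v a hv
    rw [rename_rename]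
    exact h _ _ _ _ hv

/-- Neutral terms realize their reflections, and every term equals the reification, a normal form,
of whatever it realizes. -/
theorem reflect_reify (τ : Ty 𝒮.Base) : ∀ {Γ : List (Ty 𝒮.Base)},
    (∀ n : Tm 𝒮 Γ τ, IsNe n → Realizes τ n ((quote τ).reflect n)) ∧
    (∀ (t : Tm 𝒮 Γ τ) (a : (Sem 𝒮 τ).obj Γ), Realizes τ t a →
      Eqv .assoc t ((quote τ).reify a) ∧ IsNf ((quote τ).reify a)) := by
  induction τ with
  | base b => exact fun {Γ} => ⟨fun n hn => ⟨.refl _, hn⟩, fun t a h => ⟨h.1, .ne h.2⟩⟩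
  | arr σ τ ih₁ ih₂ =>
    refine fun {Γ} => ⟨fun n hn Δ ρ v a hv => ?_, fun t F h => ?_⟩
    · obtain ⟨h1, h2⟩ := ih₁.2 v a hv
      exact (ih₂.1 _ (.app (isNe_rename.2 hn) h2)).of_eqv ((Eqv.refl _).app h1)
    · obtain ⟨h1, h2⟩ := ih₂.2 _ _ (h (σ :: Γ) (fun _ x => x.succ) (.bvar .zero) _ (ih₁.1 _ (.bvar _)))
      exact ⟨(Eqv.eta t).symm.trans h1.lam, h2.lam⟩

end Realizes

/-- The fundamental lemma of the logical relation. -/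
theorem realizes_eval (t : Tm 𝒮 Γ τ) (s : Env 𝒮 Γ Δ) (e : SemEnv 𝒮 Γ Δ)
    (h : ∀ τ x, Realizes τ (s τ x) (e τ x)) : Realizes τ (t.bsubst s) (eval t e) := by
  induction t generalizing Δ with
  | bvar x => exact h _ x
  | fvar n => exact (Realizes.reflect_reify _).1 _ (.fvar n)
  | con c => exact (Realizes.reflect_reify _).1 _ (.con c)
  | acon f =>
    intro Θ ρ v a hv Ξ ρ' w c hw
    have h1 := hv.rename ρ'
    exact ⟨((Eqv.refl _).app h1.1).app hw.1 |>.trans (append_eqv f _ _), isNe_append h1.2 hw.2⟩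
  | @lam Γ σ τ t ih =>
    intro Θ ρ v a hv
    let s' : Env 𝒮 (σ :: Γ) Θ := fun
      | _, .zero => v
      | _, .succ x => (s _ x).rename ρ
    have h1 : Realizes τ (t.bsubst s') (eval t ((e.map ρ).cons a)) := by
      refine ih s' _ ?_
      intro τ x
      cases x
      · exact hv
      · exact (h _ _).rename ρ
    refine h1.of_eqv ((Eqv.beta _ _).trans (.of_eq ?_))
    simp only [inst, bsubst_rename, bsubst_bsubst]
    congr 1; funext τ x
    cases x
    · rfl
    · simp only [liftEnv, wk, bsubst_rename]; exact (rename_eq_bsubst _ _).symm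
  | app t v ih₁ ih₂ =>
    have := ih₁ s e h Δ (fun _ x => x) _ _ (ih₂ s e h)
    rwa [rename_id] at this

/-- The identity environment. -/
def SemEnv.id (𝒮 : Sig.{u}) (Γ : List (Ty 𝒮.Base)) : SemEnv 𝒮 Γ Γ :=
  fun τ x => (quote τ).reflect (.bvar x)

theorem SemEnv.map_id_env (ρ : Ren Γ Δ) :
    (SemEnv.id 𝒮 Γ).map ρ = fun τ x => SemEnv.id 𝒮 Δ τ (ρ τ x) := by
  funext τ x; exact (quote τ).map_reflect _ _

namespace Tm

/-- The canonical form of a term: its `η`-long `β`-normal form with all trees of an associative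
constant reassociated to the right. -/
noncomputable def canon (t : Tm 𝒮 Γ τ) : Tm 𝒮 Γ τ := (quote τ).reify (eval t (SemEnv.id 𝒮 Γ))

theorem canon_spec (t : Tm 𝒮 Γ τ) : Eqv .assoc t t.canon ∧ IsNf t.canon := by
  refine (Realizes.reflect_reify τ).2 t _ ?_
  have := realizes_eval t (fun _ x => .bvar x) (SemEnv.id 𝒮 Γ)
    fun τ x => (Realizes.reflect_reify τ).1 _ (.bvar x)
  rwa [bsubst_bvar] at this

theorem eqv_canon (t : Tm 𝒮 Γ τ) : Eqv .assoc t t.canon := (canon_spec t).1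

theorem isNf_canon (t : Tm 𝒮 Γ τ) : IsNf t.canon := (canon_spec t).2

theorem Eqv.canon_eq {t v : Tm 𝒮 Γ τ} (h : Eqv E t v) : t.canon = v.canon := by
  rw [canon, canon, eval_eq_of_eqv h]

theorem eqv_iff_canon_eq {t v : Tm 𝒮 Γ τ} : Eqv .assoc t v ↔ t.canon = v.canon :=
  ⟨fun h => h.canon_eq, fun h => (eqv_canon t).trans ((Eqv.of_eq h).trans (eqv_canon v).symm)⟩

/-- Canonical forms are natural, since the model is: a term and its renamed copies decompose in the
same way. -/
theorem canon_rename (t : Tm 𝒮 Γ τ) (ρ : Ren Γ Δ) : (t.rename ρ).canon = t.canon.rename ρ := by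
  rw [canon, canon, (quote τ).rename_reify, map_eval, SemEnv.map_id_env, eval_rename]

theorem canon_lam (t : Tm 𝒮 (σ :: Γ) τ) : (lam t).canon = lam t.canon := by
  refine congrArg (fun e => lam ((quote τ).reify (eval t e))) ?_
  funext α x
  cases x
  · rfl
  · exact (quote _).map_reflect _ _

theorem canon_bin {b : 𝒮.Base} (f : 𝒮.assoc b) (v w : Tm 𝒮 Γ (.base b)) :
    (bin f v w).canon = append f v.canon w.canon :=
  eval_bin f v w _

/-- Atoms that are not associative constants. -/
inductive IsAtom : {Γ : List (Ty 𝒮.Base)} → {τ : Ty 𝒮.Base} → Tm 𝒮 Γ τ → Prop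
  | bvar {Γ : List (Ty 𝒮.Base)} {τ : Ty 𝒮.Base} (x : Var Γ τ) : IsAtom (.bvar x)
  | fvar {Γ : List (Ty 𝒮.Base)} {τ : Ty 𝒮.Base} (n : ℕ) : IsAtom (.fvar n : Tm 𝒮 Γ τ)
  | con {Γ : List (Ty 𝒮.Base)} {τ : Ty 𝒮.Base} (c : 𝒮.free τ) : IsAtom (.con c : Tm 𝒮 Γ τ)

theorem eval_apps {h : Tm 𝒮 Γ (arrows Δ τ)} {h' : Tm 𝒮 Θ (arrows Δ τ)} (ts : Env 𝒮 Δ Γ)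
    (e : SemEnv 𝒮 Γ Θ) (hh : eval h e = (quote _).reflect h') :
    eval (apps Δ h ts) e =
      (quote τ).reflect (apps Δ h' (fun σ x => (quote σ).reify (eval (ts σ x) e))) := by
  induction Δ generalizing τ with
  | nil => exact hh
  | cons σ Δ ih =>
    refine (congrArg (fun F : (Sem 𝒮 (.arr σ τ)).obj Θ => F.1 Θ (fun _ x => x) (eval (ts _ .zero) e))
      (ih (τ := .arr σ τ) (fun _ x => ts _ x.succ) hh)).trans ?_
    exact congrArg (fun z => (quote τ).reflect (.app z _)) (rename_id _)

/-- Together with `canon_lam` and `canon_bin`, this computes canonical forms along the structure of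
normal forms; it makes free constants, bound and free variables injective modulo associativity. -/
theorem canon_apps {b : 𝒮.Base} {h : Tm 𝒮 Γ (arrows Δ (.base b))} (hh : IsAtom h)
    (ts : Env 𝒮 Δ Γ) : (apps Δ h ts).canon = apps Δ h (fun σ x => (ts σ x).canon) := by
  refine eval_apps ts _ ?_
  generalize arrows Δ (.base b) = τ at h hh
  cases hh <;> rfl

end Tm

end AntiUnif

/-! ### Spines, heads and bound variables of normal forms -/

namespace AntiUnif

variable {𝒮 : Sig.{u}} {Γ Δ Θ : List (Ty 𝒮.Base)} {σ τ : Ty 𝒮.Base} {E : Tm.Theory}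

/-- A family extended by a value for one more argument. -/
def Env.cons (v : Tm 𝒮 Γ σ) (e : Env 𝒮 Δ Γ) : Env 𝒮 (σ :: Δ) Γ
  | _, .zero => v
  | _, .succ x => e _ x

namespace Tm

/-- Normal forms with the spine `h(t₁, …, tₘ)` of a term of basic type made explicit. -/
inductive NfSpine : {Γ : List (Ty 𝒮.Base)} → {τ : Ty 𝒮.Base} → Tm 𝒮 Γ τ → Prop
  | lam {Γ : List (Ty 𝒮.Base)} {σ τ : Ty 𝒮.Base} {t : Tm 𝒮 (σ :: Γ) τ} :
      NfSpine t → NfSpine (.lam t)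
  | atom {Γ Δ : List (Ty 𝒮.Base)} {b : 𝒮.Base} {h : Tm 𝒮 Γ (arrows Δ (.base b))} (hh : IsAtom h)
      (ts : Env 𝒮 Δ Γ) (hts : ∀ α x, NfSpine (ts α x)) : NfSpine (apps Δ h ts)
  | bin {Γ : List (Ty 𝒮.Base)} {b : 𝒮.Base} (f : 𝒮.assoc b) {v w : Tm 𝒮 Γ (.base b)} :
      NfSpine v → NfSpine w → NfSpine (bin f v w)

/-- Atoms applied to some of their arguments, as spines. -/
inductive NeSpine : {Γ : List (Ty 𝒮.Base)} → {τ : Ty 𝒮.Base} → Tm 𝒮 Γ τ → Prop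
  | atom {Γ Δ : List (Ty 𝒮.Base)} {τ : Ty 𝒮.Base} {h : Tm 𝒮 Γ (arrows Δ τ)} (hh : IsAtom h)
      (ts : Env 𝒮 Δ Γ) (hts : ∀ α x, NfSpine (ts α x)) : NeSpine (apps Δ h ts)
  | acon {Γ : List (Ty 𝒮.Base)} {b : 𝒮.Base} (f : 𝒮.assoc b) :
      NeSpine (.acon f : Tm 𝒮 Γ (.arr (.base b) (.arr (.base b) (.base b))))
  | acon₁ {Γ : List (Ty 𝒮.Base)} {b : 𝒮.Base} (f : 𝒮.assoc b) {v : Tm 𝒮 Γ (.base b)} :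
      NfSpine v → NeSpine (.app (.acon f) v)
  | acon₂ {Γ : List (Ty 𝒮.Base)} {b : 𝒮.Base} (f : 𝒮.assoc b) {v w : Tm 𝒮 Γ (.base b)} :
      NfSpine v → NfSpine w → NeSpine (.app (.app (.acon f) v) w)

theorem NeSpine.of_atom {h : Tm 𝒮 Γ τ} (hh : IsAtom h) : NeSpine h :=
  .atom (Δ := []) hh (fun _ x => nomatch x) (fun _ x => nomatch x)

theorem NeSpine.app {t : Tm 𝒮 Γ (.arr σ τ)} {v : Tm 𝒮 Γ σ} (ht : NeSpine t) (hv : NfSpine v) :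
    NeSpine (.app t v) := by
  cases ht with
  | @atom Δ _ h hh ts hts =>
    exact NeSpine.atom (Δ := σ :: Δ) (τ := τ) hh (Env.cons v ts) (by rintro α (_ | x); exacts [hv, hts _ x])
  | acon f => exact .acon₁ f hv
  | acon₁ f hv' => exact .acon₂ f hv' hv

theorem NeSpine.nf {b : 𝒮.Base} {t : Tm 𝒮 Γ (.base b)} (ht : NeSpine t) : NfSpine t := by
  cases ht with
  | atom hh ts hts => exact .atom hh ts hts
  | acon₂ f hv hw => exact .bin f hv hw

theorem nfSpine_neSpine (t : Tm 𝒮 Γ τ) : (IsNf t → NfSpine t) ∧ (IsNe t → NeSpine t) := by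
  induction t with
  | bvar x =>
    exact ⟨fun h => by cases h; exact (NeSpine.of_atom (.bvar x)).nf, fun _ => .of_atom (.bvar x)⟩
  | fvar n =>
    exact ⟨fun h => by cases h; exact (NeSpine.of_atom (.fvar n)).nf, fun _ => .of_atom (.fvar n)⟩
  | con c =>
    exact ⟨fun h => by cases h; exact (NeSpine.of_atom (.con c)).nf, fun _ => .of_atom (.con c)⟩
  | acon f => exact ⟨fun h => (by cases h), fun _ => .acon f⟩
  | lam t ih =>
    exact ⟨fun h => by cases h with | lam h => exact .lam (ih.1 h), fun h => (by cases h)⟩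
  | app t v ih₁ ih₂ =>
    have h : IsNe (.app t v) → NeSpine (.app t v) := by
      intro h; cases h with | app ht hv => exact (ih₁.2 ht).app (ih₂.1 hv)
    exact ⟨fun h' => by cases h' with | ne h' => exact (h h').nf, h⟩

theorem IsNf.nfSpine {t : Tm 𝒮 Γ τ} (h : IsNf t) : NfSpine t := (nfSpine_neSpine t).1 h

theorem IsAtom.isNe {h : Tm 𝒮 Γ τ} (hh : IsAtom h) : IsNe h := by
  cases hh with
  | bvar x => exact .bvar x
  | fvar n => exact .fvar n
  | con c => exact .con c

theorem IsNe.apps {h : Tm 𝒮 Γ (arrows Δ τ)} (hh : IsNe h) {ts : Env 𝒮 Δ Γ}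
    (hts : ∀ α x, IsNf (ts α x)) : IsNe (Tm.apps Δ h ts) := by
  induction Δ generalizing τ with
  | nil => exact hh
  | cons σ Δ ih => exact .app (ih (τ := .arr σ τ) hh fun _ x => hts _ x.succ) (hts _ .zero)

theorem NfSpine.isNf {t : Tm 𝒮 Γ τ} (h : NfSpine t) : IsNf t := by
  induction h with
  | lam _ ih => exact .lam ih
  | atom hh ts _ ih => exact .ne (IsNe.apps hh.isNe ih)
  | bin f _ _ ih₁ ih₂ => exact .ne (ih₁.isNe.bin ih₂.isNe)

theorem IsNf.bin {b : 𝒮.Base} {f : 𝒮.assoc b} {v w : Tm 𝒮 Γ (.base b)} (hv : IsNf v)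
    (hw : IsNf w) : IsNf (Tm.bin f v w) := .ne (hv.isNe.bin hw.isNe)

theorem isNf_bin {b : 𝒮.Base} {f : 𝒮.assoc b} {v w : Tm 𝒮 Γ (.base b)} (h : IsNf (Tm.bin f v w)) :
    IsNf v ∧ IsNf w :=
  ⟨.ne (isNe_bin h.isNe).1, .ne (isNe_bin h.isNe).2⟩

theorem isNf_arr {t : Tm 𝒮 Γ (.arr σ τ)} (h : IsNf t) : ∃ t', t = .lam t' ∧ IsNf t' := by
  cases h with | lam h => exact ⟨_, rfl, h⟩

/-- The image of a head symbol under a renaming. -/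
def Head.rename (ρ : Ren Γ Δ) : Head 𝒮 Γ → Head 𝒮 Δ
  | .bvar x => .bvar ⟨x.1, ρ x.1 x.2⟩
  | .fvar Z => .fvar Z
  | .con c => .con c
  | .acon f => .acon f

theorem Head.rename_injective {ρ : Ren Γ Δ} (h : ∀ α, Function.Injective (ρ α)) :
    Function.Injective (Head.rename ρ : Head 𝒮 Γ → Head 𝒮 Δ) := by
  intro x y hxy
  cases x with
  | bvar x =>
    cases y with
    | bvar y =>
      obtain ⟨α, x⟩ := x
      obtain ⟨β, y⟩ := y
      simp only [Head.rename, Head.bvar.injEq, Sigma.mk.injEq] at hxy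
      obtain ⟨rfl, hxy⟩ := hxy
      rw [h _ (eq_of_heq hxy)]
    | _ => simp [Head.rename] at hxy
  | _ => cases y <;> simp_all [Head.rename]

theorem head_rename (t : Tm 𝒮 Γ τ) (ρ : Ren Γ Δ) : (t.rename ρ).head = t.head.map (Head.rename ρ) := by
  induction t generalizing Δ with
  | app t v ih _ => exact ih ρ
  | _ => rfl

theorem head_append {b : 𝒮.Base} (f : 𝒮.assoc b) (v w : Tm 𝒮 Γ (.base b)) :
    (append f v w).head = some (.acon ⟨b, f⟩) := by
  by_cases h : ∃ v₁ v₂, v = bin f v₁ v₂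
  · obtain ⟨v₁, v₂, rfl⟩ := h
    rw [append_bin]; rfl
  · push Not at h
    rw [append_of_ne f h]; rfl

theorem head_canon {b : 𝒮.Base} {t : Tm 𝒮 Γ (.base b)} (h : IsNf t) : t.canon.head = t.head := by
  cases h.nfSpine with
  | atom hh ts => rw [canon_apps hh, head_apps, head_apps]
  | bin f => rw [canon_bin, head_append]; rfl

theorem head_eq_of_eqv {b : 𝒮.Base} {t v : Tm 𝒮 Γ (.base b)} (ht : IsNf t) (hv : IsNf v)
    (h : Eqv .assoc t v) : t.head = v.head := by
  rw [← head_canon ht, h.canon_eq, head_canon hv]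

theorem head_atom_ne_acon {h : Tm 𝒮 Γ τ} (hh : IsAtom h) (f : (b : 𝒮.Base) × 𝒮.assoc b) :
    h.head ≠ some (.acon f) := by
  cases hh <;> simp [head]

theorem head_eq_acon_iff {b : 𝒮.Base} {t : Tm 𝒮 Γ (.base b)} (h : IsNf t) (f : 𝒮.assoc b) :
    t.head = some (.acon ⟨b, f⟩) ↔ ∃ v w, t = bin f v w := by
  constructor
  · intro ht
    cases h.nfSpine with
    | atom hh ts => rw [head_apps] at ht; exact absurd ht (head_atom_ne_acon hh _)
    | bin g => simp only [bin, head, Option.some.injEq, Head.acon.injEq, Sigma.mk.injEq, heq_eq_eq,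
        true_and] at ht; subst ht; exact ⟨_, _, rfl⟩
  · rintro ⟨v, w, rfl⟩; rfl

/-! ### Bound variables that occur in a term -/

theorem hasVar_rename (t : Tm 𝒮 Γ τ) (ρ : Ren Γ Δ) (y : Var Δ σ) :
    (t.rename ρ).HasVar y ↔ ∃ x, ρ _ x = y ∧ t.HasVar x := by
  induction t generalizing Δ with
  | bvar z =>
    simp only [rename, HasVar]
    constructor
    · intro h
      simp only [Sigma.mk.injEq] at h
      obtain ⟨rfl, h⟩ := h
      exact ⟨z, (eq_of_heq h).symm, rfl⟩
    · rintro ⟨x, rfl, h⟩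
      simp only [Sigma.mk.injEq] at h
      obtain ⟨rfl, h⟩ := h
      rw [eq_of_heq h]
  | lam t ih =>
    simp only [rename, HasVar, ih]
    constructor
    · rintro ⟨x, hx, h⟩
      cases x with
      | zero => simp [Ren.lift] at hx
      | succ x => exact ⟨x, by simpa [Ren.lift] using hx, h⟩
    · rintro ⟨x, rfl, h⟩
      exact ⟨x.succ, rfl, h⟩
  | app t v ih₁ ih₂ => simp only [rename, HasVar, ih₁, ih₂, and_or_left, exists_or]
  | _ => simp [rename, HasVar]

theorem hasVar_apps (y : Var Γ σ) (t : Tm 𝒮 Γ (arrows Δ τ)) (e : Env 𝒮 Δ Γ) :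
    (apps Δ t e).HasVar y ↔ t.HasVar y ∨ ∃ σ x, (e σ x).HasVar y := by
  induction Δ generalizing τ with
  | nil =>
    refine ⟨.inl, ?_⟩
    rintro (h | ⟨σ, x, -⟩)
    · exact h
    · cases x
  | cons α Δ ih =>
    refine (or_congr_left (ih (τ := .arr α τ) t _)).trans (or_assoc.trans (or_congr_right ⟨?_, ?_⟩))
    · rintro (⟨σ, x, h⟩ | h)
      · exact ⟨σ, _, h⟩
      · exact ⟨_, _, h⟩
    · rintro ⟨σ, x, h⟩
      cases x
      · exact .inr h
      · exact .inl ⟨_, _, h⟩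

theorem hasVar_bin {b : 𝒮.Base} (f : 𝒮.assoc b) (y : Var Γ σ) (v w : Tm 𝒮 Γ (.base b)) :
    (bin f v w).HasVar y ↔ v.HasVar y ∨ w.HasVar y := by
  simp [bin, HasVar]

theorem hasVar_append {b : 𝒮.Base} (f : 𝒮.assoc b) (y : Var Γ σ) (v w : Tm 𝒮 Γ (.base b)) :
    (append f v w).HasVar y ↔ v.HasVar y ∨ w.HasVar y := by
  induction v using spine_induction f with
  | leaf t h => rw [append_of_ne f h, hasVar_bin]
  | node u₁ u₂ ih => rw [append_bin, hasVar_bin, hasVar_bin, ih, or_assoc]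

theorem hasVar_canon {t : Tm 𝒮 Γ τ} (h : IsNf t) (y : Var Γ σ) : t.canon.HasVar y ↔ t.HasVar y := by
  replace h := h.nfSpine
  induction h with
  | lam _ ih => rw [canon_lam]; exact ih _
  | atom hh ts _ ih => simp only [canon_apps hh, hasVar_apps, ih]
  | bin f _ _ ih₁ ih₂ =>
    rw [canon_bin]
    exact (hasVar_append f y _ _).trans ((or_congr (ih₁ y) (ih₂ y)).trans (hasVar_bin f y _ _).symm)

theorem hasVar_iff_of_eqv {t v : Tm 𝒮 Γ τ} (ht : IsNf t) (hv : IsNf v) (h : Eqv .assoc t v)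
    (y : Var Γ σ) : t.HasVar y ↔ v.HasVar y := by
  rw [← hasVar_canon ht, h.canon_eq, hasVar_canon hv]

theorem exists_eq_rename (t : Tm 𝒮 Γ τ) (ρ : Ren Δ Γ)
    (h : ∀ α (x : Var Γ α), t.HasVar x → ∃ y, ρ α y = x) : ∃ t', t = rename ρ t' := by
  induction t generalizing Δ with
  | bvar x => obtain ⟨y, rfl⟩ := h _ x rfl; exact ⟨.bvar y, rfl⟩
  | fvar n => exact ⟨.fvar n, rfl⟩
  | con n => exact ⟨.con n, rfl⟩
  | acon n => exact ⟨.acon n, rfl⟩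
  | lam t ih =>
    obtain ⟨t', rfl⟩ := ih (ρ.lift _) (by
      rintro α (_ | x) hx
      · exact ⟨.zero, rfl⟩
      · obtain ⟨y, rfl⟩ := h _ x hx; exact ⟨y.succ, rfl⟩)
    exact ⟨.lam t', rfl⟩
  | app t v ih₁ ih₂ =>
    obtain ⟨t', rfl⟩ := ih₁ ρ fun α x hx => h α x (.inl hx)
    obtain ⟨v', rfl⟩ := ih₂ ρ fun α x hx => h α x (.inr hx)
    exact ⟨.app t' v', rfl⟩

end Tm

theorem Thin.ren_injective : ∀ {Δ Γ : List (Ty 𝒮.Base)} (ι : Thin Δ Γ) (α : Ty 𝒮.Base),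
    Function.Injective (ι.ren α)
  | _, _, .nil, _ => fun x => nomatch x
  | _, _, .keep ι, α => Ren.lift_injective (Thin.ren_injective ι) α
  | _, _, .drop ι, α => fun _ _ h => Thin.ren_injective ι α (Var.succ.inj h)

/-- The subsequence of the bound variables with a given property. -/
theorem exists_thin (P : ∀ α, Var Γ α → Prop) :
    ∃ (Δ : List (Ty 𝒮.Base)) (ι : Thin Δ Γ), ∀ α x, P α x ↔ ∃ y, ι.ren α y = x := by
  induction Γ with
  | nil => exact ⟨[], .nil, fun α x => nomatch x⟩
  | cons σ Γ ih =>
    obtain ⟨Δ, ι, h⟩ := ih fun α x => P α x.succ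
    by_cases h0 : P σ .zero
    · refine ⟨σ :: Δ, .keep ι, ?_⟩
      rintro α (_ | x)
      · exact ⟨fun _ => ⟨.zero, rfl⟩, fun _ => h0⟩
      · rw [h]
        constructor
        · rintro ⟨y, rfl⟩; exact ⟨y.succ, rfl⟩
        · rintro ⟨_ | y, hy⟩
          · simp [Thin.ren, Ren.lift] at hy
          · exact ⟨y, by simpa [Thin.ren, Ren.lift] using hy⟩
    · refine ⟨Δ, .drop ι, ?_⟩
      rintro α (_ | x)
      · exact ⟨fun h => absurd h h0, fun ⟨y, hy⟩ => by simp [Thin.ren] at hy⟩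
      · rw [h]
        constructor
        · rintro ⟨y, rfl⟩; exact ⟨y, rfl⟩
        · rintro ⟨y, hy⟩; exact ⟨y, by simpa [Thin.ren] using hy⟩

/-- Any two terms live over the subsequence of the bound variables that occur in one of them. -/
theorem exists_thin_rename (t v : Tm 𝒮 Γ τ) :
    ∃ (Δ : List (Ty 𝒮.Base)) (ι : Thin Δ Γ) (t' v' : Tm 𝒮 Δ τ),
      t = t'.rename ι.ren ∧ v = v'.rename ι.ren ∧ ∀ α (y : Var Δ α), t'.HasVar y ∨ v'.HasVar y := by
  obtain ⟨Δ, ι, h⟩ := exists_thin fun α (x : Var Γ α) => t.HasVar x ∨ v.HasVar x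
  obtain ⟨t', rfl⟩ := t.exists_eq_rename ι.ren fun α x hx => (h α x).1 (.inl hx)
  obtain ⟨v', rfl⟩ := v.exists_eq_rename ι.ren fun α x hx => (h α x).1 (.inr hx)
  refine ⟨Δ, ι, t', v', rfl, rfl, fun α y => ?_⟩
  have := (h α (ι.ren α y)).2 ⟨y, rfl⟩
  simp only [Tm.hasVar_rename] at this
  rcases this with ⟨x, hx, h⟩ | ⟨x, hx, h⟩ <;> rw [ι.ren_injective α hx] at h
  · exact .inl h
  · exact .inr h

namespace Tm

/-! ### Flattened forms -/

section Flat

variable {b : 𝒮.Base} {f : 𝒮.assoc b} {t v w : Tm 𝒮 Γ (.base b)} {ts vs ws : List (Tm 𝒮 Γ (.base b))}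

theorem exists_flat (f : 𝒮.assoc b) (t : Tm 𝒮 Γ (.base b)) : ∃ ts, Flat f t ts := by
  by_cases h : ∃ v w, t = bin f v w
  · obtain ⟨v, w, ht⟩ := h
    obtain ⟨vs, hv⟩ := exists_flat f v
    obtain ⟨ws, hw⟩ := exists_flat f w
    exact ⟨_, ht ▸ hv.node hw⟩
  · push Not at h
    exact ⟨_, .leaf h⟩
termination_by t.size
decreasing_by all_goals rw [ht, size_bin]; omega

theorem Flat.ne_nil (h : Flat f t ts) : ts ≠ [] := by
  induction h with
  | leaf => simp
  | node _ _ ih _ => simp [ih]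

theorem Flat.eq_of_ne (h : Flat f t ts) (ht : ∀ v w, t ≠ bin f v w) : ts = [t] := by
  cases h with
  | leaf => rfl
  | node => exact absurd rfl (ht _ _)

theorem Flat.unique (h : Flat f t ts) (h' : Flat f t vs) : ts = vs := by
  induction h generalizing vs with
  | leaf h => exact (h'.eq_of_ne h).symm
  | @node v w _ _ _ _ ih₁ ih₂ =>
    generalize hu : bin f v w = u at h'
    cases h' with
    | leaf h => exact absurd hu.symm (h _ _)
    | node h1 h2 =>
      obtain ⟨-, rfl, rfl⟩ := bin_inj hu
      rw [ih₁ h1, ih₂ h2]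

theorem Flat.append (hv : Flat f v vs) (hw : Flat f w ws) : Flat f (append f v w) (vs ++ ws) := by
  induction hv generalizing w ws with
  | leaf h => rw [append_of_ne f h]; exact .node (.leaf h) hw
  | @node v w' vs ws' hv hw' ih₁ ih₂ =>
    clear ih₁
    rw [append_bin, List.append_assoc]
    exact hv.node (ih₂ hw)

theorem Flat.isNf (h : Flat f t ts) (ht : IsNf t) : ∀ v ∈ ts, IsNf v := by
  induction h with
  | leaf => simpa using ht
  | node _ _ ih₁ ih₂ =>
    intro u hu
    rcases List.mem_append.1 hu with hu | hu
    · exact ih₁ (isNf_bin ht).1 u hu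
    · exact ih₂ (isNf_bin ht).2 u hu

theorem Flat.canon (h : Flat f t ts) (ht : IsNf t) : Flat f t.canon (ts.map Tm.canon) := by
  induction h with
  | @leaf t h =>
    refine .leaf ?_
    intro v w hvw
    obtain ⟨v, w, hvw⟩ := (head_eq_acon_iff ht f).1 ((head_canon ht).symm.trans (by rw [hvw]; rfl))
    exact h v w hvw
  | node _ _ ih₁ ih₂ =>
    rw [canon_bin, List.map_append]
    exact (ih₁ (isNf_bin ht).1).append (ih₂ (isNf_bin ht).2)

theorem acomb_append (f : 𝒮.assoc b) (t v : Tm 𝒮 Γ (.base b)) (ts vs : List (Tm 𝒮 Γ (.base b))) :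
    Eqv .assoc (acomb f t (ts ++ v :: vs)) (bin f (acomb f t ts) (acomb f v vs)) := by
  induction ts generalizing t with
  | nil => exact .refl _
  | cons u us ih => exact ((Eqv.refl _).app (ih u)).trans (.assoc rfl f _ _ _)

theorem Flat.eqv_acomb (h : Flat f t (v :: vs)) : Eqv .assoc t (acomb f v vs) := by
  generalize hus : v :: vs = us at h
  induction h generalizing v vs with
  | leaf h =>
    obtain ⟨rfl, rfl⟩ := List.cons.inj hus
    exact .refl _
  | @node t₁ t₂ l₁ l₂ h₁ h₂ ih₁ ih₂ =>
    obtain ⟨a, as, rfl⟩ := List.exists_cons_of_ne_nil h₁.ne_nil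
    obtain ⟨c, cs, rfl⟩ := List.exists_cons_of_ne_nil h₂.ne_nil
    obtain ⟨rfl, rfl⟩ := List.cons.inj hus
    exact (((Eqv.refl _).app (ih₁ rfl)).app (ih₂ rfl)).trans (acomb_append f _ _ _ _).symm

theorem isNf_acomb (ht : IsNf t) (hts : ∀ v ∈ ts, IsNf v) : IsNf (acomb f t ts) := by
  induction ts generalizing t with
  | nil => exact ht
  | cons v vs ih =>
    exact ht.bin (ih (hts v (by simp)) fun u hu => hts u (by simp [hu]))

theorem acomb_congr (htv : Eqv .assoc t v) (h : List.Forall₂ (Eqv .assoc) ts vs) :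
    Eqv .assoc (acomb f t ts) (acomb f v vs) := by
  induction h generalizing t v with
  | nil => exact htv
  | cons h _ ih => exact ((Eqv.refl _).app htv).app (ih h)

/-- If a normal form equals `f(v, w)` modulo associativity, its flattened form splits accordingly. -/
theorem Flat.split (ht : IsNf t) (h : Flat f t ts) (he : Eqv .assoc t (Tm.bin f v w)) :
    ∃ a as c cs, ts = (a :: as) ++ (c :: cs) ∧ Eqv .assoc (acomb f a as) v ∧
      Eqv .assoc (acomb f c cs) w ∧ ((∀ v₁ v₂, v.canon ≠ Tm.bin f v₁ v₂) → as = []) := by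
  obtain ⟨vs, hv⟩ := exists_flat f v.canon
  obtain ⟨ws, hw⟩ := exists_flat f w.canon
  have hts : ts.map Tm.canon = vs ++ ws := by
    refine (h.canon ht).unique ?_
    rw [he.canon_eq, canon_bin]
    exact hv.append hw
  have key : ∀ {u : Tm 𝒮 Γ (.base b)} {l : List (Tm 𝒮 Γ (.base b))}, Flat f u.canon (l.map Tm.canon) →
      ∃ a as, l = a :: as ∧ Eqv .assoc (acomb f a as) u := by
    intro u l hl
    cases l with
    | nil => exact absurd rfl hl.ne_nil
    | cons a as =>
      refine ⟨a, as, rfl, ?_⟩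
      refine Eqv.trans ?_ (hl.eqv_acomb.symm.trans (eqv_canon u).symm)
      refine acomb_congr (eqv_canon a) ?_
      rw [List.forall₂_map_right_iff]
      exact List.forall₂_same.2 fun u _ => eqv_canon u
  obtain ⟨l₁, l₂, rfl, rfl, rfl⟩ := List.map_eq_append_iff.1 hts
  obtain ⟨a, as, rfl, h1⟩ := key hv
  obtain ⟨c, cs, rfl, h2⟩ := key hw
  refine ⟨a, as, c, cs, rfl, h1, h2, fun hne => ?_⟩
  have := hv.eq_of_ne hne
  simpa using congrArg List.length this

end Flat

end Tm

end AntiUnif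

/-! ### Patterns -/

namespace AntiUnif

variable {𝒮 : Sig.{u}} {Γ Δ Θ : List (Ty 𝒮.Base)} {σ τ : Ty 𝒮.Base} {E : Tm.Theory}

namespace Tm

theorem etaLong_rename (t : Tm 𝒮 Γ τ) (ρ : Ren Γ Δ) :
    (etaLong τ t).rename ρ = etaLong τ (t.rename ρ) := by
  induction τ generalizing Γ Δ with
  | base b => rfl
  | arr σ τ ih₁ ih₂ => simp only [etaLong, rename, ih₂, ih₁, wk_rename_lift, Ren.lift]

mutual

theorem IsNfPattern.rename : ∀ {Γ : List (Ty 𝒮.Base)} {τ : Ty 𝒮.Base} {t : Tm 𝒮 Γ τ},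
    IsNfPattern t → ∀ {Δ : List (Ty 𝒮.Base)} {ρ : Ren Γ Δ},
    (∀ α, Function.Injective (ρ α)) → IsNfPattern (t.rename ρ)
  | _, _, _, .lam h, _, _, hρ => .lam (h.rename (Ren.lift_injective hρ))
  | _, _, _, .rigid h, _, _, hρ => .rigid (h.rename hρ)
  | _, _, _, .flex n π hπ, _, ρ, hρ => by
    simp only [apps_rename, etaLong_rename]
    exact .flex n (fun _ x => ρ _ (π _ x)) fun α => (hρ α).comp (hπ α)

theorem IsRigid.rename : ∀ {Γ : List (Ty 𝒮.Base)} {τ : Ty 𝒮.Base} {t : Tm 𝒮 Γ τ},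
    IsRigid t → ∀ {Δ : List (Ty 𝒮.Base)} {ρ : Ren Γ Δ},
    (∀ α, Function.Injective (ρ α)) → IsRigid (t.rename ρ)
  | _, _, _, .bvar x, _, _, _ => .bvar _
  | _, _, _, .con c, _, _, _ => .con c
  | _, _, _, .acon f, _, _, _ => .acon f
  | _, _, _, .app h₁ h₂, _, _, hρ => .app (h₁.rename hρ) (h₂.rename hρ)

end

theorem isNfPattern_arr {t : Tm 𝒮 Γ (.arr σ τ)} (h : IsNfPattern t) :
    ∃ t', t = .lam t' ∧ IsNfPattern t' := by
  cases h with | lam h => exact ⟨_, rfl, h⟩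

theorem isNfPattern_arrows {t : Tm 𝒮 [] (arrows Γ τ)} (h : IsNfPattern t) :
    ∃ t', t = lams Γ t' ∧ IsNfPattern t' := by
  induction Γ generalizing τ with
  | nil => exact ⟨t, rfl, h⟩
  | cons σ Γ ih =>
    obtain ⟨t₁, rfl, h₁⟩ := ih (τ := .arr σ τ) h
    obtain ⟨t₂, rfl, h₂⟩ := isNfPattern_arr h₁
    exact ⟨t₂, rfl, h₂⟩

/-- The term has a pattern as its `η`-long `β`-normal form, and normalization does not introduce
free variables. -/
def HasPattern (t : Tm 𝒮 Γ τ) : Prop :=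
  ∃ p, Eqv .empty t p ∧ IsNfPattern p ∧ ∀ Z, p.Occurs Z → t.Occurs Z

/-- The analogue of `HasPattern` for a constant or bound variable applied to patterns. -/
def HasRigid (t : Tm 𝒮 Γ τ) : Prop :=
  ∃ p, Eqv .empty t p ∧ IsRigid p ∧ ∀ Z, p.Occurs Z → t.Occurs Z

theorem IsNfPattern.hasPattern {t : Tm 𝒮 Γ τ} (h : IsNfPattern t) : HasPattern t :=
  ⟨t, .refl t, h, fun _ h => h⟩

theorem HasRigid.hasPattern {b : 𝒮.Base} {t : Tm 𝒮 Γ (.base b)} (h : HasRigid t) : HasPattern t :=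
  let ⟨p, h1, h2, h3⟩ := h
  ⟨p, h1, .rigid h2, h3⟩

theorem HasPattern.lam {t : Tm 𝒮 (σ :: Γ) τ} (h : HasPattern t) : HasPattern (.lam t) :=
  let ⟨p, h1, h2, h3⟩ := h
  ⟨.lam p, h1.lam, .lam h2, h3⟩

theorem HasPattern.lams {t : Tm 𝒮 Γ τ} (h : HasPattern t) : HasPattern (lams Γ t) := by
  induction Γ generalizing τ with
  | nil => exact h
  | cons σ Γ ih => exact ih h.lam

theorem HasRigid.app {t : Tm 𝒮 Γ (.arr σ τ)} {v : Tm 𝒮 Γ σ} (ht : HasRigid t)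
    (hv : HasPattern v) : HasRigid (.app t v) :=
  let ⟨p, h1, h2, h3⟩ := ht
  let ⟨q, h4, h5, h6⟩ := hv
  ⟨.app p q, h1.app h4, .app h2 h5, fun Z => Or.imp (h3 Z) (h6 Z)⟩

theorem HasRigid.apps {h : Tm 𝒮 Γ (arrows Δ τ)} (hh : HasRigid h) {ts : Env 𝒮 Δ Γ}
    (hts : ∀ α x, HasPattern (ts α x)) : HasRigid (Tm.apps Δ h ts) := by
  induction Δ generalizing τ with
  | nil => exact hh
  | cons σ Δ ih => exact .app (ih (τ := .arr σ τ) hh fun _ x => hts _ x.succ) (hts _ .zero)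

/-- `X(x̄ρ)` is a pattern at every type: at function types, `η`-expansion adds further distinct bound
variables to its arguments. -/
theorem hasPattern_fvarApp (X : ℕ) {ρ : Ren Δ Γ} (hρ : ∀ α, Function.Injective (ρ α)) :
    HasPattern (fvarApp X ρ : Tm 𝒮 Γ τ) := by
  induction τ generalizing Γ Δ with
  | base b =>
    refine ⟨_, ?_, .flex X ρ hρ, ?_⟩
    · exact apps_congr (.refl _) fun _ _ => (etaLong_eqv _).symm
    · intro Z hZ
      have h0 : ∀ (τ : Ty 𝒮.Base) {Γ : List (Ty 𝒮.Base)} (t : Tm 𝒮 Γ τ),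
          (etaLong τ t).Occurs Z → t.Occurs Z := by
        intro τ
        induction τ with
        | base b => exact fun t h => h
        | arr σ τ ih₁ ih₂ =>
          intro Γ t h
          rcases ih₂ _ h with h | h
          · rwa [wk, occurs_rename] at h
          · exact (ih₁ _ h).elim
      rw [occurs_apps] at hZ
      rw [fvarApp, occurs_apps]
      exact hZ.imp_right fun ⟨σ, x, h⟩ => ⟨σ, x, h0 _ _ h⟩
  | arr σ τ _ ih =>
    obtain ⟨p, h1, h2, h3⟩ := ih (Ren.lift_injective (σ := σ) hρ)
    have h4 : Tm.app (fvarApp X ρ : Tm 𝒮 Γ (.arr σ τ)).wk (.bvar .zero) = fvarApp X (ρ.lift σ) := by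
      rw [wk, fvarApp_rename]; rfl
    refine ⟨.lam p, (Eqv.eta _).symm.trans ?_, .lam h2, ?_⟩
    · rw [h4]; exact h1.lam
    · intro Z hZ
      have := h3 Z hZ
      rw [occurs_fvarApp] at this ⊢
      exact this

theorem hasPattern_gen (X : ℕ) : HasPattern (gen X : Tm 𝒮 Γ τ) :=
  hasPattern_fvarApp X fun _ _ _ h => h

theorem hasPattern_fvar (X : ℕ) : HasPattern (.fvar X : Tm 𝒮 Γ τ) :=
  hasPattern_fvarApp (Δ := []) X (ρ := Ren.empty Γ) fun _ x => nomatch x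

mutual

/-- Instances of patterns under substitutions whose values are patterns are patterns: the
instance of `X(x̄ρ)` is a renamed copy of the body of the value of `X`. -/
theorem IsNfPattern.subst {θ : Subst 𝒮} (hθ : ∀ τ n, HasPattern (θ.map τ n)) :
    ∀ {Γ : List (Ty 𝒮.Base)} {τ : Ty 𝒮.Base} {t : Tm 𝒮 Γ τ}, IsNfPattern t → HasPattern (t.subst θ)
  | _, _, _, .lam h => (h.subst hθ).lam
  | _, _, _, .rigid h => (h.subst hθ).hasPattern
  | _, _, _, .flex (Γ := Γ) (Δ := Δ) (b := b) n ρ hρ => by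
    obtain ⟨p, h1, h2, h3⟩ := hθ (arrows Δ (.base b)) n
    obtain ⟨q, rfl, hq⟩ := isNfPattern_arrows h2
    refine ⟨q.rename ρ, ?_, hq.rename hρ, fun Z hZ => ?_⟩
    · refine Eqv.trans ?_ (fvarApp_subst h1 ρ)
      exact (apps_congr (.refl _) fun _ _ => etaLong_eqv _).subst θ
    · rw [occurs_rename, ← occurs_lams Z q] at hZ
      rw [apps_subst, occurs_apps]
      exact .inl ((occurs_rename _ _ _).2 (h3 Z hZ))

theorem IsRigid.subst {θ : Subst 𝒮} (hθ : ∀ τ n, HasPattern (θ.map τ n)) :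
    ∀ {Γ : List (Ty 𝒮.Base)} {τ : Ty 𝒮.Base} {t : Tm 𝒮 Γ τ}, IsRigid t → HasRigid (t.subst θ)
  | _, _, _, .bvar x => ⟨_, .refl _, .bvar x, fun _ h => h⟩
  | _, _, _, .con c => ⟨_, .refl _, .con c, fun _ h => h⟩
  | _, _, _, .acon f => ⟨_, .refl _, .acon f, fun _ h => h⟩
  | _, _, _, .app h₁ h₂ => (h₁.subst hθ).app (h₂.subst hθ)

end

theorem HasPattern.subst {θ : Subst 𝒮} (hθ : ∀ τ n, HasPattern (θ.map τ n)) {t : Tm 𝒮 Γ τ}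
    (h : HasPattern t) : HasPattern (t.subst θ) := by
  obtain ⟨p, h1, h2, h3⟩ := h
  obtain ⟨q, h4, h5, h6⟩ := h2.subst hθ
  refine ⟨q, (h1.subst θ).trans h4, h5, fun Z hZ => ?_⟩
  obtain ⟨Y, hY, hYZ⟩ := (occurs_subst _ _ _).1 (h6 Z hZ)
  exact (occurs_subst _ _ _).2 ⟨Y, h3 Y hY, hYZ⟩

theorem single_self (X : ℕ) (r : Tm 𝒮 [] τ) : (Subst.single X r).map τ X = r := by
  simp [Subst.single]

theorem single_of_ne {X : ℕ} (r : Tm 𝒮 [] τ) {Z : FVar 𝒮} (h : Z ≠ ⟨τ, X⟩) :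
    (Subst.single X r).map Z.1 Z.2 = .fvar Z.2 := by
  obtain ⟨α, n⟩ := Z
  refine dif_neg ?_
  rintro ⟨rfl, rfl⟩
  exact h rfl

theorem HasPattern.subst_single {X : ℕ} {r : Tm 𝒮 [] σ} (hr : HasPattern r) {t : Tm 𝒮 Γ τ}
    (ht : HasPattern t) : HasPattern (t.subst (.single X r)) := by
  refine ht.subst fun α n => ?_
  by_cases h : (⟨α, n⟩ : FVar 𝒮) = ⟨σ, X⟩
  · cases h; rwa [single_self]
  · have := single_of_ne r h
    simp only at this
    rw [this]; exact hasPattern_fvar n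

/-! ### Patterns with associative trees nested to the right -/

/-- Patterns up to `η`-expansion in which the left argument of an associative constant `f` does
not have the head `f`. -/
inductive CombPattern : {Γ : List (Ty 𝒮.Base)} → {τ : Ty 𝒮.Base} → Tm 𝒮 Γ τ → Prop
  | lam {Γ : List (Ty 𝒮.Base)} {σ τ : Ty 𝒮.Base} {t : Tm 𝒮 (σ :: Γ) τ} :
      CombPattern t → CombPattern (.lam t)
  | apps {Γ Δ : List (Ty 𝒮.Base)} {b : 𝒮.Base} {h : Tm 𝒮 Γ (arrows Δ (.base b))}
      (hh : IsDecHead h) (ts : Env 𝒮 Δ Γ) (hts : ∀ α x, CombPattern (ts α x)) :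
      CombPattern (apps Δ h ts)
  | bin {Γ : List (Ty 𝒮.Base)} {b : 𝒮.Base} (f : 𝒮.assoc b) {v w : Tm 𝒮 Γ (.base b)}
      (h : ∀ v₁ v₂, v ≠ bin f v₁ v₂) : CombPattern v → CombPattern w → CombPattern (bin f v w)
  | flex {Γ Δ : List (Ty 𝒮.Base)} {b : 𝒮.Base} (n : ℕ) (ρ : Ren Δ Γ)
      (hρ : ∀ σ, Function.Injective (ρ σ)) :
      CombPattern (fvarApp (τ := .base b) n ρ)

/-- Spines of the terms in `CombPattern` whose head is a constant or a bound variable. -/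
inductive CombRigid : {Γ : List (Ty 𝒮.Base)} → {τ : Ty 𝒮.Base} → Tm 𝒮 Γ τ → Prop
  | apps {Γ Δ : List (Ty 𝒮.Base)} {τ : Ty 𝒮.Base} {h : Tm 𝒮 Γ (arrows Δ τ)}
      (hh : IsDecHead h) (ts : Env 𝒮 Δ Γ) (hts : ∀ α x, CombPattern (ts α x)) :
      CombRigid (apps Δ h ts)
  | acon {Γ : List (Ty 𝒮.Base)} {b : 𝒮.Base} (f : 𝒮.assoc b) :
      CombRigid (.acon f : Tm 𝒮 Γ (.arr (.base b) (.arr (.base b) (.base b))))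
  | acon₁ {Γ : List (Ty 𝒮.Base)} {b : 𝒮.Base} (f : 𝒮.assoc b) {v : Tm 𝒮 Γ (.base b)} :
      CombPattern v → CombRigid (.app (.acon f) v)
  | full {Γ : List (Ty 𝒮.Base)} {b : 𝒮.Base} {t : Tm 𝒮 Γ (.base b)} : CombPattern t → CombRigid t

theorem _root_.AntiUnif.IsDecHead.isAtom {h : Tm 𝒮 Γ τ} (hh : IsDecHead h) : IsAtom h := by
  cases hh with
  | bvar x => exact .bvar x
  | con c => exact .con c

theorem head_fvarApp (X : ℕ) (ρ : Ren Δ Γ) :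
    (fvarApp X ρ : Tm 𝒮 Γ τ).head = some (.fvar ⟨arrows Δ τ, X⟩) :=
  head_apps _ _

theorem CombPattern.of_bin {b : 𝒮.Base} {f : 𝒮.assoc b} {v w : Tm 𝒮 Γ (.base b)}
    (h : CombPattern (Tm.bin f v w)) :
    (∀ v₁ v₂, v ≠ Tm.bin f v₁ v₂) ∧ CombPattern v ∧ CombPattern w := by
  generalize ht : Tm.bin f v w = t at h
  have hd : t.head = some (.acon ⟨b, f⟩) := by rw [← ht]; rfl
  cases h with
  | apps hh ts => rw [head_apps] at hd; exact absurd hd (head_atom_ne_acon hh.isAtom _)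
  | bin g h hv hw =>
    obtain ⟨rfl, rfl, rfl⟩ := bin_inj ht
    exact ⟨h, hv, hw⟩
  | flex n ρ => rw [head_fvarApp] at hd; simp at hd

theorem CombPattern.append {b : 𝒮.Base} (f : 𝒮.assoc b) {v w : Tm 𝒮 Γ (.base b)}
    (hv : CombPattern v) (hw : CombPattern w) : CombPattern (append f v w) := by
  induction v using spine_induction f with
  | leaf t h => rw [append_of_ne f h]; exact .bin f h hv hw
  | node u₁ u₂ ih =>
    obtain ⟨h, h1, h2⟩ := hv.of_bin
    rw [append_bin]
    exact .bin f h h1 (ih h2)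

theorem occurs_append {b : 𝒮.Base} (f : 𝒮.assoc b) (Z : FVar 𝒮) (v w : Tm 𝒮 Γ (.base b)) :
    (append f v w).Occurs Z ↔ v.Occurs Z ∨ w.Occurs Z := by
  induction v using spine_induction f with
  | leaf t h => rw [append_of_ne f h]; simp [Tm.bin, Occurs]
  | node u₁ u₂ ih => rw [append_bin]; simp [Tm.bin, Occurs, ih, or_assoc]

theorem CombRigid.app {t : Tm 𝒮 Γ (.arr σ τ)} {v : Tm 𝒮 Γ σ} (ht : CombRigid t)
    (hv : CombPattern v) : ∃ q, Eqv .assoc (.app t v) q ∧ CombRigid q ∧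
      ∀ Z, q.Occurs Z → t.Occurs Z ∨ v.Occurs Z := by
  cases ht with
  | @apps Δ _ h hh ts hts =>
    refine ⟨_, .refl _, ?_, fun Z h => h⟩
    exact CombRigid.apps (Δ := σ :: Δ) (τ := τ) hh (Env.cons v ts)
      (by rintro α (_ | x); exacts [hv, hts _ x])
  | acon f => exact ⟨_, .refl _, .acon₁ f hv, fun Z h => h⟩
  | @acon₁ _ f u hu =>
    refine ⟨_, append_eqv f _ _, .full (hu.append f hv), fun Z h => ?_⟩
    simpa [Occurs] using (occurs_append f Z u v).1 h

theorem CombRigid.combPattern {b : 𝒮.Base} {t : Tm 𝒮 Γ (.base b)} (ht : CombRigid t) :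
    CombPattern t := by
  cases ht with
  | apps hh ts hts => exact .apps hh ts hts
  | full h => exact h

mutual

/-- Reassociation of all associative trees to the right turns a pattern into a `CombPattern`. -/
theorem IsNfPattern.exists_comb : ∀ {Γ : List (Ty 𝒮.Base)} {τ : Ty 𝒮.Base} {t : Tm 𝒮 Γ τ},
    IsNfPattern t → ∃ q, Eqv .assoc t q ∧ CombPattern q ∧ ∀ Z, q.Occurs Z → t.Occurs Z
  | _, _, _, .lam h =>
    let ⟨q, h1, h2, h3⟩ := h.exists_comb
    ⟨.lam q, h1.lam, .lam h2, h3⟩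
  | _, _, _, .rigid h =>
    let ⟨q, h1, h2, h3⟩ := h.exists_comb
    ⟨q, h1, h2.combPattern, h3⟩
  | _, _, _, .flex n ρ hρ =>
    ⟨fvarApp n ρ, apps_congr (.refl _) fun _ _ => etaLong_eqv _, .flex n ρ hρ, fun Z hZ => by
      rw [occurs_fvarApp] at hZ
      exact (occurs_apps _ _ _).2 (.inl hZ)⟩

theorem IsRigid.exists_comb : ∀ {Γ : List (Ty 𝒮.Base)} {τ : Ty 𝒮.Base} {t : Tm 𝒮 Γ τ},
    IsRigid t → ∃ q, Eqv .assoc t q ∧ CombRigid q ∧ ∀ Z, q.Occurs Z → t.Occurs Z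
  | _, _, _, .bvar x => ⟨_, .refl _, .apps (Δ := []) (.bvar x) (fun _ x => nomatch x)
      (fun _ x => nomatch x), fun _ h => h⟩
  | _, _, _, .con c => ⟨_, .refl _, .apps (Δ := []) (.con c) (fun _ x => nomatch x)
      (fun _ x => nomatch x), fun _ h => h⟩
  | _, _, _, .acon f => ⟨_, .refl _, .acon f, fun _ h => h⟩
  | _, _, _, .app h₁ h₂ =>
    let ⟨_, h3, h4, h5⟩ := h₁.exists_comb
    let ⟨_, h6, h7, h8⟩ := h₂.exists_comb
    let ⟨r, h9, h10, h11⟩ := h4.app h7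
    ⟨r, (h3.app h6).trans h9, h10, fun Z hZ => (h11 Z hZ).imp (h5 Z) (h8 Z)⟩

end

end Tm

end AntiUnif

/-! ### Generalizations described by sets of anti-unification problems -/

namespace AntiUnif

variable {𝒮 : Sig.{u}} {Γ Δ Θ : List (Ty 𝒮.Base)} {σ τ : Ty 𝒮.Base} {E : Tm.Theory}

open Tm

/-- The position of a bound variable in its context. -/
def Var.toNat {B : Type u} : {Γ : List (Ty B)} → {τ : Ty B} → Var Γ τ → ℕ
  | _, _, .zero => 0
  | _, _, .succ x => x.toNat + 1

theorem Var.toNat_injective {B : Type u} {Γ : List (Ty B)} {τ : Ty B} :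
    Function.Injective (Var.toNat : Var Γ τ → ℕ) := by
  intro x y h
  induction x with
  | zero => cases y with
    | zero => rfl
    | succ y => simp [Var.toNat] at h
  | succ x ih => cases y with
    | zero => simp [Var.toNat] at h
    | succ y => rw [ih (by simpa [Var.toNat] using h)]

/-- The list of all bound variables of a context. -/
def Var.all {B : Type u} : (Γ : List (Ty B)) → List ((τ : Ty B) × Var Γ τ)
  | [] => []
  | σ :: Γ => ⟨σ, .zero⟩ :: (Var.all Γ).map fun y => ⟨y.1, y.2.succ⟩

theorem Var.mem_all {B : Type u} {Γ : List (Ty B)} {τ : Ty B} (x : Var Γ τ) :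
    (⟨τ, x⟩ : (τ : Ty B) × Var Γ τ) ∈ Var.all Γ := by
  induction x with
  | zero => simp [Var.all]
  | succ x ih => exact List.mem_cons_of_mem _ (List.mem_map.2 ⟨_, ih, rfl⟩)

theorem finite_setOf_var {α : Type*} {B : Type u} {Γ : List (Ty B)} (F : ∀ τ, Var Γ τ → α) :
    {a | ∃ τ x, a = F τ x}.Finite := by
  refine ((List.finite_toSet (Var.all Γ)).image fun y => F y.1 y.2).subset ?_
  rintro _ ⟨τ, x, rfl⟩
  exact ⟨⟨τ, x⟩, Var.mem_all x, rfl⟩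

/-- All large enough names are fresh for a finite set of free variables. -/
theorem exists_fresh {F : Set (FVar 𝒮)} (hF : F.Finite) :
    ∃ N : ℕ, ∀ (τ : Ty 𝒮.Base) (n : ℕ), N ≤ n → (⟨τ, n⟩ : FVar 𝒮) ∉ F := by
  obtain ⟨N, hN⟩ := (hF.image fun Z => Z.2).bddAbove
  refine ⟨N + 1, fun τ n hn h => ?_⟩
  have : n ≤ N := hN ⟨_, h, rfl⟩
  omega

namespace Subst

open Classical in
/-- The substitution `θ` with its values on finitely many variables replaced by the values listed
in `N`. -/
noncomputable def extend (θ : Subst 𝒮) (N : Set ((Z : FVar 𝒮) × Tm 𝒮 [] Z.1)) (hN : N.Finite) :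
    Subst 𝒮 where
  map τ n := if h : ∃ v, (⟨⟨τ, n⟩, v⟩ : (Z : FVar 𝒮) × Tm 𝒮 [] Z.1) ∈ N then h.choose
    else θ.map τ n
  finite := by
    refine ((hN.image Sigma.fst).union θ.finite).subset ?_
    intro Z hZ
    by_cases h : ∃ v, (⟨Z, v⟩ : (Z : FVar 𝒮) × Tm 𝒮 [] Z.1) ∈ N
    · exact .inl ⟨_, h.choose_spec, rfl⟩
    · refine .inr fun h' => hZ ?_
      rw [dif_neg h]; exact h'

variable {N : Set ((Z : FVar 𝒮) × Tm 𝒮 [] Z.1)} {hN : N.Finite}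

theorem extend_of_mem (θ : Subst 𝒮) {Z : FVar 𝒮} {v : Tm 𝒮 [] Z.1}
    (hf : ∀ w, ⟨Z, w⟩ ∈ N → w = v) (h : ⟨Z, v⟩ ∈ N) : (θ.extend N hN).map Z.1 Z.2 = v := by
  have h' : ∃ v, (⟨⟨Z.1, Z.2⟩, v⟩ : (Z : FVar 𝒮) × Tm 𝒮 [] Z.1) ∈ N := ⟨v, h⟩
  exact (dif_pos h').trans (hf _ h'.choose_spec)

theorem extend_of_notMem (θ : Subst 𝒮) {Z : FVar 𝒮} (h : ∀ v, ⟨Z, v⟩ ∉ N) :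
    (θ.extend N hN).map Z.1 Z.2 = θ.map Z.1 Z.2 :=
  dif_neg fun ⟨v, hv⟩ => h v hv

end Subst

/-- Replacing `X` by `r` does not change an instance, provided that the values of `X` and `r` are
equal and the values of all other variables are kept. -/
theorem subst_single_subst {X : ℕ} {r : Tm 𝒮 [] σ} {θ θ' : Subst 𝒮} (t : Tm 𝒮 Γ τ)
    (h : ∀ Z : FVar 𝒮, t.Occurs Z → Z ≠ ⟨σ, X⟩ → θ'.map Z.1 Z.2 = θ.map Z.1 Z.2)
    (hr : Eqv E (r.subst θ') (θ.map σ X)) :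
    Eqv E ((t.subst (.single X r)).subst θ') (t.subst θ) := by
  rw [← subst_comp]
  refine Eqv.subst_congr t fun Z hZ => ?_
  by_cases hZX : Z = ⟨σ, X⟩
  · subst hZX
    simpa only [Subst.comp, single_self] using hr
  · refine .of_eq ?_
    exact (congrArg (Tm.subst θ') (single_of_ne r hZX)).trans
      ((subst_fvar θ' Z.2).trans (h Z hZ hZX))

namespace IsDecHead

variable {h : Tm 𝒮 Γ τ}

theorem subst (hh : IsDecHead h) (θ : Subst 𝒮) : h.subst θ = h := by cases hh <;> rfl

theorem isRigid (hh : IsDecHead h) : IsRigid h := by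
  cases hh with
  | bvar x => exact .bvar x
  | con c => exact .con c

theorem not_occurs (hh : IsDecHead h) (Z : FVar 𝒮) : ¬ h.Occurs Z := by
  cases hh <;> exact id

end IsDecHead

namespace AUP

/-- The generalization variable of a problem. -/
def gvar (p : AUP 𝒮) : FVar 𝒮 := ⟨arrows p.ctx p.ty, p.var⟩

/-- The left (`true`) or right (`false`) term of a problem. -/
def side (p : AUP 𝒮) : Bool → Tm 𝒮 p.ctx p.ty
  | true => p.left
  | false => p.right

end AUP

/-- The substitution maps the generalization variables of the problems to their left (right)
terms. -/
def Subst.Solves (θ : Subst 𝒮) (i : Bool) (G : Set (AUP 𝒮)) : Prop :=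
  ∀ p ∈ G, Eqv .assoc (θ.map p.gvar.1 p.gvar.2) (lams p.ctx (p.side i))

/-- The pattern `u` is a generalization of `T true` and `T false` whose free variables are
generalization variables of `G`; the two terms of each problem say how to instantiate them. -/
structure IsGen (T : Bool → Tm 𝒮 [] τ) (u : Tm 𝒮 [] τ) (G : Set (AUP 𝒮)) : Prop where
  pat : HasPattern u
  occurs : ∀ Z, u.Occurs Z → ∃ p ∈ G, Z = p.gvar
  solves : ∀ i, ∃ θ : Subst 𝒮, θ.Solves i G ∧ Eqv .assoc (u.subst θ) (T i)

variable {T : Bool → Tm 𝒮 [] τ} {u : Tm 𝒮 [] τ} {G : Set (AUP 𝒮)} {b : 𝒮.Base}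

namespace IsGen

theorem isPatternGeneralization (h : IsGen T u G) :
    IsPatternGeneralization u (T true) (T false) := by
  obtain ⟨p, h1, h2, -⟩ := h.pat
  obtain ⟨θ, -, hθ⟩ := h.solves true
  obtain ⟨θ', -, hθ'⟩ := h.solves false
  exact ⟨⟨p, h1, h2⟩, ⟨θ, hθ⟩, ⟨θ', hθ'⟩⟩

/-- The one step behind all transformation rules: a problem is replaced by problems with fresh
generalization variables, and its generalization variable by a pattern that they solve. -/
theorem replace {p₀ : AUP 𝒮} (h : IsGen T u (insert p₀ G)) {P : Set (AUP 𝒮)} (hP : P.Finite)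
    (hfresh : ∀ p ∈ P, ∀ q ∈ insert p₀ G, q.gvar ≠ p.gvar)
    (hinj : ∀ p ∈ P, ∀ q ∈ P, p.gvar = q.gvar → p = q)
    {r : Tm 𝒮 [] (arrows p₀.ctx p₀.ty)} (hr : HasPattern r)
    (hocc : ∀ Z, r.Occurs Z → ∃ p ∈ P ∪ G, Z = p.gvar)
    (hsol : ∀ i (θ : Subst 𝒮), θ.Solves i (P ∪ G) →
      Eqv .assoc (r.subst θ) (lams p₀.ctx (p₀.side i))) :
    IsGen T (u.subst (.single p₀.var r)) (P ∪ G) := by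
  refine ⟨hr.subst_single h.pat, fun Z hZ => ?_, fun i => ?_⟩
  · obtain ⟨Y, hY, hYZ⟩ := (occurs_subst _ _ _).1 hZ
    by_cases hYX : Y = p₀.gvar
    · subst hYX
      exact hocc Z (by rwa [AUP.gvar, single_self] at hYZ)
    · rw [single_of_ne r hYX] at hYZ
      obtain rfl : Z = Y := hYZ
      obtain ⟨p, rfl | hp, rfl⟩ := h.occurs Z hY
      · exact absurd rfl hYX
      · exact ⟨p, .inr hp, rfl⟩
  · obtain ⟨θ, h1, h2⟩ := h.solves i
    let N : Set ((Z : FVar 𝒮) × Tm 𝒮 [] Z.1) :=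
      (fun p : AUP 𝒮 => ⟨p.gvar, lams p.ctx (p.side i)⟩) '' P
    let θ' := θ.extend N (hP.image _)
    have hold : ∀ q ∈ insert p₀ G, θ'.map q.gvar.1 q.gvar.2 = θ.map q.gvar.1 q.gvar.2 := by
      intro q hq
      refine Subst.extend_of_notMem _ ?_
      rintro v ⟨p, hp, hpq⟩
      exact hfresh p hp q hq (congrArg Sigma.fst hpq).symm
    have hθ' : θ'.Solves i (P ∪ G) := by
      rintro p (hp | hp)
      · refine .of_eq (Subst.extend_of_mem _ ?_ ⟨p, hp, rfl⟩)
        rintro w ⟨q, hq, hqp⟩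
        obtain rfl := hinj q hq p hp (congrArg Sigma.fst hqp)
        exact (eq_of_heq (Sigma.mk.inj hqp).2).symm
      · rw [hold p (.inr hp)]
        exact h1 p (.inr hp)
    refine ⟨θ', hθ', (subst_single_subst u ?_ ?_).trans h2⟩
    · intro Z hZ _
      obtain ⟨q, hq, rfl⟩ := h.occurs Z hZ
      exact hold q hq
    · exact (hsol i θ' hθ').trans (h1 p₀ (.inl rfl)).symm

theorem dec {X : ℕ} {l r : Tm 𝒮 Γ (.base b)} (h : IsGen T u (insert ⟨Γ, .base b, X, l, r⟩ G))
    {c : Tm 𝒮 Γ (arrows Δ (.base b))} (hc : IsDecHead c) {t s : Env 𝒮 Δ Γ}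
    (hl : Eqv .assoc l (apps Δ c t)) (hr : Eqv .assoc r (apps Δ c s)) {Y : ∀ α, Var Δ α → ℕ}
    (hfresh : ∀ α x, ∀ q ∈ insert ⟨Γ, .base b, X, l, r⟩ G, q.gvar ≠ ⟨arrows Γ α, Y α x⟩)
    (hY : ∀ α, Function.Injective (Y α)) :
    IsGen T (u.subst (.single X (lams Γ (apps Δ c (fun α x => gen (Y α x))))))
      ({p | ∃ α, ∃ x : Var Δ α, p = ⟨Γ, α, Y α x, t α x, s α x⟩} ∪ G) := by
  refine replace h (p₀ := ⟨Γ, .base b, X, l, r⟩) (finite_setOf_var _) ?_ ?_ ?_ ?_ ?_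
  · rintro _ ⟨α, x, rfl⟩ q hq
    exact hfresh α x q hq
  · rintro _ ⟨α, x, rfl⟩ _ ⟨β, y, rfl⟩ hxy
    simp only [AUP.gvar, Sigma.mk.injEq] at hxy
    obtain rfl := arrows_injective_right hxy.1
    rw [hY _ (eq_of_heq hxy.2)]
  · refine (HasRigid.apps ?_ fun α x => hasPattern_gen _).hasPattern.lams
    exact ⟨c, .refl _, hc.isRigid, fun _ h => h⟩
  · intro Z hZ
    rw [occurs_lams, occurs_apps] at hZ
    rcases hZ with hZ | ⟨α, x, hZ⟩
    · exact absurd hZ (hc.not_occurs Z)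
    · exact ⟨_, .inl ⟨α, x, rfl⟩, (occurs_fvarApp _ _ _).1 hZ⟩
  · intro i θ hθ
    rw [lams_subst, apps_subst, hc.subst]
    have key : ∀ e : Env 𝒮 Δ Γ, (∀ α x, Eqv .assoc (θ.map (arrows Γ α) (Y α x)) (lams Γ (e α x))) →
        Eqv .assoc (apps Δ c fun α x => (gen (Y α x) : Tm 𝒮 Γ α).subst θ) (apps Δ c e) :=
      fun e he => apps_congr (.refl c) fun α x => gen_subst (he α x)
    cases i
    · exact lams_congr ((key s fun α x => hθ ⟨Γ, α, Y α x, t α x, s α x⟩ (.inl ⟨α, x, rfl⟩)).trans hr.symm)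
    · exact lams_congr ((key t fun α x => hθ ⟨Γ, α, Y α x, t α x, s α x⟩ (.inl ⟨α, x, rfl⟩)).trans hl.symm)

theorem abs {X : ℕ} {t s : Tm 𝒮 (σ :: Γ) τ} {υ : Ty 𝒮.Base} {T : Bool → Tm 𝒮 [] υ} {u : Tm 𝒮 [] υ}
    (h : IsGen T u (insert ⟨Γ, .arr σ τ, X, .lam t, .lam s⟩ G)) {Y : ℕ}
    (hfresh : ∀ q ∈ insert ⟨Γ, .arr σ τ, X, .lam t, .lam s⟩ G, q.gvar ≠ ⟨arrows (σ :: Γ) τ, Y⟩) :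
    IsGen T (u.subst (.single X (lams (σ :: Γ) (gen (τ := τ) Y))))
      ({⟨σ :: Γ, τ, Y, t, s⟩} ∪ G) := by
  refine replace h (p₀ := ⟨Γ, .arr σ τ, X, .lam t, .lam s⟩) (Set.finite_singleton _) ?_ ?_
    (hasPattern_gen Y).lams ?_ ?_
  · rintro _ rfl q hq
    exact hfresh q hq
  · rintro _ rfl _ rfl _; rfl
  · intro Z hZ
    exact ⟨_, .inl rfl, (occurs_fvarApp _ _ _).1 ((occurs_lams _ _).1 hZ)⟩
  · intro i θ hθ
    refine Eqv.trans (.of_eq (lams_subst (Γ := σ :: Γ) _ θ)) ?_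
    have h0 := hθ _ (.inl rfl)
    cases i <;> exact lams_congr (Γ := σ :: Γ) (gen_subst h0)

theorem sol {X : ℕ} {l r : Tm 𝒮 Γ σ} (h : IsGen T u (insert ⟨Γ, σ, X, l, r⟩ G))
    {ρ : Ren Δ Γ} (hρ : ∀ α, Function.Injective (ρ α)) {t s : Tm 𝒮 Δ σ}
    (hl : l = t.rename ρ) (hr : r = s.rename ρ) {Y : ℕ}
    (hfresh : ∀ q ∈ insert ⟨Γ, σ, X, l, r⟩ G, q.gvar ≠ ⟨arrows Δ σ, Y⟩) :
    IsGen T (u.subst (.single X (lams Γ (fvarApp (τ := σ) Y ρ)))) ({⟨Δ, σ, Y, t, s⟩} ∪ G) := by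
  refine replace h (p₀ := ⟨Γ, σ, X, l, r⟩) (Set.finite_singleton _) ?_ ?_
    (hasPattern_fvarApp Y hρ).lams ?_ ?_
  · rintro _ rfl q hq
    exact hfresh q hq
  · rintro _ rfl _ rfl _; rfl
  · intro Z hZ
    exact ⟨_, .inl rfl, (occurs_fvarApp _ _ _).1 ((occurs_lams _ _).1 hZ)⟩
  · intro i θ hθ
    rw [lams_subst]
    have h0 := hθ _ (.inl rfl)
    subst hl hr
    cases i <;> exact lams_congr (fvarApp_subst h0 ρ)

theorem mer {X Y : ℕ} {t₁ t₂ : Tm 𝒮 Γ σ} {s₁ s₂ : Tm 𝒮 Δ σ} (h : IsGen T u (insert ⟨Δ, σ, Y, s₁, s₂⟩ G))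
    (hX : ⟨Γ, σ, X, t₁, t₂⟩ ∈ G) {π : Ren Γ Δ} (hπ : ∀ α, Function.Injective (π α))
    (h₁ : Eqv .assoc (t₁.rename π) s₁) (h₂ : Eqv .assoc (t₂.rename π) s₂) :
    IsGen T (u.subst (.single Y (lams Δ (fvarApp (τ := σ) X π)))) G := by
  rw [← Set.empty_union G]
  refine replace h (p₀ := ⟨Δ, σ, Y, s₁, s₂⟩) Set.finite_empty (by simp) (by simp)
    (hasPattern_fvarApp X hπ).lams ?_ ?_
  · intro Z hZ
    exact ⟨_, .inr hX, (occurs_fvarApp _ _ _).1 ((occurs_lams _ _).1 hZ)⟩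
  · intro i θ hθ
    rw [lams_subst]
    have h0 := hθ _ (.inr hX)
    cases i
    · exact lams_congr ((fvarApp_subst h0 π).trans h₂)
    · exact lams_congr ((fvarApp_subst h0 π).trans h₁)

theorem bin {X : ℕ} {l r : Tm 𝒮 Γ (.base b)} (h : IsGen T u (insert ⟨Γ, .base b, X, l, r⟩ G))
    {f : 𝒮.assoc b} {t₁ t₂ s₁ s₂ : Tm 𝒮 Γ (.base b)} (hl : Eqv .assoc l (Tm.bin f t₁ t₂))
    (hr : Eqv .assoc r (Tm.bin f s₁ s₂)) {Y₁ Y₂ : ℕ}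
    (h₁ : ∀ q ∈ insert ⟨Γ, .base b, X, l, r⟩ G, q.gvar ≠ ⟨arrows Γ (.base b), Y₁⟩)
    (h₂ : ∀ q ∈ insert ⟨Γ, .base b, X, l, r⟩ G, q.gvar ≠ ⟨arrows Γ (.base b), Y₂⟩)
    (hY : Y₁ ≠ Y₂) :
    IsGen T (u.subst (.single X (lams Γ (Tm.bin f (gen Y₁) (gen Y₂)))))
      ({⟨Γ, .base b, Y₁, t₁, s₁⟩, ⟨Γ, .base b, Y₂, t₂, s₂⟩} ∪ G) := by
  refine replace h (p₀ := ⟨Γ, .base b, X, l, r⟩) (by simp) ?_ ?_ ?_ ?_ ?_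
  · rintro _ (rfl | rfl) q hq
    · exact h₁ q hq
    · exact h₂ q hq
  · rintro _ (rfl | rfl) _ (rfl | rfl) hxy <;> simp_all [AUP.gvar]
  · refine HasPattern.lams (HasRigid.hasPattern ?_)
    exact .app (.app ⟨.acon f, .refl _, .acon f, fun _ h => h⟩ (hasPattern_gen _)) (hasPattern_gen _)
  · intro Z hZ
    rw [occurs_lams] at hZ
    rcases hZ with (hZ | hZ) | hZ
    · exact hZ.elim
    · exact ⟨_, .inl (.inl rfl), (occurs_fvarApp _ _ _).1 hZ⟩
    · exact ⟨_, .inl (.inr rfl), (occurs_fvarApp _ _ _).1 hZ⟩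
  · intro i θ hθ
    rw [lams_subst]
    have h1 := hθ _ (.inl (.inl rfl))
    have h2 := hθ _ (.inl (.inr rfl))
    cases i
    · exact lams_congr ((((Eqv.refl _).app (gen_subst h1)).app (gen_subst h2)).trans hr.symm)
    · exact lams_congr ((((Eqv.refl _).app (gen_subst h1)).app (gen_subst h2)).trans hl.symm)

theorem init (X : ℕ) (t₁ t₂ : Tm 𝒮 Γ σ) :
    IsGen (fun i => lams Γ (AUP.side ⟨Γ, σ, X, t₁, t₂⟩ i)) (.fvar X) {⟨Γ, σ, X, t₁, t₂⟩} := by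
  refine ⟨hasPattern_fvar X, fun Z hZ => ⟨_, rfl, hZ⟩, fun i => ?_⟩
  refine ⟨Subst.single X (lams Γ (AUP.side ⟨Γ, σ, X, t₁, t₂⟩ i)), ?_, ?_⟩
  · rintro _ rfl
    exact .of_eq (single_self _ _)
  · rw [subst_fvar, single_self]; exact .refl _

end IsGen

/-! ### Soundness of the transformation rules -/

theorem State.Fresh.gvar_ne {Q : State 𝒮} {Y : ℕ} (h : Q.Fresh τ Y) :
    ∀ q ∈ Q.problems ∪ Q.store, q.gvar ≠ ⟨τ, Y⟩ :=
  fun q hq h' => h.1 q hq (.inl h'.symm)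

/-- Every rule preserves that the computed term is a generalization given by the problems. -/
theorem IsGen.step {Q Q' : State 𝒮} (hQ : Step Q Q') {X : ℕ}
    (h : IsGen T (Q.sub.map τ X) (Q.problems ∪ Q.store)) :
    IsGen T (Q'.sub.map τ X) (Q'.problems ∪ Q'.store) := by
  cases hQ with
  | dec X c hc t s Y hA hfresh hY =>
    simp only [Set.insert_union] at h ⊢
    rw [Set.union_assoc]
    exact h.dec hc (.refl _) (.refl _) (fun α x q hq => (hfresh α x).gvar_ne q
      (by simpa only [Set.insert_union] using hq)) hY
  | abs X t s Y hA hfresh =>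
    simp only [Set.insert_union] at h ⊢
    exact h.abs fun q hq => hfresh.gvar_ne q (by simpa only [Set.insert_union] using hq)
  | sol X ι t s Y hhead hvars hA hfresh =>
    simp only [Set.insert_union, Set.union_insert] at h ⊢
    exact h.sol ι.ren_injective rfl rfl
      fun q hq => hfresh.gvar_ne q (by simpa only [Set.insert_union] using hq)
  | @mer Γ Δ σ A S _ X Y t₁ t₂ s₁ s₂ π hπ h₁ h₂ =>
    have e : A ∪ ({⟨Γ, σ, X, t₁, t₂⟩, ⟨Δ, σ, Y, s₁, s₂⟩} ∪ S) =
        insert ⟨Δ, σ, Y, s₁, s₂⟩ (A ∪ insert ⟨Γ, σ, X, t₁, t₂⟩ S) := by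
      ext p; simp only [Set.mem_union, Set.mem_insert_iff, Set.mem_singleton_iff]; tauto
    simp only at h ⊢
    rw [e] at h
    exact h.mer (.inr (.inl rfl)) (fun α => (hπ α).injective) h₁ h₂
  | decAL X f l r t t' s s' ts ts' ss' hl hr Y₁ Y₂ hA h₁ h₂ hY =>
    simp only [Set.insert_union] at h
    simp only
    rw [Set.union_assoc]
    exact h.bin (hl.eqv_acomb.trans (acomb_append f _ _ _ _)) hr.eqv_acomb
      (fun q hq => h₁.gvar_ne q (by simpa only [Set.insert_union] using hq))
      (fun q hq => h₂.gvar_ne q (by simpa only [Set.insert_union] using hq)) hY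
  | decAR X f l r t t' s s' ts' ss ss' hl hr Y₁ Y₂ hA h₁ h₂ hY =>
    simp only [Set.insert_union] at h
    simp only
    rw [Set.union_assoc]
    exact h.bin hl.eqv_acomb (hr.eqv_acomb.trans (acomb_append f _ _ _ _))
      (fun q hq => h₁.gvar_ne q (by simpa only [Set.insert_union] using hq))
      (fun q hq => h₂.gvar_ne q (by simpa only [Set.insert_union] using hq)) hY

/-- Every computed term is a pattern generalization of the two given terms. -/
theorem Computes.isPatternGeneralization {X : ℕ} {t₁ t₂ : Tm 𝒮 Γ τ} {σ : Subst 𝒮}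
    (h : Computes X t₁ t₂ σ) :
    IsPatternGeneralization (σ.map (arrows Γ τ) X) (lams Γ t₁) (lams Γ t₂) := by
  obtain ⟨S, hS⟩ := h
  suffices ∀ Q : State 𝒮, Relation.ReflTransGen Step ⟨{⟨Γ, τ, X, t₁, t₂⟩}, ∅, Subst.id⟩ Q →
      IsGen (fun i => lams Γ (AUP.side ⟨Γ, τ, X, t₁, t₂⟩ i)) (Q.sub.map (arrows Γ τ) X)
        (Q.problems ∪ Q.store) from (this _ hS).isPatternGeneralization
  intro Q hQ
  induction hQ with
  | refl => simpa [Subst.id] using IsGen.init X t₁ t₂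
  | tail _ hstep ih => exact ih.step hstep

end AntiUnif

/-! ### Refinement of a generalization -/

namespace AntiUnif

variable {𝒮 : Sig.{u}} {Γ Δ Θ : List (Ty 𝒮.Base)} {σ τ : Ty 𝒮.Base} {E : Tm.Theory} {b : 𝒮.Base}

open Tm

theorem MoreGeneral.trans {t v w : Tm 𝒮 [] τ} (h : MoreGeneral t v) (h' : MoreGeneral v w) :
    MoreGeneral t w := by
  obtain ⟨θ, hθ⟩ := h
  obtain ⟨θ', hθ'⟩ := h'
  exact ⟨θ.comp θ', by rw [subst_comp]; exact (hθ.subst θ').trans hθ'⟩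

theorem MoreGeneral.of_eqv {t v : Tm 𝒮 [] τ} (h : Eqv .assoc t v) : MoreGeneral t v :=
  ⟨Subst.id, by rwa [subst_id]⟩

namespace Tm

theorem IsAtom.eq_of_head {τ' : Ty 𝒮.Base} {h : Tm 𝒮 Γ τ} {h' : Tm 𝒮 Γ τ'} (hh : IsAtom h)
    (hh' : IsAtom h') (he : h.head = h'.head) :
    (⟨τ, h⟩ : (τ : Ty 𝒮.Base) × Tm 𝒮 Γ τ) = ⟨τ', h'⟩ := by
  cases hh <;> cases hh' <;> simp only [head, Option.some.injEq, Head.bvar.injEq, Head.fvar.injEq,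
    Head.con.injEq, Sigma.mk.injEq, reduceCtorEq] at he <;> obtain ⟨rfl, he⟩ := he <;>
    obtain rfl := eq_of_heq he <;> rfl

theorem IsAtom.eq_fvar_or {h : Tm 𝒮 Γ τ} (hh : IsAtom h) :
    (∃ Z, h.head = some (.fvar Z)) ∨ IsDecHead h := by
  cases hh with
  | bvar x => exact .inr (.bvar x)
  | fvar n => exact .inl ⟨_, rfl⟩
  | con c => exact .inr (.con c)

/-- Normal forms of basic type with the same head: it is a free variable, or they decompose in the
same way. -/
theorem decompose {l r : Tm 𝒮 Γ (.base b)} (hl : IsNf l) (hr : IsNf r) (h : l.head = r.head) :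
    (∃ Z, l.head = some (.fvar Z)) ∨
    (∃ (Δ : List (Ty 𝒮.Base)) (c : Tm 𝒮 Γ (arrows Δ (.base b))) (t s : Env 𝒮 Δ Γ), IsDecHead c ∧
      l = apps Δ c t ∧ r = apps Δ c s ∧ (∀ α x, IsNf (t α x)) ∧ ∀ α x, IsNf (s α x)) ∨
    (∃ (f : 𝒮.assoc b) (v w v' w' : Tm 𝒮 Γ (.base b)), l = bin f v w ∧ r = bin f v' w' ∧
      IsNf v ∧ IsNf w ∧ IsNf v' ∧ IsNf w') := by
  cases hl.nfSpine with
  | @atom _ Δ _ c hc t ht =>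
    rw [head_apps] at h
    rcases hc.eq_fvar_or with ⟨Z, hZ⟩ | hd
    · exact .inl ⟨Z, by rw [head_apps, hZ]⟩
    cases hr.nfSpine with
    | @atom _ Δ' _ c' hc' s hs =>
      rw [head_apps] at h
      have he := hc.eq_of_head hc' h
      obtain ⟨rfl, -⟩ := arrows_base_injective (congrArg Sigma.fst he)
      obtain rfl := eq_of_heq (Sigma.mk.inj he).2
      exact .inr (.inl ⟨Δ, c, t, s, hd, rfl, rfl, fun α x => (ht α x).isNf, fun α x => (hs α x).isNf⟩)
    | bin g => exact absurd h (head_atom_ne_acon hc ⟨_, g⟩)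
  | bin f hv hw =>
    obtain ⟨v', w', rfl⟩ := (head_eq_acon_iff hr f).1 h.symm
    obtain ⟨hv', hw'⟩ := isNf_bin hr
    exact .inr (.inr ⟨f, _, _, _, _, rfl, rfl, hv.isNf, hw.isNf, hv', hw'⟩)

theorem size_pos (t : Tm 𝒮 Γ τ) : 0 < t.size := by cases t <;> simp [size]

theorem sum_size_lt (h : Tm 𝒮 Γ (arrows Δ τ)) (ts : Env 𝒮 Δ Γ) :
    ((Var.all Δ).map fun y => (ts y.1 y.2).size).sum < (apps Δ h ts).size := by
  induction Δ generalizing τ with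
  | nil => exact size_pos _
  | cons α Δ ih =>
    have := ih (τ := .arr α τ) h fun _ x => ts _ x.succ
    simp only [Var.all, List.map_cons, List.map_map, List.sum_cons, Function.comp_def, apps, size]
    omega

end Tm

/-- Problems whose terms are normal forms of basic type that do not decompose, over no more bound
variables than those that occur in them. -/
inductive AUP.Reduced : AUP 𝒮 → Prop
  | intro {Δ : List (Ty 𝒮.Base)} {b : 𝒮.Base} {n : ℕ} {a c : Tm 𝒮 Δ (.base b)} (ha : IsNf a)
      (hc : IsNf c)
      (hhead : a.head ≠ c.head ∨ ∃ Z : FVar 𝒮, a.head = some (.fvar Z) ∧ c.head = some (.fvar Z))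
      (hvars : ∀ α (y : Var Δ α), a.HasVar y ∨ c.HasVar y) : AUP.Reduced ⟨Δ, .base b, n, a, c⟩

/-- The total number of nodes of the terms of a problem. -/
def AUP.size (p : AUP 𝒮) : ℕ := p.left.size + p.right.size

/-- Every generalization given by problems in normal form has an instance that is given by reduced
problems: decompose as long as possible, then drop the bound variables that do not occur. The list `L`
holds the problems still to be treated; the total size of their terms decreases. -/
theorem IsGen.exists_reduced {T : Bool → Tm 𝒮 [] τ} (n : ℕ) : ∀ (L : List (AUP 𝒮)) (D : Set (AUP 𝒮))
    (u : Tm 𝒮 [] τ), D.Finite → IsGen T u ({p | p ∈ L} ∪ D) →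
    (∀ p ∈ L, IsNf p.left ∧ IsNf p.right) → (∀ p ∈ D, p.Reduced) → (L.map AUP.size).sum < n →
    ∃ (u' : Tm 𝒮 [] τ) (D' : Set (AUP 𝒮)),
      (∀ p ∈ D', p.Reduced) ∧ IsGen T u' D' ∧ MoreGeneral u u' := by
  induction n with
  | zero => intro L D u _ _ _ _ h; omega
  | succ n ih =>
    intro L D u hD hu hL hred hn
    cases L with
    | nil => exact ⟨u, D, hred, by simpa using hu, .of_eqv (.refl u)⟩
    | cons p L =>
      have hins : ({q | q ∈ p :: L} ∪ D : Set (AUP 𝒮)) = insert p ({q | q ∈ L} ∪ D) := by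
        ext q; simp [or_assoc]
      rw [hins] at hu
      obtain ⟨N, hN⟩ := exists_fresh ((((List.finite_toSet L).union hD).insert p).image AUP.gvar)
      have hfresh : ∀ (τ : Ty 𝒮.Base) (n : ℕ), N ≤ n →
          ∀ q ∈ insert p ({q | q ∈ L} ∪ D), q.gvar ≠ ⟨τ, n⟩ :=
        fun τ n hn q hq h => hN τ n hn ⟨q, hq, h⟩
      obtain ⟨hl, hr⟩ := hL p (by simp)
      have hL' : ∀ p ∈ L, IsNf p.left ∧ IsNf p.right := fun q hq => hL q (by simp [hq])
      -- One step of refinement, followed by the refinement of the result.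
      have next : ∀ {r : Tm 𝒮 [] (arrows p.ctx p.ty)} {G : Set (AUP 𝒮)},
          IsGen T (u.subst (.single p.var r)) G → ∀ (L' : List (AUP 𝒮)) (D' : Set (AUP 𝒮)),
          D'.Finite → {q | q ∈ L' ++ L} ∪ D' = G →
          (∀ p ∈ L', IsNf p.left ∧ IsNf p.right) → (∀ p ∈ D', p.Reduced) →
          (L'.map AUP.size).sum < p.size → ∃ (u' : Tm 𝒮 [] τ) (D' : Set (AUP 𝒮)),
            (∀ p ∈ D', p.Reduced) ∧ IsGen T u' D' ∧ MoreGeneral u u' := by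
        intro r G hu' L' D' hD' hG hnf hred' hlt
        obtain ⟨u', D'', h1, h2, h3⟩ := ih (L' ++ L) D' _ hD' (hG ▸ hu')
          (fun q hq => (List.mem_append.1 hq).elim (hnf q) (hL' q)) hred' (by
            simp only [List.map_cons, List.sum_cons] at hn
            simp only [List.map_append, List.sum_append]
            omega)
        exact ⟨u', D'', h1, h2, .trans ⟨_, .refl _⟩ h3⟩
      obtain ⟨Γ, υ, X, l, r⟩ := p
      change IsNf l at hl
      change IsNf r at hr
      cases υ with
      | arr α υ =>
        obtain ⟨l, rfl, hl'⟩ := isNf_arr hl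
        obtain ⟨r, rfl, hr'⟩ := isNf_arr hr
        have := hu.abs (hfresh _ N le_rfl)
        refine next this [⟨α :: Γ, υ, N, l, r⟩] D hD ?_ (by simpa using ⟨hl', hr'⟩) hred ?_
        · ext q; simp [or_assoc]
        · simp [AUP.size, size]; omega
      | base b =>
        by_cases hh : l.head ≠ r.head ∨
            ∃ Z : FVar 𝒮, l.head = some (.fvar Z) ∧ r.head = some (.fvar Z)
        · obtain ⟨Δ, ι, a, c, rfl, rfl, hvars⟩ := exists_thin_rename l r
          have := hu.sol ι.ren_injective rfl rfl (hfresh _ N le_rfl)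
          refine next this [] (insert ⟨Δ, .base b, N, a, c⟩ D) (hD.insert _) ?_ (by simp) ?_ ?_
          · ext q; simp
          · rintro _ (rfl | hq)
            · refine .intro (isNf_rename.1 hl) (isNf_rename.1 hr) ?_ hvars
              refine hh.imp (fun h h' => h ?_) fun ⟨Z, h1, h2⟩ => ⟨Z, ?_, ?_⟩
              · rw [head_rename, head_rename, h']
              · rw [head_rename] at h1
                cases ha : a.head with
                | none => simp [ha] at h1
                | some k => rw [ha] at h1; cases k <;> simp_all [Head.rename]
              · rw [head_rename] at h2
                cases hc : c.head with
                | none => simp [hc] at h2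
                | some k => rw [hc] at h2; cases k <;> simp_all [Head.rename]
            · exact hred _ hq
          · simpa [AUP.size] using Or.inl (size_pos _)
        · push Not at hh
          obtain ⟨hh, hZ⟩ := hh
          rcases decompose hl hr hh with ⟨Z, h⟩ | ⟨Δ, c, t, s, hc, rfl, rfl, ht, hs⟩ |
            ⟨f, v, w, v', w', rfl, rfl, hv, hw, hv', hw'⟩
          · exact absurd (hh.symm.trans h) (hZ Z h)
          · have := hu.dec hc (.refl _) (.refl _) (Y := fun α x => N + x.toNat)
              (fun α x => hfresh _ _ (Nat.le_add_right _ _))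
              (fun α x y hxy => Var.toNat_injective (Nat.add_left_cancel hxy))
            refine next this ((Var.all Δ).map fun y => ⟨Γ, y.1, N + y.2.toNat, t y.1 y.2, s y.1 y.2⟩)
              D hD ?_ ?_ hred ?_
            · ext q
              simp only [List.mem_append, List.mem_map, Set.mem_ofPred_eq, Set.mem_union, or_assoc]
              refine or_congr_left ⟨?_, ?_⟩
              · rintro ⟨y, -, rfl⟩; exact ⟨_, _, rfl⟩
              · rintro ⟨α, x, rfl⟩; exact ⟨⟨α, x⟩, Var.mem_all x, rfl⟩
            · simp only [List.mem_map]
              rintro _ ⟨y, -, rfl⟩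
              exact ⟨ht _ _, hs _ _⟩
            · have h1 := sum_size_lt c t
              have h2 := sum_size_lt c s
              simp only [List.map_map, Function.comp_def, AUP.size, List.sum_map_add]
              omega
          · have := hu.bin (.refl _) (.refl _) (hfresh _ N le_rfl) (hfresh _ (N + 1) (by omega))
              (by omega)
            refine next this [⟨Γ, .base b, N, v, v'⟩, ⟨Γ, .base b, N + 1, w, w'⟩] D hD ?_ ?_ hred ?_
            · ext q; simp [or_assoc]
            · simpa using ⟨⟨hv, hv'⟩, hw, hw'⟩
            · simp [AUP.size, size_bin]; omega

/-- A pattern generalization is at least as general as one that is given by reduced problems. -/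
theorem exists_reduced_of_isPatternGeneralization {s : Tm 𝒮 [] τ} {T : Bool → Tm 𝒮 [] τ}
    (h : IsPatternGeneralization s (T true) (T false)) :
    ∃ (u : Tm 𝒮 [] τ) (D : Set (AUP 𝒮)),
      (∀ p ∈ D, p.Reduced) ∧ IsGen T u D ∧ MoreGeneral s u := by
  obtain ⟨⟨p, hsp, hp⟩, ⟨θ₁, h₁⟩, ⟨θ₂, h₂⟩⟩ := h
  -- One problem for each free variable of the pattern, whose terms are the two values of the variable.
  let F : FVar 𝒮 → AUP 𝒮 := fun Z =>
    ⟨[], Z.1, Z.2, (θ₁.map Z.1 Z.2).canon, (θ₂.map Z.1 Z.2).canon⟩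
  obtain ⟨L, hL⟩ : ∃ L : List (FVar 𝒮), ∀ Z, Z ∈ L ↔ p.Occurs Z :=
    ⟨(finite_occurs p).toFinset.toList, by simp⟩
  have hgen : IsGen T p ({q | q ∈ L.map F} ∪ ∅) := by
    refine ⟨hp.hasPattern, fun Z hZ => ⟨F Z, .inl (List.mem_map.2 ⟨Z, (hL Z).2 hZ, rfl⟩), rfl⟩, ?_⟩
    rintro (_ | _)
    · refine ⟨θ₂, ?_, (Eqv.of_empty hsp).symm.subst θ₂ |>.trans h₂⟩
      rintro q (hq | hq)
      · obtain ⟨Z, -, rfl⟩ := List.mem_map.1 hq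
        exact eqv_canon _
      · exact hq.elim
    · refine ⟨θ₁, ?_, (Eqv.of_empty hsp).symm.subst θ₁ |>.trans h₁⟩
      rintro q (hq | hq)
      · obtain ⟨Z, -, rfl⟩ := List.mem_map.1 hq
        exact eqv_canon _
      · exact hq.elim
  obtain ⟨u, D, h1, h2, h3⟩ := hgen.exists_reduced _ (L.map F) ∅ p Set.finite_empty
    (by
      intro q hq
      obtain ⟨Z, -, rfl⟩ := List.mem_map.1 hq
      exact ⟨isNf_canon _, isNf_canon _⟩) (by simp) (Nat.lt_succ_self _)
  exact ⟨u, D, h1, h2, .trans (.of_eqv (.of_empty hsp)) h3⟩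

end AntiUnif

/-! ### Computing a generalization that is given by reduced problems -/

namespace AntiUnif

variable {𝒮 : Sig.{u}} {Γ Δ : List (Ty 𝒮.Base)} {σ τ υ : Ty 𝒮.Base} {b : 𝒮.Base}

open Tm

namespace Tm

theorem eqv_of_lam {t v : Tm 𝒮 (σ :: Γ) τ} (h : Eqv .assoc (lam t) (lam v)) : Eqv .assoc t v := by
  have := h.canon_eq
  rw [canon_lam, canon_lam, lam.injEq] at this
  exact eqv_iff_canon_eq.2 this

theorem eqv_of_rename {ρ : Ren Γ Δ} (hρ : ∀ α, Function.Injective (ρ α)) {t v : Tm 𝒮 Γ τ}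
    (h : Eqv .assoc (t.rename ρ) (v.rename ρ)) : Eqv .assoc t v := by
  have := h.canon_eq
  rw [canon_rename, canon_rename] at this
  exact eqv_iff_canon_eq.2 (rename_injective hρ this)

/-- A normal form that equals `h(s₁, …, sₘ)` has the form `h(t₁, …, tₘ)`, and the arguments are
equal. -/
theorem exists_apps_of_eqv {t : Tm 𝒮 Γ (.base b)} (ht : IsNf t) {c : Tm 𝒮 Γ (arrows Δ (.base b))}
    (hc : IsAtom c) {s : Env 𝒮 Δ Γ} (h : Eqv .assoc t (apps Δ c s)) :
    ∃ ts : Env 𝒮 Δ Γ, t = apps Δ c ts ∧ ∀ α x, IsNf (ts α x) ∧ Eqv .assoc (s α x) (ts α x) := by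
  have hcan : t.canon = apps Δ c (fun α x => (s α x).canon) := by rw [h.canon_eq, canon_apps hc]
  have hd : t.head = c.head := by rw [← head_canon ht, hcan, head_apps]
  cases ht.nfSpine with
  | @atom _ Δ' _ c' hc' ts hts =>
    rw [head_apps] at hd
    have he := hc'.eq_of_head hc hd
    obtain ⟨rfl, -⟩ := arrows_base_injective (congrArg Sigma.fst he)
    obtain rfl := eq_of_heq (Sigma.mk.inj he).2
    rw [canon_apps hc'] at hcan
    have := apps_injective hcan
    refine ⟨ts, rfl, fun α x => ⟨(hts α x).isNf, eqv_iff_canon_eq.2 ?_⟩⟩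
    exact (congrFun (congrFun this α) x).symm
  | bin f => exact absurd hd.symm (head_atom_ne_acon hc ⟨_, f⟩)

end Tm

theorem State.exists_fresh {Q : State 𝒮} (hA : Q.problems.Finite) (hS : Q.store.Finite) :
    ∃ N : ℕ, ∀ (τ : Ty 𝒮.Base) (n : ℕ), N ≤ n → Q.Fresh τ n := by
  have h1 : ∀ p : AUP 𝒮, {Z | p.Mentions Z}.Finite := fun p =>
    (Set.finite_singleton p.gvar).union ((finite_occurs _).union (finite_occurs _))
  have h2 : {Z | Q.sub.Mentions Z}.Finite := by
    refine (Q.sub.finite.biUnion fun Z _ =>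
      (Set.finite_singleton Z).union (finite_occurs (Q.sub.map Z.1 Z.2))).subset ?_
    rintro X ⟨Z, hZ, hX⟩
    exact Set.mem_biUnion hZ hX
  obtain ⟨N, hN⟩ := AntiUnif.exists_fresh (((hA.union hS).biUnion fun p _ => h1 p).union h2)
  refine ⟨N, fun τ n hn => ⟨fun p hp h => ?_, fun h => ?_⟩⟩
  · exact hN τ n hn (.inl (Set.mem_biUnion hp h))
  · exact hN τ n hn (.inr h)

/-- A solved problem `W(x̄) : t ≜ v` that stems from the variable `n` of the generalization to be
computed: `κ` maps `W` to `λx̄. n(x̄π)` for a bijection `π`, and the two instances of `n(x̄π)` are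
the terms of the problem. -/
inductive AUP.SolvedAs (θ : Bool → Subst 𝒮) (κ : Subst 𝒮) (Δ : List (Ty 𝒮.Base)) (b : 𝒮.Base)
    (n : ℕ) : AUP 𝒮 → Prop
  | intro {Γ : List (Ty 𝒮.Base)} {W : ℕ} {t v : Tm 𝒮 Γ (.base b)} (π : Ren Δ Γ)
      (hπ : ∀ α, Function.Bijective (π α))
      (h : Eqv .assoc (κ.map (arrows Γ (.base b)) W) (lams Γ (fvarApp (τ := .base b) n π)))
      (ht : Eqv .assoc ((fvarApp n π).subst (θ true)) t)
      (hv : Eqv .assoc ((fvarApp n π).subst (θ false)) v) :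
      AUP.SolvedAs θ κ Δ b n ⟨Γ, .base b, W, t, v⟩

theorem AUP.SolvedAs.congr {θ : Bool → Subst 𝒮} {κ κ' : Subst 𝒮} {n : ℕ} {p : AUP 𝒮}
    (h : p.SolvedAs θ κ Δ b n) (hκ : κ'.map p.gvar.1 p.gvar.2 = κ.map p.gvar.1 p.gvar.2) :
    p.SolvedAs θ κ' Δ b n := by
  obtain ⟨π, hπ, h, ht, hv⟩ := h
  exact .intro π hπ ((Eqv.of_eq hκ).trans h) ht hv

/-- The part `s` of the generalization to be computed guides the decomposition of the problem `p`. -/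
def AUP.Guided (θ : Bool → Subst 𝒮) (κ : Subst 𝒮) (p : AUP 𝒮) (s : Tm 𝒮 p.ctx p.ty) : Prop :=
  Eqv .assoc (κ.map p.gvar.1 p.gvar.2) (lams p.ctx s) ∧
    ∀ i, Eqv .assoc (s.subst (θ i)) (p.side i) ∧ IsNf (p.side i)

/-- The invariant of the guided computation of the generalization `T` with the instances given by
`θ`: the term computed so far has the instance `T` under `κ`, and the solved problems stem from
variables of `T`. -/
structure Invariant (θ : Bool → Subst 𝒮) (T : Tm 𝒮 [] υ) (X₀ : ℕ) (Q : State 𝒮) (κ : Subst 𝒮) :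
    Prop where
  finite_problems : Q.problems.Finite
  finite_store : Q.store.Finite
  occurs : ∀ Z, (Q.sub.map υ X₀).Occurs Z → ∃ p ∈ Q.problems ∪ Q.store, Z = p.gvar
  instance_eq : Eqv .assoc ((Q.sub.map υ X₀).subst κ) T
  solved : ∀ q ∈ Q.store, ∃ Δ b n, q.SolvedAs θ κ Δ b n

variable {θ : Bool → Subst 𝒮} {T : Tm 𝒮 [] υ} {X₀ : ℕ} {A S : Set (AUP 𝒮)} {ς κ : Subst 𝒮}

/-- A problem is replaced by new problems and new solved problems, and `κ` is extended to their
generalization variables. -/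
theorem Invariant.update {p : AUP 𝒮} (h : Invariant θ T X₀ ⟨insert p A, S, ς⟩ κ)
    {N : Set ((Z : FVar 𝒮) × Tm 𝒮 [] Z.1)} {hN : N.Finite}
    (hfresh : ∀ e ∈ N, ∀ q ∈ insert p A ∪ S, q.gvar ≠ e.1) {P R A' S' : Set (AUP 𝒮)}
    (hP : P.Finite) (hR : R.Finite) (hA' : A' = P ∪ A) (hS' : S' = R ∪ S)
    {r : Tm 𝒮 [] (arrows p.ctx p.ty)} (hocc : ∀ Z, r.Occurs Z → ∃ q ∈ P ∪ R, Z = q.gvar)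
    (hr : Eqv .assoc (r.subst (κ.extend N hN)) (κ.map p.gvar.1 p.gvar.2))
    (hsolved : ∀ q ∈ R, ∃ Δ b n, q.SolvedAs θ (κ.extend N hN) Δ b n) :
    Invariant θ T X₀ ⟨A', S', ς.comp (.single p.var r)⟩ (κ.extend N hN) ∧
      ∀ q ∈ A, (κ.extend N hN).map q.gvar.1 q.gvar.2 = κ.map q.gvar.1 q.gvar.2 := by
  subst hA' hS'
  have hold : ∀ q ∈ insert p A ∪ S,
      (κ.extend N hN).map q.gvar.1 q.gvar.2 = κ.map q.gvar.1 q.gvar.2 :=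
    fun q hq => Subst.extend_of_notMem _ fun v hv => hfresh _ hv q hq rfl
  refine ⟨⟨?_, ?_, ?_, ?_, ?_⟩, fun q hq => hold q (.inl (.inr hq))⟩
  · exact hP.union (h.finite_problems.subset (Set.subset_insert _ _))
  · exact hR.union h.finite_store
  · intro Z hZ
    obtain ⟨Y, hY, hYZ⟩ := (occurs_subst _ _ _).1 hZ
    by_cases hYp : Y = p.gvar
    · subst hYp
      obtain ⟨q, hq | hq, rfl⟩ := hocc Z (by rwa [AUP.gvar, single_self] at hYZ)
      · exact ⟨q, .inl (.inl hq), rfl⟩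
      · exact ⟨q, .inr (.inl hq), rfl⟩
    · rw [single_of_ne r hYp] at hYZ
      obtain rfl : Z = Y := hYZ
      obtain ⟨q, (rfl | hq) | hq, rfl⟩ := h.occurs Z hY
      · exact absurd rfl hYp
      · exact ⟨q, .inl (.inr hq), rfl⟩
      · exact ⟨q, .inr (.inr hq), rfl⟩
  · refine Eqv.trans (subst_single_subst _ (fun Z hZ _ => ?_) hr) h.instance_eq
    obtain ⟨q, hq, rfl⟩ := h.occurs Z hZ
    exact hold q hq
  · rintro q (hq | hq)
    · exact hsolved q hq
    · obtain ⟨Δ, b, n, hs⟩ := h.solved q hq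
      exact ⟨Δ, b, n, hs.congr (hold q (.inr hq))⟩

/-- From every state with a problem guided by `s`, that problem can be worked off. -/
def Solvable (θ : Bool → Subst 𝒮) (T : Tm 𝒮 [] υ) (X₀ : ℕ) (s : Tm 𝒮 Γ τ) : Prop :=
  ∀ (X : ℕ) (t v : Tm 𝒮 Γ τ) (A S : Set (AUP 𝒮)) (ς κ : Subst 𝒮),
    AUP.Guided θ κ ⟨Γ, τ, X, t, v⟩ s → ⟨Γ, τ, X, t, v⟩ ∉ A →
    Invariant θ T X₀ ⟨insert ⟨Γ, τ, X, t, v⟩ A, S, ς⟩ κ →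
    ∃ (S' : Set (AUP 𝒮)) (ς' κ' : Subst 𝒮),
      Relation.ReflTransGen Step ⟨insert ⟨Γ, τ, X, t, v⟩ A, S, ς⟩ ⟨A, S', ς'⟩ ∧
      Invariant θ T X₀ ⟨A, S', ς'⟩ κ' ∧ ∀ q ∈ A, κ'.map q.gvar.1 q.gvar.2 = κ.map q.gvar.1 q.gvar.2

/-- Finitely many guided problems are worked off one after the other; this leaves the values of `κ` on
the generalization variables of the remaining problems unchanged. -/
theorem Solvable.set {P : Set (AUP 𝒮)} (hP : P.Finite) (hPA : ∀ p ∈ P, p ∉ A)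
    (hs : ∀ p ∈ P, ∃ s, AUP.Guided θ κ p s ∧ Solvable θ T X₀ s)
    (h : Invariant θ T X₀ ⟨P ∪ A, S, ς⟩ κ) :
    ∃ (S' : Set (AUP 𝒮)) (ς' κ' : Subst 𝒮),
      Relation.ReflTransGen Step ⟨P ∪ A, S, ς⟩ ⟨A, S', ς'⟩ ∧
      Invariant θ T X₀ ⟨A, S', ς'⟩ κ' ∧
      ∀ q ∈ A, κ'.map q.gvar.1 q.gvar.2 = κ.map q.gvar.1 q.gvar.2 := by
  induction P, hP using Set.Finite.induction_on generalizing S ς κ with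
  | empty =>
    rw [Set.empty_union] at h ⊢
    exact ⟨S, ς, κ, .refl, h, fun _ _ => rfl⟩
  | @insert p P hp hP ih =>
    rw [Set.insert_union] at h ⊢
    obtain ⟨s, hg, hsol⟩ := hs p (.inl rfl)
    obtain ⟨S₁, ς₁, κ₁, h1, h2, h3⟩ := hsol p.var p.left p.right (P ∪ A) S ς κ hg
      (by rintro (h | h); exacts [hp h, hPA p (.inl rfl) h]) h
    obtain ⟨S₂, ς₂, κ₂, h4, h5, h6⟩ := ih (fun q hq => hPA q (.inr hq)) (fun q hq => by
      obtain ⟨s, hg, hsol⟩ := hs q (.inr hq)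
      refine ⟨s, ⟨?_, hg.2⟩, hsol⟩
      rw [h3 q (.inl hq)]
      exact hg.1) h2
    exact ⟨S₂, ς₂, κ₂, h1.trans h4, h5, fun q hq => (h6 q hq).trans (h3 q (.inr hq))⟩

variable {D : Set (AUP 𝒮)}

/-- The two instances of a variable of a generalization that is given by reduced problems. -/
theorem exists_reduced_instances (hD : ∀ p ∈ D, p.Reduced) (hθ : ∀ i, (θ i).Solves i D) {n : ℕ}
    (h : ∃ p ∈ D, (⟨arrows Δ (.base b), n⟩ : FVar 𝒮) = p.gvar) :
    ∃ a : Bool → Tm 𝒮 Δ (.base b), (∀ i, IsNf (a i)) ∧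
      ((a true).head ≠ (a false).head ∨ ∃ Z : FVar 𝒮, ∀ i, (a i).head = some (.fvar Z)) ∧
      (∀ α (y : Var Δ α), ∃ i, (a i).HasVar y) ∧
      ∀ {Γ : List (Ty 𝒮.Base)} (ρ : Ren Δ Γ) (i : Bool),
        Eqv .assoc ((fvarApp n ρ : Tm 𝒮 Γ (.base b)).subst (θ i)) ((a i).rename ρ) := by
  obtain ⟨p, hp, he⟩ := h
  have hs := fun i => hθ i p hp
  cases hD p hp with
  | @intro Δ' b' n' a c ha hc hhead hvars =>
    obtain ⟨rfl, rfl⟩ := arrows_base_injective (congrArg Sigma.fst he)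
    obtain rfl : n = n' := eq_of_heq (Sigma.mk.inj he).2
    refine ⟨fun i => AUP.side ⟨Δ, .base b, n, a, c⟩ i, ?_, ?_, ?_, fun ρ i => fvarApp_subst (hs i) ρ⟩
    · rintro (_ | _)
      · exact hc
      · exact ha
    · refine hhead.imp_right fun ⟨Z, h1, h2⟩ => ⟨Z, ?_⟩
      rintro (_ | _)
      · exact h2
      · exact h1
    · exact fun α y => (hvars α y).elim (fun h => ⟨true, h⟩) fun h => ⟨false, h⟩

/-- The instances of a subterm that does not have the head `f` do not both have the head `f`. -/
theorem exists_canon_ne_bin (hD : ∀ p ∈ D, p.Reduced) (hθ : ∀ i, (θ i).Solves i D) {f : 𝒮.assoc b}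
    {v : Tm 𝒮 Γ (.base b)} (hv : CombPattern v) (hvf : ∀ v₁ v₂, v ≠ bin f v₁ v₂)
    (hocc : ∀ Z, v.Occurs Z → ∃ p ∈ D, Z = p.gvar) :
    ∃ i, ∀ v₁ v₂, (v.subst (θ i)).canon ≠ bin f v₁ v₂ := by
  by_contra hcon
  push Not at hcon
  have hcon : ∀ i, (v.subst (θ i)).canon.head = some (.acon ⟨b, f⟩) := by
    intro i
    obtain ⟨v₁, v₂, h⟩ := hcon i
    rw [h]; rfl
  cases hv with
  | apps hh ts =>
    have := hcon true
    rw [apps_subst, hh.subst, canon_apps hh.isAtom, head_apps] at this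
    exact head_atom_ne_acon hh.isAtom _ this
  | bin g h hv hw =>
    have := hcon true
    change (bin g _ _).canon.head = _ at this
    rw [canon_bin, head_append] at this
    simp only [Option.some.injEq, Head.acon.injEq, Sigma.mk.injEq, heq_eq_eq, true_and] at this
    exact hvf _ _ (by rw [this])
  | @flex _ Δ _ n ρ hρ =>
    obtain ⟨a, ha, hhead, -, hinst⟩ := exists_reduced_instances hD hθ
      (hocc ⟨arrows Δ (.base b), n⟩ ((occurs_fvarApp _ _ _).2 rfl))
    have h : ∀ i, (a i).head = some (.acon ⟨b, f⟩) := by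
      intro i
      have := hcon i
      rw [(hinst ρ i).canon_eq, canon_rename, head_rename, head_canon (ha i)] at this
      cases hai : (a i).head with
      | none => simp [hai] at this
      | some k => rw [hai] at this; cases k <;> simp_all [Head.rename]
    rcases hhead with h' | ⟨Z, h'⟩
    · exact h' ((h true).trans (h false).symm)
    · have := (h true).symm.trans (h' true)
      simp at this

/-- An abstraction guides an abstraction step. -/
theorem solvable_lam {s : Tm 𝒮 (σ :: Γ) τ} (ih : Solvable θ T X₀ s) : Solvable θ T X₀ (lam s) := by
  intro X t v A S ς κ hg hA h
  have hl : IsNf t := (hg.2 true).2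
  have hr : IsNf v := (hg.2 false).2
  obtain ⟨t, rfl, ht⟩ := isNf_arr hl
  obtain ⟨v, rfl, hv⟩ := isNf_arr hr
  obtain ⟨N, hN⟩ := State.exists_fresh h.finite_problems h.finite_store
  have hfresh := hN (arrows (σ :: Γ) τ) N le_rfl
  let B : Set ((Z : FVar 𝒮) × Tm 𝒮 [] Z.1) := {⟨⟨arrows (σ :: Γ) τ, N⟩, lams (σ :: Γ) s⟩}
  have hB : B.Finite := Set.finite_singleton _
  have hval : (κ.extend B hB).map (arrows (σ :: Γ) τ) N = lams (σ :: Γ) s := by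
    refine Subst.extend_of_mem (Z := ⟨arrows (σ :: Γ) τ, N⟩) κ (fun w hw => ?_) rfl
    exact eq_of_heq (Sigma.mk.inj hw).2
  obtain ⟨h1, h2⟩ := h.update (N := B) (hN := hB) (P := {⟨σ :: Γ, τ, N, t, v⟩}) (R := ∅)
    (A' := insert ⟨σ :: Γ, τ, N, t, v⟩ A) (S' := S) (r := lams (σ :: Γ) (gen (τ := τ) N))
    (by rintro _ rfl q hq; exact hfresh.gvar_ne q hq) (Set.finite_singleton _) Set.finite_empty rfl
    (Set.empty_union _).symm
    (fun Z hZ => ⟨_, .inl rfl, (occurs_fvarApp _ _ _).1 ((occurs_lams _ _).1 hZ)⟩)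
    ((Eqv.of_eq (lams_subst (Γ := σ :: Γ) _ _)).trans
      ((lams_congr (Γ := σ :: Γ) (gen_subst (.of_eq hval))).trans hg.1.symm)) (by simp)
  obtain ⟨S', ς', κ', h3, h4, h5⟩ := ih N t v A S _ _ ⟨.of_eq hval, by
      rintro (_ | _)
      · exact ⟨eqv_of_lam (hg.2 false).1, hv⟩
      · exact ⟨eqv_of_lam (hg.2 true).1, ht⟩⟩
    (fun hq => hfresh.gvar_ne _ (.inl (.inr hq)) rfl) h1
  exact ⟨S', ς', κ', .head (.abs X t v N hA hfresh) h3, h4, fun q hq => (h5 q hq).trans (h2 q hq)⟩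

/-- A free constant or a bound variable guides a decomposition step. -/
theorem solvable_apps {c : Tm 𝒮 Γ (arrows Δ (.base b))} (hc : IsDecHead c) {s : Env 𝒮 Δ Γ}
    (ih : ∀ α x, Solvable θ T X₀ (s α x)) : Solvable θ T X₀ (apps Δ c s) := by
  intro X t v A S ς κ hg hA h
  have hinst := fun i => (hg.2 i).1
  simp only [apps_subst, hc.subst] at hinst
  have hl : IsNf t := (hg.2 true).2
  have hr : IsNf v := (hg.2 false).2
  have el : Eqv .assoc t (apps Δ c fun α x => (s α x).subst (θ true)) := (hinst true).symm
  have er : Eqv .assoc v (apps Δ c fun α x => (s α x).subst (θ false)) := (hinst false).symm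
  obtain ⟨t, rfl, ht⟩ := exists_apps_of_eqv hl hc.isAtom el
  obtain ⟨v, rfl, hv⟩ := exists_apps_of_eqv hr hc.isAtom er
  obtain ⟨N, hN⟩ := State.exists_fresh h.finite_problems h.finite_store
  have hfresh := fun α (x : Var Δ α) => hN (arrows Γ α) (N + x.toNat) (Nat.le_add_right _ _)
  let P : Set (AUP 𝒮) := {p | ∃ α, ∃ x : Var Δ α, p = ⟨Γ, α, N + x.toNat, t α x, v α x⟩}
  have hP : P.Finite := finite_setOf_var _
  let B : Set ((Z : FVar 𝒮) × Tm 𝒮 [] Z.1) :=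
    {e | ∃ α, ∃ x : Var Δ α, e = ⟨⟨arrows Γ α, N + x.toNat⟩, lams Γ (s α x)⟩}
  have hB : B.Finite := finite_setOf_var _
  have hval : ∀ α (x : Var Δ α),
      (κ.extend B hB).map (arrows Γ α) (N + x.toNat) = lams Γ (s α x) := by
    intro α x
    refine Subst.extend_of_mem (Z := ⟨arrows Γ α, N + x.toNat⟩) κ ?_ ⟨α, x, rfl⟩
    rintro w ⟨β, y, hy⟩
    have h1 := (Sigma.mk.inj hy).1
    obtain rfl := arrows_injective_right (congrArg Sigma.fst h1)
    obtain rfl : x = y := Var.toNat_injective (Nat.add_left_cancel (eq_of_heq (Sigma.mk.inj h1).2))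
    exact eq_of_heq (Sigma.mk.inj hy).2
  obtain ⟨h1, h2⟩ := h.update (N := B) (hN := hB) (P := P) (R := ∅) (A' := P ∪ A) (S' := S)
    (r := lams Γ (apps Δ c (fun α x => gen (N + x.toNat))))
    (by rintro _ ⟨α, x, rfl⟩ q hq; exact (hfresh α x).gvar_ne q hq) hP Set.finite_empty rfl
    (Set.empty_union _).symm (by
      intro Z hZ
      rw [occurs_lams, occurs_apps] at hZ
      rcases hZ with hZ | ⟨α, x, hZ⟩
      · exact absurd hZ (hc.not_occurs Z)
      · exact ⟨_, .inl ⟨α, x, rfl⟩, (occurs_fvarApp _ _ _).1 hZ⟩)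
    (by
      rw [lams_subst, apps_subst, hc.subst]
      exact (lams_congr (apps_congr (.refl c) fun α x => gen_subst (.of_eq (hval α x)))).trans
        hg.1.symm) (by simp)
  obtain ⟨S', ς', κ', h3, h4, h5⟩ := Solvable.set hP
    (by rintro _ ⟨α, x, rfl⟩ hq; exact (hfresh α x).gvar_ne _ (.inl (.inr hq)) rfl)
    (by
      rintro _ ⟨α, x, rfl⟩
      refine ⟨s α x, ⟨.of_eq (hval α x), ?_⟩, ih α x⟩
      rintro (_ | _)
      · exact ⟨(hv α x).2, (hv α x).1⟩
      · exact ⟨(ht α x).2, (ht α x).1⟩) h1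
  refine ⟨S', ς', κ', .head (.dec X c hc t v (fun α x => N + x.toNat) hA hfresh ?_) h3, h4,
    fun q hq => (h5 q hq).trans (h2 q hq)⟩
  exact fun α x y hxy => Var.toNat_injective (Nat.add_left_cancel hxy)

/-- One of the two sides of a problem guided by `f(v, w)` contributes a single argument to `v`, so
that one of the rules for associative constants applies. -/
theorem solvable_bin {f : 𝒮.assoc b} {v w : Tm 𝒮 Γ (.base b)}
    (hvf : ∃ i, ∀ v₁ v₂, (v.subst (θ i)).canon ≠ bin f v₁ v₂)
    (ihv : Solvable θ T X₀ v) (ihw : Solvable θ T X₀ w) : Solvable θ T X₀ (bin f v w) := by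
  intro X l r A S ς κ hg hA h
  obtain ⟨ls, hls⟩ := exists_flat f l
  obtain ⟨rs, hrs⟩ := exists_flat f r
  obtain ⟨t, ts, t', ts', rfl, ht, ht', hts⟩ := hls.split (hg.2 true).2 (hg.2 true).1.symm
  obtain ⟨s, ss, s', ss', rfl, hs, hs', hss⟩ := hrs.split (hg.2 false).2 (hg.2 false).1.symm
  have hlnf := hls.isNf (hg.2 true).2
  have hrnf := hrs.isNf (hg.2 false).2
  obtain ⟨N, hN⟩ := State.exists_fresh h.finite_problems h.finite_store
  have hfresh₁ := hN (arrows Γ (.base b)) N le_rfl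
  have hfresh₂ := hN (arrows Γ (.base b)) (N + 1) (by omega)
  let P : Set (AUP 𝒮) := {⟨Γ, .base b, N, acomb f t ts, acomb f s ss⟩,
    ⟨Γ, .base b, N + 1, acomb f t' ts', acomb f s' ss'⟩}
  have hP : P.Finite := by simp [P]
  -- The side whose instance of `v` does not have the head `f` contributes a single argument to `v`.
  have hstep : Step ⟨insert ⟨Γ, .base b, X, l, r⟩ A, S, ς⟩
      ⟨P ∪ A, S, ς.comp (.single X (lams Γ (bin f (gen N) (gen (N + 1)))))⟩ := by
    obtain ⟨_ | _, hi⟩ := hvf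
    · obtain rfl := hss hi
      exact .decAL X f l r t t' s s' ts ts' ss' hls hrs N (N + 1) hA hfresh₁ hfresh₂ (by omega)
    · obtain rfl := hts hi
      exact .decAR X f l r t t' s s' ts' ss ss' hls hrs N (N + 1) hA hfresh₁ hfresh₂ (by omega)
  let B : Set ((Z : FVar 𝒮) × Tm 𝒮 [] Z.1) :=
    {⟨⟨arrows Γ (.base b), N⟩, lams Γ v⟩, ⟨⟨arrows Γ (.base b), N + 1⟩, lams Γ w⟩}
  have hB : B.Finite := by simp [B]
  have hval₁ : (κ.extend B hB).map (arrows Γ (.base b)) N = lams Γ v := by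
    refine Subst.extend_of_mem (Z := ⟨arrows Γ (.base b), N⟩) κ (fun z hz => ?_) (.inl rfl)
    rcases hz with hz | hz
    · exact eq_of_heq (Sigma.mk.inj hz).2
    · have := eq_of_heq (Sigma.mk.inj (Sigma.mk.inj hz).1).2
      omega
  have hval₂ : (κ.extend B hB).map (arrows Γ (.base b)) (N + 1) = lams Γ w := by
    refine Subst.extend_of_mem (Z := ⟨arrows Γ (.base b), N + 1⟩) κ (fun z hz => ?_) (.inr rfl)
    rcases hz with hz | hz
    · have := eq_of_heq (Sigma.mk.inj (Sigma.mk.inj hz).1).2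
      omega
    · exact eq_of_heq (Sigma.mk.inj hz).2
  obtain ⟨h1, h2⟩ := h.update (N := B) (hN := hB) (P := P) (R := ∅) (A' := P ∪ A) (S' := S)
    (r := lams Γ (bin f (gen N) (gen (N + 1))))
    (by
      rintro _ (rfl | rfl) q hq
      · exact hfresh₁.gvar_ne q hq
      · exact hfresh₂.gvar_ne q hq) hP Set.finite_empty rfl (Set.empty_union _).symm
    (by
      intro Z hZ
      rw [occurs_lams] at hZ
      rcases hZ with (hZ | hZ) | hZ
      · exact hZ.elim
      · exact ⟨_, .inl (.inl rfl), (occurs_fvarApp _ _ _).1 hZ⟩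
      · exact ⟨_, .inl (.inr rfl), (occurs_fvarApp _ _ _).1 hZ⟩)
    (by
      rw [lams_subst]
      exact (lams_congr (((Eqv.refl _).app (gen_subst (.of_eq hval₁))).app
        (gen_subst (.of_eq hval₂)))).trans hg.1.symm) (by simp)
  obtain ⟨S', ς', κ', h3, h4, h5⟩ := Solvable.set hP
    (by
      rintro _ (rfl | rfl) hq
      · exact hfresh₁.gvar_ne _ (.inl (.inr hq)) rfl
      · exact hfresh₂.gvar_ne _ (.inl (.inr hq)) rfl)
    (by
      rintro _ (rfl | rfl)
      · refine ⟨v, ⟨.of_eq hval₁, ?_⟩, ihv⟩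
        rintro (_ | _)
        · exact ⟨hs.symm, isNf_acomb (hrnf _ (by simp)) fun z hz => hrnf _ (by simp [hz])⟩
        · exact ⟨ht.symm, isNf_acomb (hlnf _ (by simp)) fun z hz => hlnf _ (by simp [hz])⟩
      · refine ⟨w, ⟨.of_eq hval₂, ?_⟩, ihw⟩
        rintro (_ | _)
        · exact ⟨hs'.symm, isNf_acomb (hrnf _ (by simp)) fun z hz => hrnf _ (by simp [hz])⟩
        · exact ⟨ht'.symm, isNf_acomb (hlnf _ (by simp)) fun z hz => hlnf _ (by simp [hz])⟩) h1
  exact ⟨S', ς', κ', .head hstep h3, h4, fun q hq => (h5 q hq).trans (h2 q hq)⟩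

/-- A variable given by a reduced problem guides a solving step: the problem at hand is a renamed copy
of the reduced one up to associativity, so that its heads agree with those of the reduced problem and
exactly the arguments `x̄ρ` of the variable occur in it. -/
theorem solvable_flex (hD : ∀ p ∈ D, p.Reduced) (hθ : ∀ i, (θ i).Solves i D) {n : ℕ} {ρ : Ren Δ Γ}
    (hρ : ∀ α, Function.Injective (ρ α))
    (hn : ∃ p ∈ D, (⟨arrows Δ (.base b), n⟩ : FVar 𝒮) = p.gvar) :
    Solvable θ T X₀ (fvarApp n ρ : Tm 𝒮 Γ (.base b)) := by
  intro X l r A S ς κ hg hA h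
  obtain ⟨a, ha, hhead, hvars, hinst⟩ := exists_reduced_instances hD hθ hn
  obtain ⟨Δ', ι, t, v, rfl, rfl, htv⟩ := exists_thin_rename l r
  -- The two terms over the subsequence of the bound variables that occur in them.
  let m : Bool → Tm 𝒮 Δ' (.base b) := AUP.side ⟨Δ', .base b, X, t, v⟩
  have hm : ∀ i, IsNf ((m i).rename ι.ren) ∧
      Eqv .assoc ((a i).rename ρ) ((m i).rename ι.ren) := by
    rintro (_ | _)
    · exact ⟨(hg.2 false).2, (hinst ρ false).symm.trans (hg.2 false).1⟩
    · exact ⟨(hg.2 true).2, (hinst ρ true).symm.trans (hg.2 true).1⟩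
  have hmvars : ∀ α (y : Var Δ' α), ∃ i, (m i).HasVar y := fun α y =>
    (htv α y).elim (fun h => ⟨true, h⟩) fun h => ⟨false, h⟩
  have hhas : ∀ i α (y : Var Γ α),
      (∃ x, ρ α x = y ∧ (a i).HasVar x) ↔ ∃ z, ι.ren α z = y ∧ (m i).HasVar z := by
    intro i α y
    rw [← hasVar_rename, ← hasVar_rename]
    exact hasVar_iff_of_eqv (isNf_rename.2 (ha i)) (hm i).1 (hm i).2 y
  have hmhead : ∀ i, (a i).head.map (Head.rename ρ) = (m i).head.map (Head.rename ι.ren) := by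
    intro i
    rw [← head_rename, ← head_rename]
    exact head_eq_of_eqv (isNf_rename.2 (ha i)) (hm i).1 (hm i).2
  -- Both `ρ` and the inclusion of the subsequence have as their range the variables that occur.
  have hex : ∀ α (x : Var Δ α), ∃ y, ι.ren α y = ρ α x := by
    intro α x
    obtain ⟨i, hi⟩ := hvars α x
    obtain ⟨z, hz, -⟩ := (hhas i α (ρ α x)).1 ⟨x, rfl, hi⟩
    exact ⟨z, hz⟩
  choose π hπ using hex
  have hbij : ∀ α, Function.Bijective (π α) := by
    refine fun α => ⟨fun x y hxy => hρ α ?_, fun y => ?_⟩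
    · rw [← hπ, ← hπ, hxy]
    · obtain ⟨i, hi⟩ := hmvars α y
      obtain ⟨x, hx, -⟩ := (hhas i α (ι.ren α y)).2 ⟨y, rfl, hi⟩
      exact ⟨x, ι.ren_injective α ((hπ α x).trans hx)⟩
  have hπρ : (fun α x => ι.ren α (π α x)) = ρ := by funext α x; exact hπ α x
  have hmt : ∀ i, Eqv .assoc ((fvarApp n π : Tm 𝒮 Δ' (.base b)).subst (θ i)) (m i) := by
    intro i
    refine (hinst π i).trans (eqv_of_rename ι.ren_injective ?_)
    rw [rename_rename, hπρ]
    exact (hm i).2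
  have hthead : t.head ≠ v.head ∨
      ∃ Z : FVar 𝒮, t.head = some (.fvar Z) ∧ v.head = some (.fvar Z) := by
    refine hhead.imp (fun hne he => hne ?_) fun ⟨Z, hZ⟩ => ?_
    · refine Option.map_injective (Head.rename_injective hρ) ?_
      rw [hmhead, hmhead]
      exact congrArg _ he
    · have key : ∀ i, (m i).head = some (.fvar Z) := by
        intro i
        have := hmhead i
        rw [hZ] at this
        cases hmi : (m i).head with
        | none => simp [hmi] at this
        | some k => rw [hmi] at this; cases k <;> simp_all [Head.rename]
      exact ⟨Z, key true, key false⟩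
  obtain ⟨N, hN⟩ := State.exists_fresh h.finite_problems h.finite_store
  have hfresh := hN (arrows Δ' (.base b)) N le_rfl
  let B : Set ((Z : FVar 𝒮) × Tm 𝒮 [] Z.1) :=
    {⟨⟨arrows Δ' (.base b), N⟩, lams Δ' (fvarApp (τ := .base b) n π)⟩}
  have hB : B.Finite := Set.finite_singleton _
  have hval : (κ.extend B hB).map (arrows Δ' (.base b)) N =
      lams Δ' (fvarApp (τ := .base b) n π) := by
    refine Subst.extend_of_mem (Z := ⟨arrows Δ' (.base b), N⟩) κ (fun w hw => ?_) rfl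
    exact eq_of_heq (Sigma.mk.inj hw).2
  obtain ⟨h1, h2⟩ := h.update (N := B) (hN := hB) (P := ∅) (R := {⟨Δ', .base b, N, t, v⟩})
    (A' := A) (S' := insert ⟨Δ', .base b, N, t, v⟩ S)
    (r := lams Γ (fvarApp (τ := .base b) N ι.ren))
    (by rintro _ rfl q hq; exact hfresh.gvar_ne q hq) Set.finite_empty (Set.finite_singleton _)
    (Set.empty_union _).symm rfl
    (fun Z hZ => ⟨_, .inr rfl, (occurs_fvarApp _ _ _).1 ((occurs_lams _ _).1 hZ)⟩)
    (by
      rw [lams_subst]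
      refine (lams_congr ((fvarApp_subst (.of_eq hval) ι.ren).trans (.of_eq ?_))).trans hg.1.symm
      rw [fvarApp_rename, hπρ])
    (by
      rintro _ rfl
      exact ⟨Δ, b, n, .intro π hbij (.of_eq hval) (hmt true) (hmt false)⟩)
  exact ⟨_, _, _, .single (.sol X ι t v N hthead htv hA hfresh), h1, h2⟩

/-- Every problem can be worked off that is guided by a pattern given by reduced problems. -/
theorem solvable (hD : ∀ p ∈ D, p.Reduced) (hθ : ∀ i, (θ i).Solves i D) {s : Tm 𝒮 Γ τ}
    (hs : CombPattern s) (hocc : ∀ Z, s.Occurs Z → ∃ p ∈ D, Z = p.gvar) : Solvable θ T X₀ s := by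
  induction hs with
  | lam _ ih => exact solvable_lam (ih hocc)
  | apps hh ts _ ih =>
    exact solvable_apps hh fun α x => ih α x fun Z hZ =>
      hocc Z ((occurs_apps _ _ _).2 (.inr ⟨α, x, hZ⟩))
  | bin f h hv _ ihv ihw =>
    have hocc₁ := fun Z hZ => hocc Z (.inl (.inr hZ))
    exact solvable_bin (exists_canon_ne_bin hD hθ hv h hocc₁) (ihv hocc₁)
      (ihw fun Z hZ => hocc Z (.inr hZ))
  | flex n ρ hρ => exact solvable_flex hD hθ hρ (hocc _ ((occurs_fvarApp _ _ _).2 rfl))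

/-! ### Merging, and completeness -/

/-- Solved problems that stem from the same variable are merged. -/
theorem Invariant.merge (n : ℕ) : ∀ (S : Set (AUP 𝒮)) (ς : Subst 𝒮), S.ncard = n →
    Invariant θ T X₀ ⟨∅, S, ς⟩ κ → ∃ (S' : Set (AUP 𝒮)) (ς' : Subst 𝒮),
      Relation.ReflTransGen Step ⟨∅, S, ς⟩ ⟨∅, S', ς'⟩ ∧ Invariant θ T X₀ ⟨∅, S', ς'⟩ κ ∧
      ∀ p ∈ S', ∀ q ∈ S', ∀ Δ b n, p.SolvedAs θ κ Δ b n → q.SolvedAs θ κ Δ b n → p = q := by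
  induction n with
  | zero =>
    intro S ς hS h
    have : S = ∅ := (Set.ncard_eq_zero h.finite_store).1 hS
    subst this
    exact ⟨∅, ς, .refl, h, fun p hp => hp.elim⟩
  | succ n ih =>
    intro S ς hS h
    by_cases hcon : ∀ p ∈ S, ∀ q ∈ S, ∀ Δ b n, p.SolvedAs θ κ Δ b n → q.SolvedAs θ κ Δ b n → p = q
    · exact ⟨S, ς, .refl, h, hcon⟩
    push Not at hcon
    obtain ⟨p, hp, q, hq, Δ, b, k, hpk, hqk, hpq⟩ := hcon
    let R := S \ {p, q}
    have hSR : S = {p, q} ∪ R := by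
      ext x
      by_cases hx : x = p ∨ x = q
      · rcases hx with rfl | rfl <;> simp_all [R]
      · simp [R, hx]
    have hqR : q ∉ R := by simp [R]
    have hpR : p ∉ R := by simp [R]
    have hRS : (insert p R) ⊆ S := by rw [hSR]; intro x; simp; tauto
    have hcard : (insert p R).ncard = n := by
      have h1 : S = insert q (insert p R) := by rw [hSR]; ext x; simp; tauto
      rw [h1, Set.ncard_insert_of_notMem (by simp [hqR, Ne.symm hpq])
        (h.finite_store.subset hRS)] at hS
      omega
    clear_value R
    subst hSR
    obtain @⟨Γ₁, W₁, t₁, v₁, π₁, hπ₁, h₁, ht₁, hv₁⟩ := hpk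
    obtain @⟨Γ₂, W₂, t₂, v₂, π₂, hπ₂, h₂, ht₂, hv₂⟩ := hqk
    -- The bijection between the bound variables that identifies the two occurrences of the variable.
    choose inv hinv using fun α => (Function.bijective_iff_has_inverse.1 (hπ₁ α))
    let π : Ren Γ₁ Γ₂ := fun α x => π₂ α (inv α x)
    have hπ : ∀ α, Function.Bijective (π α) := fun α =>
      (hπ₂ α).comp ⟨(hinv α).2.injective, (hinv α).1.surjective⟩
    have hππ : (fun α x => π α (π₁ α x)) = π₂ := by
      funext α x
      exact congrArg (π₂ α) ((hinv α).1 x)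
    have hren : ∀ i, ((fvarApp k π₁ : Tm 𝒮 Γ₁ (.base b)).subst (θ i)).rename π =
        (fvarApp k π₂ : Tm 𝒮 Γ₂ (.base b)).subst (θ i) := by
      intro i
      rw [← subst_rename, fvarApp_rename, hππ]
    have e₁ : Eqv .assoc (t₁.rename π) t₂ :=
      (ht₁.symm.rename π).trans ((Eqv.of_eq (hren true)).trans ht₂)
    have e₂ : Eqv .assoc (v₁.rename π) v₂ :=
      (hv₁.symm.rename π).trans ((Eqv.of_eq (hren false)).trans hv₂)
    have hstep := Step.mer (A := ∅) (S := R) (σ := ς) W₁ W₂ t₁ v₁ t₂ v₂ π hπ e₁ e₂ hpq hpR hqR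
    -- The values of `κ` on the two generalization variables agree up to `π`, so `κ` is kept.
    have hnew : Invariant θ T X₀ ⟨∅, insert ⟨Γ₁, .base b, W₁, t₁, v₁⟩ R,
        ς.comp (.single W₂ (lams Γ₂ (fvarApp (τ := .base b) W₁ π)))⟩ κ := by
      refine ⟨Set.finite_empty, h.finite_store.subset hRS, ?_, ?_, fun q hq => h.solved q (hRS hq)⟩
      · intro Z hZ
        obtain ⟨Y, hY, hYZ⟩ := (occurs_subst _ _ _).1 hZ
        by_cases hYq : Y = ⟨arrows Γ₂ (.base b), W₂⟩
        · subst hYq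
          rw [single_self, occurs_lams, occurs_fvarApp] at hYZ
          exact ⟨_, .inr (.inl rfl), hYZ⟩
        · rw [single_of_ne _ hYq] at hYZ
          obtain rfl : Z = Y := hYZ
          obtain ⟨q, hq | (rfl | rfl) | hq, rfl⟩ := h.occurs Z hY
          · exact hq.elim
          · exact ⟨_, .inr (.inl rfl), rfl⟩
          · exact absurd rfl hYq
          · exact ⟨q, .inr (.inr hq), rfl⟩
      · refine Eqv.trans (subst_single_subst _ (fun Z _ _ => rfl) ?_) h.instance_eq
        rw [lams_subst]
        refine (lams_congr ((fvarApp_subst h₁ π).trans (.of_eq ?_))).trans h₂.symm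
        rw [fvarApp_rename, hππ]
    obtain ⟨S', ς', h3, h4, h5⟩ := ih _ _ hcard hnew
    exact ⟨S', ς', .head hstep h3, h4, h5⟩

/-- Once everything is solved and merged, the solved problems correspond to variables of `T`, up
to the order of the arguments; so `κ` can be undone. -/
theorem Invariant.moreGeneral (h : Invariant θ T X₀ ⟨∅, S, ς⟩ κ)
    (hS : ∀ p ∈ S, ∀ q ∈ S, ∀ Δ b n, p.SolvedAs θ κ Δ b n → q.SolvedAs θ κ Δ b n → p = q) :
    MoreGeneral T (ς.map υ X₀) := by
  have key : ∀ p ∈ S, ∃ e : (Z : FVar 𝒮) × Tm 𝒮 [] Z.1,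
      (∃ Δ b n, p.SolvedAs θ κ Δ b n ∧ e.1 = ⟨arrows Δ (.base b), n⟩) ∧
      ∀ ϑ : Subst 𝒮, ϑ.map e.1.1 e.1.2 = e.2 →
        Eqv .assoc ((κ.map p.gvar.1 p.gvar.2).subst ϑ) (.fvar p.gvar.2) := by
    intro p hp
    obtain ⟨Δ, b, n, hpn⟩ := h.solved p hp
    have hpn' := hpn
    obtain @⟨Γ, W, t, v, π, hπ, hκ, -, -⟩ := hpn
    choose inv hinv using fun α => (Function.bijective_iff_has_inverse.1 (hπ α))
    refine ⟨⟨⟨arrows Δ (.base b), n⟩, lams Δ (fvarApp (τ := .base b) W inv)⟩,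
      ⟨Δ, b, n, hpn', rfl⟩, fun ϑ hϑ => ?_⟩
    refine (hκ.subst ϑ).trans ?_
    rw [lams_subst]
    refine (lams_congr ((fvarApp_subst (.of_eq hϑ) π).trans (.of_eq ?_))).trans (lams_gen W)
    rw [fvarApp_rename, gen]
    congr 1
    funext α x
    exact (hinv α).2 x
  have : Nonempty ((Z : FVar 𝒮) × Tm 𝒮 [] Z.1) := ⟨⟨⟨υ, X₀⟩, .fvar X₀⟩⟩
  choose! e he₁ he₂ using key
  have hfin : S.Finite := h.finite_store
  let N : Set ((Z : FVar 𝒮) × Tm 𝒮 [] Z.1) := {w | ∃ p ∈ S, w = e p}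
  have hN : N.Finite := (hfin.image e).subset fun w ⟨p, hp, hw⟩ => ⟨p, hp, hw.symm⟩
  let ϑ := Subst.id.extend N hN
  -- Different solved problems stem from different variables, so `ϑ` has a single value for each of them.
  have hϑ : ∀ p ∈ S, ϑ.map (e p).1.1 (e p).1.2 = (e p).2 := by
    intro p hp
    refine Subst.extend_of_mem _ ?_ ⟨p, hp, rfl⟩
    rintro w ⟨q, hq, hqw⟩
    obtain ⟨Δ, b, n, h1, h2⟩ := he₁ p hp
    obtain ⟨Δ', b', n', h1', h2'⟩ := he₁ q hq
    have h3 : (⟨arrows Δ' (.base b'), n'⟩ : FVar 𝒮) = ⟨arrows Δ (.base b), n⟩ := by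
      rw [← h2, ← h2', ← hqw]
    obtain ⟨rfl, rfl⟩ := arrows_base_injective (congrArg Sigma.fst h3)
    obtain rfl := eq_of_heq (Sigma.mk.inj h3).2
    obtain rfl := hS p hp q hq _ _ _ h1 h1'
    exact eq_of_heq (Sigma.ext_iff.1 hqw).2
  refine ⟨ϑ, (h.instance_eq.symm.subst ϑ).trans ?_⟩
  rw [← subst_comp]
  refine (Eqv.subst_congr (θ' := Subst.id) _ fun Z hZ => ?_).trans (.of_eq (subst_id _))
  obtain ⟨p, hp | hp, rfl⟩ := h.occurs Z hZ
  · exact hp.elim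
  · exact he₂ p hp ϑ (hϑ p hp)

/-- Every pattern generalization is at least as general as one that is computed. -/
theorem exists_computes {t₁ t₂ : Tm 𝒮 Γ τ} (h₁ : t₁.IsNf) (h₂ : t₂.IsNf) (X : ℕ)
    {s : Tm 𝒮 [] (arrows Γ τ)} (hs : IsPatternGeneralization s (lams Γ t₁) (lams Γ t₂)) :
    ∃ ς : Subst 𝒮, Computes X t₁ t₂ ς ∧ MoreGeneral s (ς.map (arrows Γ τ) X) := by
  let p₀ : AUP 𝒮 := ⟨Γ, τ, X, t₁, t₂⟩
  obtain ⟨v, D, hD, hv, hsv⟩ := exists_reduced_of_isPatternGeneralization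
    (T := fun i => lams Γ (p₀.side i)) hs
  obtain ⟨p, hvp, hp, hpo⟩ := hv.pat
  obtain ⟨p', rfl, hp'⟩ := isNfPattern_arrows hp
  obtain ⟨q, hpq, hq, hqo⟩ := hp'.exists_comb
  have hvq : Eqv .assoc v (lams Γ q) := (Eqv.of_empty hvp).trans (lams_congr hpq)
  choose θ hθ hinst using hv.solves
  have hsolv : Solvable θ (lams Γ q) X q := solvable hD hθ hq fun Z hZ =>
    hv.occurs Z (hpo Z ((occurs_lams _ _).2 (hqo Z hZ)))
  -- At the start the computed term is the variable `X`, which `κ` maps to the guiding pattern.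
  let κ : Subst 𝒮 := .single X (lams Γ q)
  have hinv : Invariant θ (lams Γ q) X ⟨insert p₀ ∅, ∅, Subst.id⟩ κ := by
    refine ⟨by simp, Set.finite_empty, fun Z hZ => ⟨p₀, .inl (.inl rfl), hZ⟩, ?_, by simp⟩
    refine .of_eq ((subst_fvar _ _).trans ?_)
    exact single_self _ _
  obtain ⟨S, ς, κ', h3, h4, -⟩ := hsolv X t₁ t₂ ∅ ∅ Subst.id κ ⟨.of_eq (single_self _ _), by
      intro i
      refine ⟨eqv_of_lams (Γ := Γ) ?_, ?_⟩
      · rw [← lams_subst]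
        exact (hvq.symm.subst (θ i)).trans (hinst i)
      · cases i
        · exact h₂
        · exact h₁⟩ (by simp) hinv
  obtain ⟨S', ς', h5, h6, h7⟩ := h4.merge _ S ς rfl
  refine ⟨ς', ⟨S', ?_⟩, hsv.trans ((MoreGeneral.of_eqv hvq).trans (h6.moreGeneral h7))⟩
  have := h3.trans h5
  rwa [insert_empty_eq] at this

end AntiUnif

theorem mainTheorem1 (𝒮 : AntiUnif.Sig.{u}) (Γ : List (AntiUnif.Ty 𝒮.Base))
    (τ : AntiUnif.Ty 𝒮.Base) (t₁ t₂ : AntiUnif.Tm 𝒮 Γ τ) (h₁ : t₁.IsNf) (h₂ : t₂.IsNf)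
    (X : ℕ) (hX₁ : ¬ t₁.Occurs ⟨AntiUnif.arrows Γ τ, X⟩)
    (hX₂ : ¬ t₂.Occurs ⟨AntiUnif.arrows Γ τ, X⟩) :
    (∀ s : AntiUnif.Tm 𝒮 Γ τ,
      AntiUnif.IsPatternGeneralization (s.lams Γ) (t₁.lams Γ) (t₂.lams Γ) →
        ∃ σ : AntiUnif.Subst 𝒮, AntiUnif.Computes X t₁ t₂ σ ∧
          AntiUnif.MoreGeneral (s.lams Γ) (σ.map (AntiUnif.arrows Γ τ) X)) ∧
    (∀ σ : AntiUnif.Subst 𝒮, AntiUnif.Computes X t₁ t₂ σ →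
      AntiUnif.IsPatternGeneralization (σ.map (AntiUnif.arrows Γ τ) X)
        (t₁.lams Γ) (t₂.lams Γ)) :=
  ⟨fun _ hs => AntiUnif.exists_computes h₁ h₂ X hs, fun _ hσ => hσ.isPatternGeneralization⟩
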